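/- **Notation.** Let $q,t\in\mathbb C$ with $|q|<1$, $|t|<1$. Write $(q;q)_m=\prod_{i=1}^m(1-q^i)$ and let $$h_m(z;q)=\sum_{k=0}^m\frac{(q;q)_m}{(q;q)_k(q;q)_{m-k}}z^k$$ be the Rogers–Szegő polynomials. For a partition $\kappa$ in which the part $i$ has multiplicity $m_i$, put $$h_\kappa(a,b;q)=\prod_{i\ge1}a^{m_{2i-1}}h_{m_{2i-1}}(b/a;q)\,h_{m_{2i}}(ab;q),$$ which is a polynomial in $a,b$ and is read as such when $a=0$. Let $\lambda'$ denote the conjugate of the partition $\lambda$ and $|\lambda|$ its size. Let $\Lambda=\mathbb C[p_1,p_2,\dots]$ be the ring of symmetric functions, $p_k$ being the power sums, with the bilinear form determined by $\langle p_\lambda,p_\mu\rangle=\delta_{\lambda\mu}z_\lambda\prod_i\frac{1-q^{\lambda_i}}{1-t^{\lambda_i}}$, where $p_\lambda=\prod_i p_{\lambda_i}$ and $z_\lambda=\prod_i m_i(\lambda)!\,i^{m_i(\lambda)}$. The Macdonald functions $P_\lambda(q,t)$ are the pairwise orthogonal family in $\Lambda$ that is upper unitriangular with respect to the monomial symmetric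 functions in the dominance order. Let $Q_\lambda=P_\lambda/\langle P_\lambda,P_\lambda\rangle$, and let $P_{\lambda/\mu}\in\Lambda$ be defined by $\langle P_{\lambda/\mu},Q_\nu\rangle=\langle P_\lambda,Q_\mu Q_\nu\rangle$ for all $\nu$. The skew $q$-Whittaker polynomial $P_{\lambda/\mu}(x;q,0)$ in a finite alphabet $x$ is obtained by setting the second Macdonald parameter to $0$ in these definitions and substituting $p_k=\sum_i x_i^k$. For an integer $n\ge0$, an alphabet $x=(x_1,\dots,x_N)\in\mathbb C^N$ and $a,b,c,d\in\mathbb C$, let $$Z_n(x;q,t;a,b,c,d)=\sum_{\substack{\mu\subseteq\lambda\\ \lambda_1\le n}}\frac{h_{n-\lambda_1}(ab;q)\,h_{\lambda'}(a,b;q)}{(q;q)_{n-\lambda_1}\prod_{i\ge1}(q;q)_{\lambda_i-\lambda_{i+1}}}\;P_{\lambda/\mu}(x;q,0)\;t^{|\mu|/2}\,h_{\mu'}\!\left(\tfrac{c}{\sqrt t},\tfrac{d}{\sqrt t};q\right),$$ the sum being over all pairs of partitions $\mu\subseteq\lambda$ with $\lambda_1\le n$. The factor $t^{|\mu|/2}h_{\mu'}(c/\sqrt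 t,d/\sqrt t;q)$ is a polynomial in $t,c,d$ and is read as such (in particular for $t=0$). **Proposition.** Let $n,N\ge0$ be integers, $x\in\mathbb C^N$, $q,t,a,b,c,d\in\mathbb C$ with $|q|,|t|<1$, and let $(x,a,b,c,d)$ denote the combined alphabet $(a,b,c,d,x_1,\dots,x_N)$. The series defining $Z_n(x;q,t;a,b,c,d)$ and $Z_n((x,a,b,c,d);q,t;0,0,0,0)$ converge absolutely, and $$Z_n(x;q,t;a,b,c,d)=Z_n\big((x,a,b,c,d);q,t;0,0,0,0\big).$$ In particular $Z_n(x;q,t;a,b,c,d)$ is invariant under all permutations of $(a,b,c,d)$. -/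

import Mathlib

noncomputable section

namespace FreeBoundary

/-! ### The ring of symmetric functions and the Macdonald inner product -/

/-- The ring of symmetric functions over `ℂ`, as the polynomial ring in the power sums:
the variable `X k` is the power sum `p_k`, `k ≥ 1`. -/
abbrev SymFun : Type := MvPolynomial ℕ+ ℂ

/-- The norm `⟨p_κ, p_κ⟩ = z_κ ∏_i (1 - q^{κ_i}) / (1 - t^{κ_i})` of the power sum product
`p_κ = ∏_k p_k ^ (m k)`, where `m k` is the number of parts of `κ` equal to `k` and
`z_κ = ∏_k (m k)! k^{m k}`. -/
def powerSumNorm (q t : ℂ) (m : ℕ+ →₀ ℕ) : ℂ :=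
  m.prod fun k e =>
    (e.factorial : ℂ) * ((k : ℕ) : ℂ) ^ e * ((1 - q ^ (k : ℕ)) / (1 - t ^ (k : ℕ))) ^ e

/-- The bilinear form on symmetric functions for which the products of power sums are
orthogonal, with norms `powerSumNorm`. -/
def macInner (q t : ℂ) (f g : SymFun) : ℂ :=
  ∑ m ∈ f.support, f.coeff m * g.coeff m * powerSumNorm q t m

/-- The value of a symmetric function on a finite alphabet: `p_k ↦ ∑_i (x i)^k`. -/
def evalAlphabet {R : Type*} [CommRing R] [Algebra ℂ R] {N : ℕ} (x : Fin N → R) :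
    SymFun →ₐ[ℂ] R :=
  MvPolynomial.aeval fun k : ℕ+ => ∑ i, x i ^ (k : ℕ)

/-- The coefficient of the monomial symmetric function `m_μ` in `f`: with `ℓ` the number of
parts of `μ`, this is the coefficient of `x_1^{μ_1} ⋯ x_ℓ^{μ_ℓ}` in `f(x_1, …, x_ℓ)`. -/
def monomialCoeff (f : SymFun) (μ : YoungDiagram) : ℂ :=
  MvPolynomial.coeff (Finsupp.equivFunOnFinite.symm fun i : Fin (μ.colLen 0) => μ.rowLen i)
    (evalAlphabet (fun i : Fin (μ.colLen 0) => (MvPolynomial.X i : MvPolynomial _ ℂ)) f)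

/-- The dominance order: `μ ≤ lam` for partitions of the same size. -/
def DominatedBy (μ lam : YoungDiagram) : Prop :=
  μ.card = lam.card ∧
    ∀ k : ℕ, ∑ i ∈ Finset.range k, μ.rowLen i ≤ ∑ i ∈ Finset.range k, lam.rowLen i

/-! ### Macdonald symmetric functions -/

/-- The defining properties of the family of Macdonald symmetric functions `P_lam(q,t)`:
unitriangular in the monomial basis with respect to dominance, and pairwise orthogonal. -/
structure IsMacdonaldFamily (q t : ℂ) (P : YoungDiagram → SymFun) : Prop where
  coeff_self : ∀ lam, monomialCoeff (P lam) lam = 1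
  triangular : ∀ lam μ, monomialCoeff (P lam) μ ≠ 0 → DominatedBy μ lam
  orthogonal : ∀ lam μ, lam ≠ μ → macInner q t (P lam) (P μ) = 0

/-- The Macdonald symmetric functions `P_lam(q,t)`: the family with the properties
`IsMacdonaldFamily`. -/
def macdonaldP (q t : ℂ) : YoungDiagram → SymFun :=
  Classical.epsilon (IsMacdonaldFamily q t)

/-- The basis dual to the `P_lam(q,t)`: `Q_lam = P_lam / ⟨P_lam, P_lam⟩`. -/
def macdonaldQ (q t : ℂ) (lam : YoungDiagram) : SymFun :=
  (macInner q t (macdonaldP q t lam) (macdonaldP q t lam))⁻¹ • macdonaldP q t lam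

/-- The skew Macdonald symmetric function `P_{lam/μ}(q,t)`: the element determined by
`⟨P_{lam/μ}, Q_ν⟩ = ⟨P_lam, Q_μ Q_ν⟩` for all `ν`. -/
def skewMacdonaldP (q t : ℂ) (lam μ : YoungDiagram) : SymFun :=
  Classical.epsilon fun f : SymFun => ∀ ν : YoungDiagram,
    macInner q t f (macdonaldQ q t ν) =
      macInner q t (macdonaldP q t lam) (macdonaldQ q t μ * macdonaldQ q t ν)

/-- The skew `q`-Whittaker polynomial `P_{lam/μ}(x_1, …, x_N; q, 0)`. -/
def skewWhittaker {N : ℕ} (q : ℂ) (lam μ : YoungDiagram) (x : Fin N → ℂ) : ℂ :=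
  evalAlphabet x (skewMacdonaldP q 0 lam μ)

/-! ### Rogers--Szegő polynomials and the boundary functions -/

/-- The `q`-Pochhammer symbol `(q;q)_m`. -/
def qPoch (q : ℂ) (m : ℕ) : ℂ := ∏ i ∈ Finset.range m, (1 - q ^ (i + 1))

/-- The Gaussian binomial coefficient (used for `k ≤ m`). -/
def qBinom (q : ℂ) (m k : ℕ) : ℂ := qPoch q m / (qPoch q k * qPoch q (m - k))

/-- The Rogers--Szegő polynomial `h_m(z;q)`. -/
def rogersSzego (q : ℂ) (m : ℕ) (z : ℂ) : ℂ :=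
  ∑ k ∈ Finset.range (m + 1), qBinom q m k * z ^ k

/-- The homogeneous Rogers--Szegő polynomial `a^m h_m(b/a;q)`, written as a polynomial so that
it also makes sense for `a = 0`. -/
def rogersSzegoHom (q : ℂ) (m : ℕ) (a b : ℂ) : ℂ :=
  ∑ k ∈ Finset.range (m + 1), qBinom q m k * (a ^ (m - k) * b ^ k)

theorem rogersSzegoHom_eq (q : ℂ) (m : ℕ) {a : ℂ} (b : ℂ) (ha : a ≠ 0) :
    rogersSzegoHom q m a b = a ^ m * rogersSzego q m (b / a) := by
  unfold rogersSzegoHom rogersSzego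
  rw [Finset.mul_sum]
  refine Finset.sum_congr rfl fun k hk => ?_
  have hk' : k ≤ m := Nat.lt_succ_iff.mp (Finset.mem_range.mp hk)
  obtain ⟨e, rfl⟩ := Nat.exists_eq_add_of_le hk'
  rw [Nat.add_sub_cancel_left, div_pow, pow_add]
  field_simp

/-- The multiplicity `m_{j+1}` of `j + 1` as a part of the partition `κ`. -/
def partMult (κ : YoungDiagram) (j : ℕ) : ℕ := κ.colLen j - κ.colLen (j + 1)

/-- The function `h_κ(a,b;q) = ∏_{i ≥ 1} a^{m_{2i-1}} h_{m_{2i-1}}(b/a;q) h_{m_{2i}}(ab;q)`, where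
`m_k` is the multiplicity of `k` in `κ`. The factor with index `j` belongs to the part `j + 1`. -/
def hPart (q : ℂ) (κ : YoungDiagram) (a b : ℂ) : ℂ :=
  ∏ j ∈ Finset.range (κ.rowLen 0),
    if Even j then rogersSzegoHom q (partMult κ j) a b
    else rogersSzego q (partMult κ j) (a * b)

/-- The expression `t^{|κ|/2} h_κ(c/√t, d/√t; q)`. It is a polynomial in `t`, `c`, `d`, and is
written as such, so that no root has to be chosen and `t = 0` is allowed;
see `hPartScaled_sq`. -/
def hPartScaled (q t : ℂ) (κ : YoungDiagram) (c d : ℂ) : ℂ :=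
  ∏ j ∈ Finset.range (κ.rowLen 0),
    t ^ (j / 2 * partMult κ j) *
      if Even j then rogersSzegoHom q (partMult κ j) c d
      else rogersSzegoHom q (partMult κ j) t (c * d)

theorem card_eq_sum_partMult (κ : YoungDiagram) :
    κ.card = ∑ j ∈ Finset.range (κ.rowLen 0), (j + 1) * partMult κ j := by
  have h1 : κ.card = ∑ j ∈ Finset.range (κ.rowLen 0), κ.colLen j := by
    have : Set.MapsTo (Prod.snd : ℕ × ℕ → ℕ) κ.cells (Finset.range (κ.rowLen 0)) := by
      rintro ⟨i, j⟩ hc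
      have hc' : (i, j) ∈ κ := hc
      have h0 : (0, j) ∈ κ := κ.up_left_mem (Nat.zero_le i) le_rfl hc'
      simpa using YoungDiagram.mem_iff_lt_rowLen.mp h0
    rw [YoungDiagram.card, Finset.card_eq_sum_card_fiberwise this]
    refine Finset.sum_congr rfl fun j _ => ?_
    rw [YoungDiagram.colLen_eq_card, YoungDiagram.col]
  have h2 : ∀ n, ∑ j ∈ Finset.range n, (j + 1) * partMult κ j + n * κ.colLen n =
      ∑ j ∈ Finset.range n, κ.colLen j := by
    intro n
    induction n with
    | zero => simp
    | succ n ih =>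
      rw [Finset.sum_range_succ, Finset.sum_range_succ, ← ih, partMult]
      obtain ⟨e, he⟩ := Nat.exists_eq_add_of_le (κ.colLen_anti n (n + 1) (Nat.le_succ n))
      rw [he, Nat.add_sub_cancel_left]
      ring
  have h3 : κ.colLen (κ.rowLen 0) = 0 := by
    by_contra h
    have : (0, κ.rowLen 0) ∈ κ :=
      YoungDiagram.mem_iff_lt_colLen.mpr (Nat.pos_of_ne_zero h)
    exact lt_irrefl _ (YoungDiagram.mem_iff_lt_rowLen.mp this)
  have h4 := h2 (κ.rowLen 0)
  rw [h3, mul_zero, add_zero] at h4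
  rw [h1, h4]

/-- For `t = s² ≠ 0`, the polynomial `hPartScaled` is `√t^{|κ|} h_κ(c/√t, d/√t; q)`, `√t = s`. -/
theorem hPartScaled_sq (q : ℂ) (κ : YoungDiagram) (c d : ℂ) {s : ℂ} (hs : s ≠ 0) :
    hPartScaled q (s ^ 2) κ c d = s ^ κ.card * hPart q κ (c / s) (d / s) := by
  rw [card_eq_sum_partMult, ← Finset.prod_pow_eq_pow_sum, hPart, hPartScaled,
    ← Finset.prod_mul_distrib]
  refine Finset.prod_congr rfl fun j _ => ?_
  generalize partMult κ j = m
  by_cases hj : Even j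
  · obtain ⟨r, rfl⟩ := id hj
    have hr : (r + r) / 2 = r := by omega
    have key : rogersSzegoHom q m c d = s ^ m * rogersSzegoHom q m (c / s) (d / s) := by
      unfold rogersSzegoHom
      rw [Finset.mul_sum]
      refine Finset.sum_congr rfl fun k hk => ?_
      have hk' : k ≤ m := Nat.lt_succ_iff.mp (Finset.mem_range.mp hk)
      obtain ⟨e, rfl⟩ := Nat.exists_eq_add_of_le hk'
      rw [Nat.add_sub_cancel_left, div_pow, div_pow, pow_add]
      field_simp
    rw [if_pos hj, if_pos hj, hr]
    rw [key, ← mul_assoc]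
    congr 1
    ring
  · obtain ⟨r, rfl⟩ := Nat.not_even_iff_odd.mp hj
    have hr : (2 * r + 1) / 2 = r := by omega
    have key : rogersSzegoHom q m (s ^ 2) (c * d) =
        s ^ (2 * m) * rogersSzego q m (c / s * (d / s)) := by
      rw [rogersSzegoHom_eq q m (c * d) (pow_ne_zero 2 hs), ← pow_mul]
      congr 2
      field_simp
    rw [if_neg hj, if_neg hj, hr]
    rw [key, ← mul_assoc]
    congr 1
    ring

/-! ### The sum `Z_n` -/

/-- The pairs of partitions `μ ⊆ lam` with `lam_1 ≤ n`; the first component is `lam`. -/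
def PartitionPair (n : ℕ) : Type :=
  {p : YoungDiagram × YoungDiagram // p.2 ≤ p.1 ∧ p.1.rowLen 0 ≤ n}

/-- The summand of `Z_n(x;q,t;a,b,c,d)` belonging to the pair `μ ⊆ lam`. -/
def zTerm (n : ℕ) {N : ℕ} (x : Fin N → ℂ) (q t a b c d : ℂ) (p : PartitionPair n) : ℂ :=
  let lam := p.1.1
  let μ := p.1.2
  rogersSzego q (n - lam.rowLen 0) (a * b) * hPart q lam.transpose a b /
      (qPoch q (n - lam.rowLen 0) *
        ∏ i ∈ Finset.range (lam.colLen 0), qPoch q (lam.rowLen i - lam.rowLen (i + 1))) *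
    skewWhittaker q lam μ x * hPartScaled q t μ.transpose c d

/-- The sum `Z_n(x;q,t;a,b,c,d)` over all pairs of partitions `μ ⊆ lam` with `lam_1 ≤ n`. -/
def Z (n : ℕ) {N : ℕ} (x : Fin N → ℂ) (q t a b c d : ℂ) : ℂ :=
  ∑' p : PartitionPair n, zTerm n x q t a b c d p

end FreeBoundary

end

/-!
# Moving the boundary parameters of `Z_n` into the alphabet

All objects live in the ring of symmetric functions `Λ`, with the operator `T_x : f ↦ f[X + x]`
(`addVarAt`) that adds a variable. A partition is encoded by its column multiplicities
`m : ℕ →₀ ℕ`, where `m i` is the number of columns of length `i + 1`, because the boundary weights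
are products over the column lengths.

*The `q`-Whittaker functions.* They are constructed as products of vertex operators `B_r`, one for
each column (`whittaker`). The relations `B_{r-1} B_r = q B_r B_{r-1}` and
`T_x B_r = (B_r + x B_{r-1}) T_x`, together with the `q`-binomial theorem for `q`-commuting
elements, give the branching rule `addVarAt_whittaker`
`T_x P_m = ∑_{k ≤ m} ∏_i [m_i choose k_i]_q x^{|k|} P_{m - k + shorten k}`:
`k_i` of the `m_i` columns of length `i + 1` lose a box. Iterated, it yields the triangularity in
the monomial basis. Orthogonality comes from the adjointness of `∑_r g_r x^r` and `T_x`
(`macInner_completeSym_mul`), by stripping first rows. Since the defining properties determine the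
Macdonald functions, `macdonaldP q 0` is this family (`macdonaldP_eq_whittaker`), and the skew
`q`-Whittaker polynomials are the matrix coefficients of the operator that adds the whole alphabet
(`skewWhittaker_eq_repr`).

*The sum.* Hence `Z_n(x; a, b, c, d)` is the pairing `∑_m L_{ab}(m) R_{cd}(T_x P_m)` of a left weight
and a linear functional `R_{cd}` (`Z_eq_tsum`), and each parameter is exchanged for a variable
separately:

* `R_{c0} ∘ T_d = R_{cd}` (`rightFunctional_addVarAt`): with one parameter the right weight is
  multiplicative over the columns, so the branching sum factors into Rogers–Szegő polynomials.
* the transpose of `T_b` maps `L_{a0}` to `L_{ab}` (`tsum_leftWeight_addVarAt`), for the same reason;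
  the factor `h_{n - λ_1}(ab)` arises from the columns of length `1` that disappear.

As `L_{0a} = L_{a0}` and `R_{0c} = R_{c0}`, two steps at each boundary reach the parameters `0`.
The identity for the left boundary interchanges infinite sums. This is legitimate because on
partitions with at most `n` columns the left weights and the branching coefficients are bounded and
the right weights decay like `√|t|^{|μ|}`, up to enlarging `√|t|`; all sums are dominated by
`∑ ρ^{|m|}` with `ρ < 1` (`summable_pow_colSize`, `exists_weightedNorm_addAlphabet_le`).
-/

noncomputable section

namespace FreeBoundary

/-! ### Power series with a given logarithmic derivative -/

section ExpSeries

variable {R : Type*} [CommRing R] [Algebra ℂ R]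

/-- The coefficients of the power series `F` with `F(0) = 1` and `F' = a F`. -/
def expCoeff (a : ℕ → R) : ℕ → R
  | 0 => 1
  | n + 1 => ((n + 1 : ℕ) : ℂ)⁻¹ • ∑ i : Fin (n + 1), a i * expCoeff a (n - i)

/-- The power series `F` with `F(0) = 1` and `F' = a F`, that is, the exponential of the
integral of `a`. -/
def expSeries (a : PowerSeries R) : PowerSeries R :=
  PowerSeries.mk (expCoeff fun i => PowerSeries.coeff i a)

theorem constantCoeff_expSeries (a : PowerSeries R) :
    PowerSeries.constantCoeff (expSeries a) = 1 := by
  rw [← PowerSeries.coeff_zero_eq_constantCoeff_apply, expSeries, PowerSeries.coeff_mk, expCoeff]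

theorem smul_expCoeff_succ (a : ℕ → R) (n : ℕ) :
    ((n + 1 : ℕ) : ℂ) • expCoeff a (n + 1) =
      ∑ i ∈ Finset.range (n + 1), a i * expCoeff a (n - i) := by
  have h : ((n + 1 : ℕ) : ℂ) ≠ 0 := Nat.cast_ne_zero.mpr n.succ_ne_zero
  rw [expCoeff, smul_smul, mul_inv_cancel₀ h, one_smul,
    Fin.sum_univ_eq_sum_range (fun i => a i * expCoeff a (n - i))]

theorem derivative_expSeries (a : PowerSeries R) :
    PowerSeries.derivative R (expSeries a) = a * expSeries a := by
  ext n
  rw [PowerSeries.coeff_derivative, expSeries, PowerSeries.coeff_mk, PowerSeries.coeff_mul,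
    Finset.Nat.sum_antidiagonal_eq_sum_range_succ_mk]
  simp only [PowerSeries.coeff_mk]
  rw [← smul_expCoeff_succ, Algebra.smul_def, mul_comm]
  simp

theorem eq_zero_of_derivative_eq_mul {a F : PowerSeries R}
    (hF : PowerSeries.derivative R F = a * F) (h0 : PowerSeries.constantCoeff F = 0) : F = 0 := by
  have key : ∀ n, PowerSeries.coeff n F = 0 := by
    intro n
    induction n using Nat.strong_induction_on with
    | _ n ih =>
      cases n with
      | zero => rw [PowerSeries.coeff_zero_eq_constantCoeff_apply, h0]
      | succ n =>
        have h1 := congrArg (PowerSeries.coeff n) hF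
        rw [PowerSeries.coeff_derivative, PowerSeries.coeff_mul, Finset.sum_eq_zero] at h1
        · have h2 : ((n + 1 : ℕ) : ℂ) ≠ 0 := Nat.cast_ne_zero.mpr n.succ_ne_zero
          have h3 : ((n + 1 : ℕ) : ℂ) • PowerSeries.coeff (n + 1) F = 0 := by
            rw [Algebra.smul_def, mul_comm, ← h1]
            simp
          rw [← one_smul ℂ (PowerSeries.coeff (n + 1) F), ← inv_mul_cancel₀ h2, mul_smul, h3,
            smul_zero]
        · rintro ⟨i, j⟩ hij
          rw [Finset.HasAntidiagonal.mem_antidiagonal] at hij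
          rw [ih j (by simp only at hij; omega), mul_zero]
  ext n
  rw [key, map_zero]

theorem eq_expSeries {a F : PowerSeries R} (h0 : PowerSeries.constantCoeff F = 1)
    (hF : PowerSeries.derivative R F = a * F) : F = expSeries a := by
  refine sub_eq_zero.mp (eq_zero_of_derivative_eq_mul (a := a) ?_ ?_)
  · rw [map_sub, hF, derivative_expSeries, mul_sub]
  · rw [map_sub, h0, constantCoeff_expSeries, sub_self]

theorem expSeries_add (a b : PowerSeries R) :
    expSeries (a + b) = expSeries a * expSeries b := by
  refine (eq_expSeries ?_ ?_).symm
  · rw [map_mul, constantCoeff_expSeries, constantCoeff_expSeries, one_mul]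
  · rw [Derivation.leibniz, derivative_expSeries, derivative_expSeries, smul_eq_mul, smul_eq_mul]
    ring

theorem map_expSeries {S : Type*} [CommRing S] [Algebra ℂ S] (φ : R →+* S)
    (a : PowerSeries R) :
    PowerSeries.map φ (expSeries a) = expSeries (PowerSeries.map φ a) := by
  refine eq_expSeries ?_ ?_
  · rw [← PowerSeries.coeff_zero_eq_constantCoeff_apply, PowerSeries.coeff_map,
      PowerSeries.coeff_zero_eq_constantCoeff_apply, constantCoeff_expSeries, map_one]
  · rw [← map_mul, ← derivative_expSeries]
    ext n
    simp [PowerSeries.coeff_derivative]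

theorem rescale_expSeries (c : R) (a : PowerSeries R) :
    PowerSeries.rescale c (expSeries a) =
      expSeries (PowerSeries.C c * PowerSeries.rescale c a) := by
  refine eq_expSeries ?_ ?_
  · rw [← PowerSeries.coeff_zero_eq_constantCoeff_apply, PowerSeries.coeff_rescale,
      PowerSeries.coeff_zero_eq_constantCoeff_apply, constantCoeff_expSeries, pow_zero, one_mul]
  · rw [mul_assoc, ← map_mul, ← derivative_expSeries]
    ext n
    rw [PowerSeries.coeff_derivative, PowerSeries.coeff_C_mul, PowerSeries.coeff_rescale,
      PowerSeries.coeff_rescale, PowerSeries.coeff_derivative]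
    ring

end ExpSeries

/-! ### Elementary and complete symmetric functions -/

/-- The power sum `p_{n+1}`. -/
def psumSucc (n : ℕ) : SymFun := MvPolynomial.X n.succPNat

/-- The series `∑_r e_r y^r = exp(∑_k (-1)^{k-1} p_k y^k / k)` of elementary symmetric
functions. -/
def elemSeries : PowerSeries SymFun :=
  expSeries (PowerSeries.mk fun n => (-1 : ℂ) ^ n • psumSucc n)

/-- The series `∑_r g_r y^r = exp(∑_k p_k y^k / (k (1 - q^k)))`, whose value on an alphabet `x`
is `∏_i 1 / (x_i y; q)_∞`. -/
def completeSeries (q : ℂ) : PowerSeries SymFun :=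
  expSeries (PowerSeries.mk fun n => (1 - q ^ (n + 1))⁻¹ • psumSucc n)

/-- The elementary symmetric function `e_r`, for an integer index; it is `0` for `r < 0`. -/
def elemSym (r : ℤ) : SymFun :=
  if 0 ≤ r then PowerSeries.coeff r.toNat elemSeries else 0

/-- The symmetric function `g_r(q, 0)`, the coefficient of `y ^ r` in `completeSeries`. -/
def completeSym (q : ℂ) (r : ℕ) : SymFun := PowerSeries.coeff r (completeSeries q)

theorem elemSym_natCast (r : ℕ) : elemSym r = PowerSeries.coeff r elemSeries := by
  simp [elemSym]

theorem elemSym_of_neg {r : ℤ} (h : r < 0) : elemSym r = 0 := by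
  rw [elemSym, if_neg (not_le.mpr h)]

theorem elemSym_zero : elemSym 0 = 1 := by
  have := elemSym_natCast 0
  rw [Nat.cast_zero] at this
  rw [this, PowerSeries.coeff_zero_eq_constantCoeff_apply, elemSeries, constantCoeff_expSeries]

theorem completeSym_zero (q : ℂ) : completeSym q 0 = 1 := by
  rw [completeSym, PowerSeries.coeff_zero_eq_constantCoeff_apply, completeSeries,
    constantCoeff_expSeries]

theorem smul_completeSym_succ (q : ℂ) (n : ℕ) :
    ((n + 1 : ℕ) : ℂ) • completeSym q (n + 1) =
      ∑ i ∈ Finset.range (n + 1),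
        (1 - q ^ (i + 1))⁻¹ • (psumSucc i * completeSym q (n - i)) := by
  simp only [completeSym, completeSeries, expSeries, PowerSeries.coeff_mk, smul_expCoeff_succ,
    smul_mul_assoc]

theorem one_sub_pow_ne_zero {q : ℂ} (hq : ‖q‖ < 1) (n : ℕ) : 1 - q ^ (n + 1) ≠ 0 := by
  intro h
  have h1 : ‖q ^ (n + 1)‖ = 1 := by rw [← sub_eq_zero.mp h, norm_one]
  rw [norm_pow] at h1
  exact absurd h1 (pow_lt_one₀ (norm_nonneg q) hq n.succ_ne_zero).ne

/-- The functional equation `E(-y) G(y) = G(q y)`. -/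
theorem rescale_elemSeries_mul_completeSeries {q : ℂ} (hq : ‖q‖ < 1) :
    PowerSeries.rescale (-1) elemSeries * completeSeries q =
      PowerSeries.rescale (algebraMap ℂ SymFun q) (completeSeries q) := by
  rw [elemSeries, completeSeries, rescale_expSeries, rescale_expSeries, ← expSeries_add]
  congr 1
  ext1 n
  rw [map_add, PowerSeries.coeff_C_mul, PowerSeries.coeff_C_mul, PowerSeries.coeff_rescale,
    PowerSeries.coeff_rescale, PowerSeries.coeff_mk, PowerSeries.coeff_mk]
  have h1 : (-1 : SymFun) ^ n * (-1 : ℂ) ^ n • psumSucc n = psumSucc n := by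
    rw [Algebra.smul_def, map_pow, map_neg, map_one, ← mul_assoc, ← mul_pow]
    simp
  have h2 : algebraMap ℂ SymFun q * (algebraMap ℂ SymFun q ^ n *
      (1 - q ^ (n + 1))⁻¹ • psumSucc n) = (q ^ (n + 1) * (1 - q ^ (n + 1))⁻¹) • psumSucc n := by
    rw [← mul_assoc, ← pow_succ', ← map_pow, ← Algebra.smul_def, smul_smul]
  have h3 : q ^ (n + 1) * (1 - q ^ (n + 1))⁻¹ = (1 - q ^ (n + 1))⁻¹ - 1 := by
    have := one_sub_pow_ne_zero hq n
    field_simp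
    ring
  rw [h2, h3, sub_smul, one_smul]
  linear_combination -h1

theorem sum_elemSym_mul_completeSym {q : ℂ} (hq : ‖q‖ < 1) (a : ℕ) :
    ∑ k ∈ Finset.range (a + 1), (-1) ^ k * elemSym k * completeSym q (a - k) =
      q ^ a • completeSym q a := by
  have h := congrArg (PowerSeries.coeff a) (rescale_elemSeries_mul_completeSeries hq)
  rw [PowerSeries.coeff_rescale, PowerSeries.coeff_mul,
    Finset.Nat.sum_antidiagonal_eq_sum_range_succ_mk, ← map_pow, ← Algebra.smul_def] at h
  simp only [PowerSeries.coeff_rescale, ← elemSym_natCast] at h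
  exact h

/-! ### Translations of the power sums -/

/-- The translation `p_k ↦ p_k + c_{k-1} X^k` of symmetric functions. -/
def transl (c : ℕ → ℂ) : SymFun →ₐ[ℂ] Polynomial SymFun :=
  MvPolynomial.aeval fun k : ℕ+ =>
    Polynomial.C (MvPolynomial.X k) + (c k.natPred) • Polynomial.X ^ (k : ℕ)

theorem transl_psumSucc (c : ℕ → ℂ) (n : ℕ) :
    transl c (psumSucc n) = Polynomial.C (psumSucc n) + c n • Polynomial.X ^ (n + 1) := by
  simp [transl, psumSucc]

/-- The coefficient of `X ^ i` in the translation `transl c`. -/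
def translCoeff (c : ℕ → ℂ) (i : ℕ) : SymFun →ₗ[ℂ] SymFun :=
  (Polynomial.lcoeff SymFun i).restrictScalars ℂ ∘ₗ (transl c).toLinearMap

theorem translCoeff_apply (c : ℕ → ℂ) (i : ℕ) (f : SymFun) :
    translCoeff c i f = (transl c f).coeff i := rfl

theorem translCoeff_mul_psumSucc (c : ℕ → ℂ) (i n : ℕ) (f : SymFun) :
    translCoeff c i (f * psumSucc n) =
      translCoeff c i f * psumSucc n +
        if n + 1 ≤ i then c n • translCoeff c (i - (n + 1)) f else 0 := by
  simp only [translCoeff_apply, map_mul, transl_psumSucc, mul_add, Polynomial.coeff_add,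
    Polynomial.coeff_mul_C, mul_smul_comm, Polynomial.coeff_smul, Polynomial.coeff_mul_X_pow',
    smul_ite, smul_zero]

theorem symFun_induction {p : SymFun → Prop} (f : SymFun) (h1 : p 1)
    (hadd : ∀ f g, p f → p g → p (f + g)) (hsmul : ∀ (a : ℂ) f, p f → p (a • f))
    (hmul : ∀ f n, p f → p (f * psumSucc n)) : p f := by
  induction f using MvPolynomial.induction_on with
  | C a =>
    have := hsmul a 1 h1
    rwa [MvPolynomial.smul_eq_C_mul, mul_one] at this
  | add f g hf hg => exact hadd f g hf hg
  | mul_X f k hf =>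
    have := hmul f k.natPred hf
    rwa [psumSucc, PNat.succPNat_natPred] at this

theorem transl_one_coeff (c : ℕ → ℂ) (i : ℕ) :
    translCoeff c i 1 = if i = 0 then 1 else 0 := by
  rw [translCoeff_apply, map_one, Polynomial.coeff_one]

/-- Translations of the power sums commute with each other. -/
theorem translCoeff_comm (c c' : ℕ → ℂ) (i j : ℕ) (f : SymFun) :
    translCoeff c i (translCoeff c' j f) = translCoeff c' j (translCoeff c i f) := by
  induction f using symFun_induction generalizing i j with
  | h1 =>
    rw [transl_one_coeff, transl_one_coeff]
    split_ifs <;> simp [transl_one_coeff, *]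
  | hadd f g hf hg => simp only [map_add, hf, hg]
  | hsmul a f hf => simp only [map_smul, hf]
  | hmul f n hf =>
    simp only [translCoeff_mul_psumSucc, map_add, apply_ite (translCoeff c i),
      apply_ite (translCoeff c' j), map_smul, map_zero]
    split_ifs <;> simp only [hf, add_zero]
    module

/-- The translation of a series `exp(∑ α_k p_k y^k / k)` multiplies it by a scalar series. -/
theorem map_transl_expSeries (c α : ℕ → ℂ) :
    PowerSeries.map (transl c : SymFun →+* Polynomial SymFun)
        (expSeries (PowerSeries.mk fun n => α n • psumSucc n)) =
      PowerSeries.map (Polynomial.C : SymFun →+* _)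
          (expSeries (PowerSeries.mk fun n => α n • psumSucc n)) *
        expSeries (PowerSeries.mk fun n =>
          (α n * c n) • (Polynomial.X : Polynomial SymFun) ^ (n + 1)) := by
  rw [map_expSeries, map_expSeries, ← expSeries_add]
  congr 1
  ext1 n
  simp only [PowerSeries.coeff_map, PowerSeries.coeff_mk, map_add, RingHom.coe_coe, map_smul,
    transl_psumSucc, smul_add, smul_smul]
  congr 1
  rw [Polynomial.smul_C]

theorem expSeries_smul_X_pow {β θ : ℕ → ℂ} (h0 : θ 0 = 1)
    (h : ∀ n : ℕ, ((n + 1 : ℕ) : ℂ) * θ (n + 1) = ∑ i ∈ Finset.range (n + 1), β i * θ (n - i)) :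
    expSeries (PowerSeries.mk fun n => β n • (Polynomial.X : Polynomial SymFun) ^ (n + 1)) =
      PowerSeries.mk fun n => θ n • Polynomial.X ^ n := by
  refine (eq_expSeries ?_ ?_).symm
  · rw [← PowerSeries.coeff_zero_eq_constantCoeff_apply, PowerSeries.coeff_mk, h0, one_smul,
      pow_zero]
  · ext1 n
    rw [PowerSeries.coeff_derivative, PowerSeries.coeff_mul, PowerSeries.coeff_mk,
      Finset.Nat.sum_antidiagonal_eq_sum_range_succ_mk]
    have h1 : ∀ i ∈ Finset.range (n + 1),
        PowerSeries.coeff i (PowerSeries.mk fun n =>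
            β n • (Polynomial.X : Polynomial SymFun) ^ (n + 1)) *
          PowerSeries.coeff (n - i) (PowerSeries.mk fun n =>
            θ n • (Polynomial.X : Polynomial SymFun) ^ n) =
        (β i * θ (n - i)) • (Polynomial.X : Polynomial SymFun) ^ (n + 1) := by
      intro i hi
      have hi' : i + 1 + (n - i) = n + 1 := by
        have := Finset.mem_range.mp hi
        omega
      rw [PowerSeries.coeff_mk, PowerSeries.coeff_mk, smul_mul_smul_comm, ← pow_add, hi']
    rw [Finset.sum_congr rfl h1, ← Finset.sum_smul, ← h n, mul_smul, mul_comm,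
      ← Nat.cast_succ, Nat.cast_smul_eq_nsmul, nsmul_eq_mul]

/-- If `θ` are the coefficients of `exp(∑ α_k c_k y^k / k)`, then the translation by `c` acts on
the coefficients of `exp(∑ α_k p_k y^k / k)` by convolution with `θ`. -/
theorem translCoeff_coeff_expSeries {c α θ : ℕ → ℂ} (h0 : θ 0 = 1)
    (h : ∀ n : ℕ, ((n + 1 : ℕ) : ℂ) * θ (n + 1) =
      ∑ i ∈ Finset.range (n + 1), α i * c i * θ (n - i)) (j r : ℕ) :
    translCoeff c j (PowerSeries.coeff r
        (expSeries (PowerSeries.mk fun n => α n • psumSucc n))) =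
      if j ≤ r then θ j • PowerSeries.coeff (r - j)
        (expSeries (PowerSeries.mk fun n => α n • psumSucc n)) else 0 := by
  have h1 := congrArg (PowerSeries.coeff r) (map_transl_expSeries c α)
  rw [PowerSeries.coeff_map, expSeries_smul_X_pow h0 h, mul_comm, PowerSeries.coeff_mul,
    Finset.Nat.sum_antidiagonal_eq_sum_range_succ_mk] at h1
  have h2 : ∀ F : SymFun, (transl c) F = (transl c : SymFun →+* Polynomial SymFun) F :=
    fun _ => rfl
  rw [translCoeff_apply, h2, h1, Polynomial.finsetSum_coeff]
  simp only [PowerSeries.coeff_mk, PowerSeries.coeff_map, smul_mul_assoc, Polynomial.coeff_smul,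
    Polynomial.coeff_mul_C, Polynomial.coeff_X_pow]
  by_cases hj : j ≤ r
  · rw [if_pos hj, Finset.sum_eq_single j]
    · rw [if_pos rfl, one_mul]
    · intro i _ hij
      rw [if_neg (Ne.symm hij), zero_mul, smul_zero]
    · intro hj'
      exact absurd (Finset.mem_range.mpr (Nat.lt_succ_of_le hj)) hj'
  · rw [if_neg hj]
    refine Finset.sum_eq_zero fun i hi => ?_
    rw [if_neg, zero_mul, smul_zero]
    have := Finset.mem_range.mp hi
    omega

theorem translCoeff_elemSym {c θ : ℕ → ℂ} (h0 : θ 0 = 1)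
    (h : ∀ n : ℕ, ((n + 1 : ℕ) : ℂ) * θ (n + 1) =
      ∑ i ∈ Finset.range (n + 1), (-1) ^ i * c i * θ (n - i)) (j : ℕ) (r : ℤ) :
    translCoeff c j (elemSym r) = θ j • elemSym (r - j) := by
  rcases lt_or_ge r 0 with hr | hr
  · rw [elemSym_of_neg hr, elemSym_of_neg (by omega), map_zero, smul_zero]
  · obtain ⟨r, rfl⟩ := Int.eq_ofNat_of_zero_le hr
    rw [elemSym_natCast, elemSeries, translCoeff_coeff_expSeries h0 h]
    split_ifs with hj
    · rw [← Nat.cast_sub hj, elemSym_natCast, elemSeries]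
    · rw [elemSym_of_neg (by omega), smul_zero]

/-- The coefficient of `x ^ i` in the operator `f[X] ↦ f[X + x]` that adds a variable `x` to the
alphabet. -/
def addVar (i : ℕ) : SymFun →ₗ[ℂ] SymFun := translCoeff (fun _ => 1) i

/-- The shift of the power sums in the vertex operators below, in the normalisation
`p_k ↦ p_k + (-1)^k (1 - q^k) X^k`. -/
def vertexShift (q : ℂ) (n : ℕ) : ℂ := (-1) ^ (n + 1) * (1 - q ^ (n + 1))

theorem addVar_elemSym (j : ℕ) (r : ℤ) :
    addVar j (elemSym r) = if j = 0 then elemSym r else if j = 1 then elemSym (r - 1) else 0 := by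
  rw [addVar, translCoeff_elemSym (θ := fun j => if j ≤ 1 then 1 else 0) rfl]
  · match j with
    | 0 => simp
    | 1 => simp
    | j + 2 => simp
  · intro n
    cases n with
    | zero => simp
    | succ n =>
      rw [if_neg (by omega), mul_zero, Finset.sum_range_succ, Finset.sum_range_succ,
        Finset.sum_eq_zero]
      · simp [pow_succ]
      · intro i hi
        have := Finset.mem_range.mp hi
        rw [if_neg (by omega), mul_zero]

/-- The coefficients of `(1 - z) / (1 - q z)`. -/
def vertexCoeff (q : ℂ) : ℕ → ℂ
  | 0 => 1
  | j + 1 => q ^ (j + 1) - q ^ j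

theorem translCoeff_vertexShift_elemSym (q : ℂ) (j : ℕ) (r : ℤ) :
    translCoeff (vertexShift q) j (elemSym r) = vertexCoeff q j • elemSym (r - j) := by
  refine translCoeff_elemSym rfl (fun n => ?_) j r
  have h1 : ∀ i, (-1 : ℂ) ^ i * vertexShift q i = q ^ (i + 1) - 1 := by
    intro i
    have : (-1 : ℂ) ^ i * (-1) ^ i = 1 := by rw [← mul_pow]; simp
    rw [vertexShift]
    linear_combination (q ^ (i + 1) - 1) * this
  simp only [h1]
  have h2 : ∑ i ∈ Finset.range n, (q ^ (i + 1) - 1) * vertexCoeff q (n - i) =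
      n * (q ^ (n + 1) - q ^ n) - (q ^ n - 1) := by
    rw [← Finset.sum_range_reflect]
    have h3 : ∀ j ∈ Finset.range n,
        (q ^ (n - 1 - j + 1) - 1) * vertexCoeff q (n - (n - 1 - j)) =
          (q ^ (n + 1) - q ^ n) - (q ^ (j + 1) - q ^ j) := by
      intro j hj
      have hj' := Finset.mem_range.mp hj
      have h4 : n - (n - 1 - j) = j + 1 := by omega
      obtain ⟨k, rfl⟩ := Nat.exists_eq_add_of_lt hj'
      have h5 : j + k + 1 - 1 - j = k := by omega
      rw [h4, h5, vertexCoeff]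
      ring
    rw [Finset.sum_congr rfl h3, Finset.sum_sub_distrib, Finset.sum_range_sub, Finset.sum_const,
      Finset.card_range, nsmul_eq_mul, pow_zero]
  rw [Finset.sum_range_succ, h2, Nat.sub_self, vertexCoeff, vertexCoeff]
  push_cast
  ring

theorem translCoeff_vertexShift_completeSym {q : ℂ} (hq : ‖q‖ < 1) (j r : ℕ) :
    translCoeff (vertexShift q) j (completeSym q r) =
      if j ≤ r then (-1 : ℂ) ^ j • completeSym q (r - j) else 0 := by
  refine translCoeff_coeff_expSeries (θ := fun j => (-1) ^ j) (pow_zero _) (fun n => ?_) j r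
  have h1 : ∀ i ∈ Finset.range (n + 1),
      (1 - q ^ (i + 1))⁻¹ * vertexShift q i * (-1) ^ (n - i) = (-1) ^ (n + 1) := by
    intro i hi
    have hi' : i + 1 + (n - i) = n + 1 := by
      have := Finset.mem_range.mp hi
      omega
    rw [vertexShift, ← hi', pow_add _ (i + 1), mul_left_comm,
      inv_mul_cancel₀ (one_sub_pow_ne_zero hq i), mul_one]
  rw [Finset.sum_congr rfl h1, Finset.sum_const, Finset.card_range, nsmul_eq_mul]

/-! ### Vertex operators -/

/-- The `SymFun`-linear functional `X ^ k ↦ e_{r+k}`. -/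
def elemPairing (r : ℤ) : Polynomial SymFun →ₗ[SymFun] SymFun :=
  Polynomial.lsum fun k => LinearMap.mulRight SymFun (elemSym (r + k))

/-- The vertex operator `B_r f = ∑_k e_{r+k} S_k f`, where `∑_k S_k f X^k` is the translation of
`f` by `vertexShift`. Up to the standard involution this is Jing's operator for the
Hall--Littlewood functions. -/
def vertexOp (q : ℂ) (r : ℤ) : Module.End ℂ SymFun :=
  (elemPairing r).restrictScalars ℂ ∘ₗ (transl (vertexShift q)).toLinearMap

theorem elemPairing_C_mul_X_pow (r : ℤ) (h : SymFun) (k : ℕ) :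
    elemPairing r (Polynomial.C h * Polynomial.X ^ k) = h * elemSym (r + k) := by
  rw [elemPairing, Polynomial.lsum_apply, Polynomial.C_mul_X_pow_eq_monomial,
    Polynomial.sum_monomial_index _ _ (by simp)]
  rfl

theorem elemPairing_X_pow_mul (r : ℤ) (i : ℕ) (Q : Polynomial SymFun) :
    elemPairing r (Polynomial.X ^ i * Q) = elemPairing (r + i) Q := by
  induction Q using Polynomial.induction_on' with
  | add P Q hP hQ => rw [mul_add, map_add, map_add, hP, hQ]
  | monomial k h =>
    rw [← Polynomial.C_mul_X_pow_eq_monomial, mul_left_comm, ← pow_add,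
      elemPairing_C_mul_X_pow, elemPairing_C_mul_X_pow]
    push_cast
    ring_nf

theorem elemPairing_mul (r : ℤ) (P Q : Polynomial SymFun) {N : ℕ}
    (hP : ∀ i, N < i → P.coeff i = 0) :
    elemPairing r (P * Q) =
      ∑ i ∈ Finset.range (N + 1), P.coeff i * elemPairing (r + i) Q := by
  conv_lhs => rw [P.as_sum_range' (N + 1)
    (Nat.lt_succ_of_le (Polynomial.natDegree_le_iff_coeff_eq_zero.mpr hP))]
  rw [Finset.sum_mul, map_sum]
  refine Finset.sum_congr rfl fun i _ => ?_
  rw [← Polynomial.C_mul_X_pow_eq_monomial, mul_assoc, ← Polynomial.smul_eq_C_mul, map_smul,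
    elemPairing_X_pow_mul, smul_eq_mul]

theorem vertexOp_mul (q : ℂ) (r : ℤ) (h f : SymFun) {N : ℕ}
    (hN : ∀ i, N < i → translCoeff (vertexShift q) i h = 0) :
    vertexOp q r (h * f) = ∑ i ∈ Finset.range (N + 1),
      translCoeff (vertexShift q) i h * vertexOp q (r + i) f := by
  have h1 := elemPairing_mul r (transl (vertexShift q) h) (transl (vertexShift q) f) hN
  rw [← map_mul] at h1
  exact h1

theorem vertexOp_apply_one (q : ℂ) (r : ℤ) : vertexOp q r 1 = elemSym r := by
  change elemPairing r (transl (vertexShift q) 1) = _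
  have := elemPairing_C_mul_X_pow r 1 0
  rw [map_one]
  simpa using this

theorem vertexOp_apply (q : ℂ) (r : ℤ) (f : SymFun) {N : ℕ}
    (hN : ∀ i, N < i → translCoeff (vertexShift q) i f = 0) :
    vertexOp q r f = ∑ i ∈ Finset.range (N + 1),
      translCoeff (vertexShift q) i f * elemSym (r + i) := by
  have := vertexOp_mul q r f 1 hN
  rw [mul_one] at this
  simp only [this, vertexOp_apply_one]

theorem exists_translCoeff_eq_zero (c : ℕ → ℂ) (f : SymFun) :
    ∃ N, ∀ i, N < i → translCoeff c i f = 0 :=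
  ⟨(transl c f).natDegree, fun _ hi => Polynomial.coeff_eq_zero_of_natDegree_lt hi⟩

theorem translCoeff_mul (c : ℕ → ℂ) (i : ℕ) (f g : SymFun) :
    translCoeff c i (f * g) =
      ∑ p ∈ Finset.HasAntidiagonal.antidiagonal i, translCoeff c p.1 f * translCoeff c p.2 g := by
  simp only [translCoeff_apply, map_mul, Polynomial.coeff_mul]

theorem addVar_zero (f : SymFun) : addVar 0 f = f := by
  induction f using symFun_induction with
  | h1 => rw [addVar, transl_one_coeff, if_pos rfl]
  | hadd f g hf hg => rw [map_add, hf, hg]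
  | hsmul a f hf => rw [map_smul, hf]
  | hmul f n hf =>
    rw [addVar] at hf ⊢
    rw [translCoeff_mul_psumSucc, hf, if_neg (by omega), add_zero]

theorem addVar_succ_mul_elemSym (i : ℕ) (f : SymFun) (r : ℤ) :
    addVar (i + 1) (f * elemSym r) =
      addVar (i + 1) f * elemSym r + addVar i f * elemSym (r - 1) := by
  have h2 : addVar (i + 1) (elemSym r * f) =
      ∑ p ∈ Finset.HasAntidiagonal.antidiagonal (i + 1), addVar p.1 (elemSym r) * addVar p.2 f :=
    translCoeff_mul _ _ _ _
  rw [mul_comm, h2, Finset.Nat.sum_antidiagonal_eq_sum_range_succ_mk, Finset.sum_range_succ',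
    Finset.sum_range_succ', Finset.sum_eq_zero]
  · have h0 := addVar_elemSym 0 r
    have h1 := addVar_elemSym 1 r
    simp only [if_true, one_ne_zero, if_false] at h0 h1
    simp only [zero_add, h0, h1, Nat.sub_zero, Nat.add_sub_cancel]
    ring
  · intro k _
    rw [addVar_elemSym, if_neg (by omega), if_neg (by omega), zero_mul]

/-- Adding a variable `x` to the alphabet turns `B_r` into `B_r + x B_{r-1}`. -/
theorem addVar_succ_vertexOp (q : ℂ) (i : ℕ) (r : ℤ) (f : SymFun) :
    addVar (i + 1) (vertexOp q r f) =
      vertexOp q r (addVar (i + 1) f) + vertexOp q (r - 1) (addVar i f) := by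
  obtain ⟨N, hN⟩ := exists_translCoeff_eq_zero (vertexShift q) f
  have h : ∀ j i, N < i → translCoeff (vertexShift q) i (addVar j f) = 0 := by
    intro j i hi
    rw [addVar, translCoeff_comm, hN i hi, map_zero]
  rw [vertexOp_apply q r f hN, vertexOp_apply q r _ (h _), vertexOp_apply q _ _ (h _), map_sum,
    ← Finset.sum_add_distrib]
  refine Finset.sum_congr rfl fun k _ => ?_
  have h1 : ∀ j, addVar j (translCoeff (vertexShift q) k f) =
      translCoeff (vertexShift q) k (addVar j f) := fun j => translCoeff_comm _ _ _ _ _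
  rw [addVar_succ_mul_elemSym, h1, h1, sub_add_eq_add_sub]

/-- The vertex operators `B_{r-1}` and `B_r` commute up to the factor `q`. -/
theorem vertexOp_comm (q : ℂ) (r : ℤ) (f : SymFun) :
    vertexOp q (r - 1) (vertexOp q r f) = q • vertexOp q r (vertexOp q (r - 1) f) := by
  obtain ⟨N₀, hN₀⟩ := exists_translCoeff_eq_zero (vertexShift q) f
  choose M hM using fun l => exists_translCoeff_eq_zero (vertexShift q)
    (translCoeff (vertexShift q) l f)
  set N := N₀ + ∑ l ∈ Finset.range (N₀ + 1), M l with hN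
  set S := translCoeff (vertexShift q) with hS
  have hN1 : ∀ i, N < i → S i f = 0 := fun i hi => hN₀ i (by omega)
  have hN2 : ∀ l i, N < i → S i (S l f) = 0 := by
    intro l i hi
    rcases lt_or_ge N₀ l with hl | hl
    · rw [hN₀ l hl, map_zero]
    · have h1 : M l ≤ ∑ l ∈ Finset.range (N₀ + 1), M l :=
        Finset.single_le_sum (f := M) (fun _ _ => Nat.zero_le _)
          (Finset.mem_range.mpr (Nat.lt_succ_of_le hl))
      exact hM l i (by omega)
  -- The product `B_a B_b` without the factor that comes from reordering the exponentials.
  let Y : ℤ → ℤ → SymFun := fun a b => ∑ l ∈ Finset.range (N + 1), ∑ i ∈ Finset.range (N + 1),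
    S i (S l f) * elemSym (a + i) * elemSym (b + l)
  have hY : ∀ a b, Y a b = Y b a := by
    intro a b
    change ∑ l ∈ Finset.range (N + 1), ∑ i ∈ Finset.range (N + 1), _ = _
    rw [Finset.sum_comm]
    refine Finset.sum_congr rfl fun i _ => Finset.sum_congr rfl fun l _ => ?_
    rw [hS, translCoeff_comm]
    ring
  have key : ∀ (a b : ℤ) (J : ℕ), b + N < J →
      vertexOp q a (vertexOp q b f) =
        ∑ j ∈ Finset.range (J + 1), vertexCoeff q j • Y (a + j) (b - j) := by
    intro a b J hJ
    have h1 : ∀ l ∈ Finset.range (N + 1), vertexOp q a (S l f * elemSym (b + l)) =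
        ∑ j ∈ Finset.range (J + 1), vertexCoeff q j •
          ∑ i ∈ Finset.range (N + 1),
            S i (S l f) * elemSym (a + j + i) * elemSym (b - j + l) := by
      intro l hl
      have hl' := Finset.mem_range.mp hl
      rw [mul_comm, vertexOp_mul q a _ _ (N := J)]
      · refine Finset.sum_congr rfl fun j _ => ?_
        rw [translCoeff_vertexShift_elemSym, vertexOp_apply q _ _ (hN2 l), smul_mul_assoc,
          Finset.mul_sum]
        congr 1
        refine Finset.sum_congr rfl fun i _ => ?_
        rw [show b + (l : ℤ) - j = b - j + l by ring]
        ring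
      · intro j hj
        rw [translCoeff_vertexShift_elemSym, elemSym_of_neg (by omega), smul_zero]
    rw [vertexOp_apply q b f hN1, map_sum, Finset.sum_congr rfl h1, Finset.sum_comm]
    simp only [Y, Finset.smul_sum]
  clear_value Y
  set J := (r + N).toNat + 1 with hJ
  rw [key (r - 1) r (J + 1) (by omega), key r (r - 1) J (by omega), Finset.sum_range_succ',
    Finset.sum_range_succ', Finset.sum_range_succ' _ J]
  have e1 : r - 1 + ((0 : ℕ) : ℤ) = r - 1 := by simp
  have e2 : r - ((0 : ℕ) : ℤ) = r := by simp
  have e3 : r + ((0 : ℕ) : ℤ) = r := by simp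
  have e4 : r - 1 - ((0 : ℕ) : ℤ) = r - 1 := by simp
  have e5 : r - 1 + ((0 + 1 : ℕ) : ℤ) = r := by simp
  have e6 : r - ((0 + 1 : ℕ) : ℤ) = r - 1 := by simp
  rw [e1, e2, e3, e4, e5, e6, hY (r - 1) r]
  have h2 : ∀ k ∈ Finset.range J,
      vertexCoeff q (k + 1 + 1) • Y (r - 1 + ((k + 1 + 1 : ℕ) : ℤ)) (r - ((k + 1 + 1 : ℕ) : ℤ)) =
        q • vertexCoeff q (k + 1) • Y (r + ((k + 1 : ℕ) : ℤ)) (r - 1 - ((k + 1 : ℕ) : ℤ)) := by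
    intro k _
    rw [smul_smul, vertexCoeff, vertexCoeff]
    congr 1
    · ring
    · congr 1 <;> push_cast <;> ring
  rw [Finset.sum_congr rfl h2, ← Finset.smul_sum, vertexCoeff, vertexCoeff]
  generalize Y r (r - 1) = y
  generalize ∑ k ∈ Finset.range J,
    vertexCoeff q (k + 1) • Y (r + ((k + 1 : ℕ) : ℤ)) (r - 1 - ((k + 1 : ℕ) : ℤ)) = z
  rw [smul_add, add_assoc, ← add_smul]
  congr 2
  · ring
  · rw [one_smul]

/-- Commutation of the vertex operators with multiplication by the functions `g_a`. -/
theorem completeSym_succ_mul_vertexOp {q : ℂ} (hq : ‖q‖ < 1) (a : ℕ) (r : ℤ) (f : SymFun) :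
    completeSym q (a + 1) * vertexOp q r f =
      vertexOp q r (completeSym q (a + 1) * f) + vertexOp q (r + 1) (completeSym q a * f) := by
  have h : ∀ (a : ℕ) (r : ℤ), vertexOp q r (completeSym q a * f) =
      ∑ j ∈ Finset.range (a + 1), (-1 : ℂ) ^ j • (completeSym q (a - j) *
        vertexOp q (r + j) f) := by
    intro a r
    rw [vertexOp_mul q r _ _ (N := a)]
    · refine Finset.sum_congr rfl fun j hj => ?_
      rw [translCoeff_vertexShift_completeSym hq,
        if_pos (Nat.le_of_lt_succ (Finset.mem_range.mp hj)), smul_mul_assoc]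
    · intro i hi
      rw [translCoeff_vertexShift_completeSym hq, if_neg (by omega)]
  rw [h, h, Finset.sum_range_succ', add_right_comm, ← Finset.sum_add_distrib,
    Finset.sum_eq_zero, zero_add]
  · simp
  · intro j _
    rw [Nat.add_sub_add_right, pow_succ, show r + ((j + 1 : ℕ) : ℤ) = r + 1 + j by push_cast; ring]
    module

theorem vertexOp_zero_completeSym {q : ℂ} (hq : ‖q‖ < 1) (a : ℕ) :
    vertexOp q 0 (completeSym q a) = q ^ a • completeSym q a := by
  rw [vertexOp_apply q 0 _ (N := a), ← sum_elemSym_mul_completeSym hq]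
  · refine Finset.sum_congr rfl fun k hk => ?_
    rw [translCoeff_vertexShift_completeSym hq,
      if_pos (Nat.le_of_lt_succ (Finset.mem_range.mp hk)), zero_add, smul_mul_assoc,
      Algebra.smul_def, map_pow, map_neg, map_one]
    ring
  · intro i hi
    rw [translCoeff_vertexShift_completeSym hq, if_neg (by omega)]

theorem vertexOp_one_completeSym {q : ℂ} (hq : ‖q‖ < 1) (a : ℕ) :
    vertexOp q 1 (completeSym q a) = (1 - q ^ (a + 1)) • completeSym q (a + 1) := by
  have h := completeSym_succ_mul_vertexOp hq a 0 1
  rw [vertexOp_apply_one, elemSym_zero, mul_one, mul_one, vertexOp_zero_completeSym hq,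
    zero_add] at h
  rw [sub_smul, one_smul, eq_sub_iff_add_eq, add_comm]
  exact h.symm

/-! ### Gaussian binomial coefficients -/

theorem qPoch_zero (q : ℂ) : qPoch q 0 = 1 := Finset.prod_range_zero _

theorem qPoch_succ (q : ℂ) (m : ℕ) : qPoch q (m + 1) = qPoch q m * (1 - q ^ (m + 1)) :=
  Finset.prod_range_succ _ _

theorem qPoch_ne_zero {q : ℂ} (hq : ‖q‖ < 1) (m : ℕ) : qPoch q m ≠ 0 :=
  Finset.prod_ne_zero_iff.mpr fun i _ => one_sub_pow_ne_zero hq i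

theorem qBinom_zero_right {q : ℂ} (hq : ‖q‖ < 1) (m : ℕ) : qBinom q m 0 = 1 := by
  rw [qBinom, qPoch_zero, one_mul, Nat.sub_zero, div_self (qPoch_ne_zero hq m)]

theorem qBinom_self {q : ℂ} (hq : ‖q‖ < 1) (m : ℕ) : qBinom q m m = 1 := by
  rw [qBinom, Nat.sub_self, qPoch_zero, mul_one, div_self (qPoch_ne_zero hq m)]

theorem qBinom_succ_succ {q : ℂ} (hq : ‖q‖ < 1) {a j : ℕ} (hj : j < a) :
    qBinom q (a + 1) (j + 1) = qBinom q a (j + 1) + q ^ (a - j) * qBinom q a j := by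
  obtain ⟨k, rfl⟩ := Nat.exists_eq_add_of_lt hj
  have h1 : j + k + 1 + 1 - (j + 1) = k + 1 := by omega
  have h2 : j + k + 1 - (j + 1) = k := by omega
  have h3 : j + k + 1 - j = k + 1 := by omega
  have h4 := qPoch_ne_zero hq j
  have h5 := qPoch_ne_zero hq k
  have h6 := one_sub_pow_ne_zero hq j
  have h7 := one_sub_pow_ne_zero hq k
  rw [qBinom, qBinom, qBinom, h1, h2, h3, qPoch_succ q (j + k + 1), qPoch_succ q j,
    qPoch_succ q k, ← mul_div_assoc, div_add_div _ _ (by positivity) (by positivity),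
    div_eq_div_iff (by positivity) (by positivity)]
  ring

/-- The `q`-binomial theorem for `q`-commuting elements. -/
theorem add_smul_pow_of_qcomm {A : Type*} [Ring A] [Algebra ℂ A] {q : ℂ} (hq : ‖q‖ < 1)
    {u v : A} (h : u * v = q • (v * u)) (x : ℂ) (a : ℕ) :
    (v + x • u) ^ a =
      ∑ j ∈ Finset.range (a + 1), (qBinom q a j * x ^ j) • (v ^ (a - j) * u ^ j) := by
  have hpow : ∀ n, u * v ^ n = q ^ n • (v ^ n * u) := by
    intro n
    induction n with
    | zero => simp
    | succ n ih =>
      rw [pow_succ, ← mul_assoc, ih, smul_mul_assoc, mul_assoc, h, mul_smul_comm, smul_smul,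
        ← mul_assoc, pow_succ]
  induction a with
  | zero => simp [qBinom_zero_right hq]
  | succ a ih =>
    rw [pow_succ', ih, add_mul, Finset.mul_sum, Finset.mul_sum, Finset.sum_range_succ' _ (a + 1)]
    have h1 : ∀ j ∈ Finset.range (a + 1),
        v * ((qBinom q a j * x ^ j) • (v ^ (a - j) * u ^ j)) =
          (qBinom q a j * x ^ j) • (v ^ (a + 1 - j) * u ^ j) := by
      intro j hj
      have := Finset.mem_range.mp hj
      rw [mul_smul_comm, ← mul_assoc, ← pow_succ', show a - j + 1 = a + 1 - j by omega]
    have h2 : ∀ j ∈ Finset.range (a + 1),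
        x • u * ((qBinom q a j * x ^ j) • (v ^ (a - j) * u ^ j)) =
          (q ^ (a - j) * qBinom q a j * x ^ (j + 1)) • (v ^ (a - j) * u ^ (j + 1)) := by
      intro j _
      rw [smul_mul_smul_comm, ← mul_assoc u, hpow, smul_mul_assoc, smul_smul,
        mul_assoc (v ^ (a - j)), ← pow_succ']
      congr 1
      ring
    rw [Finset.sum_congr rfl h1, Finset.sum_congr rfl h2, Finset.sum_range_succ',
      Finset.sum_range_succ, Finset.sum_range_succ _ a, add_add_add_comm, add_comm (_ • _) (_ • _),
      ← add_assoc, ← Finset.sum_add_distrib]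
    have h3 : ∀ j ∈ Finset.range a,
        (qBinom q a (j + 1) * x ^ (j + 1)) • (v ^ (a + 1 - (j + 1)) * u ^ (j + 1)) +
          (q ^ (a - j) * qBinom q a j * x ^ (j + 1)) • (v ^ (a - j) * u ^ (j + 1)) =
        (qBinom q (a + 1) (j + 1) * x ^ (j + 1)) • (v ^ (a + 1 - (j + 1)) * u ^ (j + 1)) := by
      intro j hj
      rw [qBinom_succ_succ hq (Finset.mem_range.mp hj), Nat.add_sub_add_right, ← add_smul]
      congr 1
      ring
    rw [Finset.sum_congr rfl h3, qBinom_zero_right hq, qBinom_zero_right hq, qBinom_self hq,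
      qBinom_self hq, Nat.sub_self, Nat.sub_self, pow_zero, one_mul]

/-! ### Column multiplicities

A partition is encoded by the finitely supported function `m : ℕ →₀ ℕ` for which `m i` is the
number of its columns of length `i + 1`. Its largest part is `m.degree` and its size is
`colSize m`. -/

/-- The size of the partition with `m i` columns of length `i + 1`. -/
def colSize : (ℕ →₀ ℕ) →+ ℕ := Finsupp.weight fun i => i + 1

/-- Shorten all columns by `1`. -/
def shorten : (ℕ →₀ ℕ) →+ (ℕ →₀ ℕ) := Finsupp.comapDomain.addMonoidHom Nat.succ_injective

/-- Lengthen all columns by `1`. -/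
def lengthen : (ℕ →₀ ℕ) →+ (ℕ →₀ ℕ) := Finsupp.mapDomain.addMonoidHom Nat.succ

theorem shorten_apply (m : ℕ →₀ ℕ) (i : ℕ) : shorten m i = m (i + 1) := rfl

theorem shorten_single_zero (a : ℕ) : shorten (Finsupp.single 0 a) = 0 := by
  ext i
  rw [shorten_apply, Finsupp.single_eq_of_ne (by omega), Finsupp.zero_apply]

theorem shorten_single_succ (i a : ℕ) :
    shorten (Finsupp.single (i + 1) a) = Finsupp.single i a := by
  ext j
  rw [shorten_apply, Finsupp.single_apply, Finsupp.single_apply]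
  simp

theorem lengthen_single (i a : ℕ) :
    lengthen (Finsupp.single i a) = Finsupp.single (i + 1) a :=
  Finsupp.mapDomain_single

theorem lengthen_apply_succ (m : ℕ →₀ ℕ) (i : ℕ) : lengthen m (i + 1) = m i :=
  Finsupp.mapDomain_apply Nat.succ_injective m i

theorem lengthen_apply_zero (m : ℕ →₀ ℕ) : lengthen m 0 = 0 :=
  Finsupp.mapDomain_of_notMem_range _ _ (by simp)

theorem lengthen_shorten_add (m : ℕ →₀ ℕ) :
    lengthen (shorten m) + Finsupp.single 0 (m 0) = m := by
  ext i
  cases i with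
  | zero => rw [Finsupp.add_apply, lengthen_apply_zero, zero_add, Finsupp.single_eq_same]
  | succ i =>
    rw [Finsupp.add_apply, lengthen_apply_succ, shorten_apply,
      Finsupp.single_eq_of_ne (by omega), add_zero]

theorem colSize_single (i a : ℕ) : colSize (Finsupp.single i a) = a * (i + 1) := by
  rw [colSize, Finsupp.weight_single, smul_eq_mul]

theorem degree_lengthen (m : ℕ →₀ ℕ) : (lengthen m).degree = m.degree := by
  induction m using Finsupp.induction_linear with
  | zero => simp
  | add f g hf hg => simp only [map_add, hf, hg]
  | single i a => rw [lengthen_single, Finsupp.degree_single, Finsupp.degree_single]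

theorem colSize_lengthen (m : ℕ →₀ ℕ) : colSize (lengthen m) = colSize m + m.degree := by
  induction m using Finsupp.induction_linear with
  | zero => simp
  | add f g hf hg =>
    simp only [map_add, hf, hg]
    ring
  | single i a =>
    rw [lengthen_single, colSize_single, colSize_single, Finsupp.degree_single]
    ring

theorem degree_eq_shorten_add (m : ℕ →₀ ℕ) : m.degree = (shorten m).degree + m 0 := by
  conv_lhs => rw [← lengthen_shorten_add m]
  rw [map_add, degree_lengthen, Finsupp.degree_single]

theorem colSize_eq_shorten_add (m : ℕ →₀ ℕ) : colSize m = colSize (shorten m) + m.degree := by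
  conv_lhs => rw [← lengthen_shorten_add m]
  rw [map_add, colSize_lengthen, colSize_single, degree_eq_shorten_add m]
  ring

theorem degree_le_colSize (m : ℕ →₀ ℕ) : m.degree ≤ colSize m := by
  induction m using Finsupp.induction_linear with
  | zero => simp
  | add f g hf hg =>
    simp only [map_add]
    omega
  | single i a =>
    rw [colSize_single, Finsupp.degree_single]
    exact Nat.le_mul_of_pos_right a i.succ_pos

/-- Induction on column multiplicities, adding the columns in order of their length. -/
theorem column_induction {p : (ℕ →₀ ℕ) → Prop} (m : ℕ →₀ ℕ) (h0 : p 0)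
    (hadd : ∀ M w, (∀ j, M < j → w j = 0) → p w → p (w + Finsupp.single M 1)) : p m := by
  induction m using Finsupp.induction_on_max with
  | zero => exact h0
  | single_add M a w hw _ ih =>
    have hw' : ∀ j, M < j → w j = 0 := fun j hj => by
      by_contra h
      exact absurd (hw j (Finsupp.mem_support_iff.mpr h)) (by omega)
    rw [add_comm]
    clear * - ih hadd hw'
    induction a with
    | zero => rwa [Finsupp.single_zero, add_zero]
    | succ a iha =>
      rw [Finsupp.single_add, ← add_assoc]
      refine hadd M _ (fun j hj => ?_) iha
      rw [Finsupp.add_apply, hw' j hj, Finsupp.single_eq_of_ne (by omega), add_zero]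

theorem sum_Iic_add_single {A : Type*} [AddCommMonoid A] {w : ℕ →₀ ℕ} {M : ℕ} (hw : w M = 0)
    (a : ℕ) (F : (ℕ →₀ ℕ) → A) :
    ∑ k ∈ Finset.Iic (w + Finsupp.single M a), F k =
      ∑ j ∈ Finset.range (a + 1), ∑ k ∈ Finset.Iic w, F (k + Finsupp.single M j) := by
  rw [← Finset.sum_product']
  symm
  refine Finset.sum_nbij' (fun p => p.2 + Finsupp.single M p.1) (fun k => (k M, k.erase M))
    ?_ ?_ ?_ ?_ (fun _ _ => rfl)
  · rintro ⟨j, k⟩ h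
    rw [Finset.mem_product, Finset.mem_range, Finset.mem_Iic] at h
    rw [Finset.mem_Iic]
    exact add_le_add h.2 (Finsupp.single_mono (Nat.le_of_lt_succ h.1))
  · intro k h
    rw [Finset.mem_Iic] at h
    rw [Finset.mem_product, Finset.mem_range, Finset.mem_Iic]
    constructor
    · have := h M
      rw [Finsupp.add_apply, hw, zero_add, Finsupp.single_eq_same] at this
      exact Nat.lt_succ_of_le this
    · intro i
      rcases eq_or_ne i M with rfl | hi
      · rw [Finsupp.erase_same]
        exact Nat.zero_le _
      · rw [Finsupp.erase_ne hi]
        have := h i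
        rwa [Finsupp.add_apply, Finsupp.single_eq_of_ne hi, add_zero] at this
  · rintro ⟨j, k⟩ h
    rw [Finset.mem_product, Finset.mem_range, Finset.mem_Iic] at h
    have hk : k M = 0 := Nat.le_zero.mp (hw ▸ h.2 M)
    refine Prod.ext ?_ ?_
    · change (k + Finsupp.single M j) M = j
      rw [Finsupp.add_apply, hk, zero_add, Finsupp.single_eq_same]
    · ext i
      change (k + Finsupp.single M j).erase M i = k i
      rcases eq_or_ne i M with rfl | hi
      · rw [Finsupp.erase_same, hk]
      · rw [Finsupp.erase_ne hi, Finsupp.add_apply, Finsupp.single_eq_of_ne hi, add_zero]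
  · intro k _
    change k.erase M + Finsupp.single M (k M) = k
    rw [Finsupp.erase_add_single]

/-! ### The `q`-Whittaker functions -/

/-- The product `B_M^{m_{M-1}} ⋯ B_2^{m_1} B_1^{m_0} 1` of vertex operators. -/
def vertexProd (q : ℂ) (m : ℕ → ℕ) : ℕ → SymFun
  | 0 => 1
  | M + 1 => (vertexOp q (M + 1) ^ m M) (vertexProd q m M)

/-- The `q`-Whittaker function of the partition with `m i` columns of length `i + 1`, as a
product of vertex operators, one for each column. -/
def whittaker (q : ℂ) (m : ℕ →₀ ℕ) : SymFun := vertexProd q m (m.support.sup Nat.succ)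

theorem vertexProd_congr {q : ℂ} {m m' : ℕ → ℕ} {M : ℕ} (h : ∀ j < M, m j = m' j) :
    vertexProd q m M = vertexProd q m' M := by
  induction M with
  | zero => rfl
  | succ M ih =>
    rw [vertexProd, vertexProd, ih fun j hj => h j (by omega), h M (by omega)]

theorem vertexProd_eq_whittaker {q : ℂ} {m : ℕ →₀ ℕ} {M : ℕ} (h : ∀ j, M ≤ j → m j = 0) :
    vertexProd q m M = whittaker q m := by
  have h1 : m.support.sup Nat.succ ≤ M := by
    refine Finset.sup_le fun j hj => Nat.succ_le_of_lt ?_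
    by_contra hj'
    exact Finsupp.mem_support_iff.mp hj (h j (not_lt.mp hj'))
  have h2 : ∀ K, m.support.sup Nat.succ ≤ K → vertexProd q m K = whittaker q m := by
    intro K hK
    induction K, hK using Nat.le_induction with
    | base => rfl
    | succ K hK ih =>
      have h3 : m K = 0 := by
        by_contra hmK
        have := Finset.le_sup (f := Nat.succ) (Finsupp.mem_support_iff.mpr hmK)
        omega
      rw [vertexProd, h3, pow_zero, Module.End.one_apply, ih]
  exact h2 M h1

theorem whittaker_zero (q : ℂ) : whittaker q 0 = 1 := rfl

theorem whittaker_add_single (q : ℂ) {w : ℕ →₀ ℕ} {M : ℕ} (hw : ∀ j, M < j → w j = 0) (a : ℕ) :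
    whittaker q (w + Finsupp.single M a) = (vertexOp q (M + 1) ^ a) (whittaker q w) := by
  rw [← vertexProd_eq_whittaker (M := M + 1) (m := w) fun j hj => hw j (by omega),
    ← vertexProd_eq_whittaker (M := M + 1), vertexProd, vertexProd,
    vertexProd_congr (m := ⇑(w + Finsupp.single M a)) (m' := w), Finsupp.add_apply,
    Finsupp.single_eq_same, add_comm (w M) a, pow_add]
  · rfl
  · intro j hj
    rw [Finsupp.add_apply, Finsupp.single_eq_of_ne (by omega), add_zero]
  · intro j hj
    rw [Finsupp.add_apply, Finsupp.single_eq_of_ne (by omega), add_zero, hw j (by omega)]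

theorem whittaker_add_single_one (q : ℂ) {w : ℕ →₀ ℕ} {M : ℕ} (hw : ∀ j, M < j → w j = 0) :
    whittaker q (w + Finsupp.single M 1) = vertexOp q (M + 1) (whittaker q w) := by
  rw [whittaker_add_single q hw, pow_one]

theorem vertexOp_comm_pow (q : ℂ) (r : ℤ) (a : ℕ) (f : SymFun) :
    vertexOp q (r - 1) ((vertexOp q r ^ a) f) =
      q ^ a • (vertexOp q r ^ a) (vertexOp q (r - 1) f) := by
  induction a with
  | zero => simp
  | succ a ih =>
    rw [pow_succ', Module.End.mul_apply, Module.End.mul_apply, vertexOp_comm, ih, map_smul,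
      smul_smul, pow_succ']

/-- `B_M` adds a column of length `M` also in the presence of columns of length `M + 1`. -/
theorem vertexOp_whittaker (q : ℂ) {n : ℕ →₀ ℕ} {M : ℕ} (hn : ∀ j, M + 1 < j → n j = 0) :
    vertexOp q (M + 1) (whittaker q n) =
      q ^ n (M + 1) • whittaker q (n + Finsupp.single M 1) := by
  have h1 : ∀ j, M < j → n.erase (M + 1) j = 0 := by
    intro j hj
    rcases eq_or_ne j (M + 1) with rfl | h
    · rw [Finsupp.erase_same]
    · rw [Finsupp.erase_ne h, hn j (by omega)]
  have h2 : ∀ j, M + 1 < j → n.erase (M + 1) j = 0 := fun j hj => h1 j (by omega)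
  have h3 : ∀ j, M + 1 < j → (n.erase (M + 1) + Finsupp.single M 1 : ℕ →₀ ℕ) j = 0 := by
    intro j hj
    rw [Finsupp.add_apply, h2 j hj, Finsupp.single_eq_of_ne (by omega), add_zero]
  have h4 : n + Finsupp.single M 1 =
      n.erase (M + 1) + Finsupp.single M 1 + Finsupp.single (M + 1) (n (M + 1)) := by
    rw [add_right_comm, Finsupp.erase_add_single]
  rw [h4, whittaker_add_single q h3, whittaker_add_single_one q h1]
  conv_lhs => rw [← Finsupp.erase_add_single (M + 1) n, whittaker_add_single q h2]
  have h5 := vertexOp_comm_pow q (((M + 1 : ℕ) : ℤ) + 1) (n (M + 1))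
    (whittaker q (n.erase (M + 1)))
  rw [add_sub_cancel_right, Nat.cast_succ] at h5
  simpa using h5

theorem constantCoeff_elemSym {r : ℤ} (hr : r ≠ 0) :
    MvPolynomial.constantCoeff (elemSym r) = 0 := by
  rcases lt_or_ge r 0 with h | h
  · rw [elemSym_of_neg h, map_zero]
  · obtain ⟨r, rfl⟩ := Int.eq_ofNat_of_zero_le h
    obtain ⟨n, rfl⟩ := Nat.exists_eq_succ_of_ne_zero (n := r) (by omega)
    have h1 := smul_expCoeff_succ (fun n => (-1 : ℂ) ^ n • psumSucc n) n
    have h2 := congrArg MvPolynomial.constantCoeff h1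
    have h3 : ∀ k, MvPolynomial.constantCoeff (psumSucc k) = 0 :=
      fun k => MvPolynomial.constantCoeff_X _ _
    rw [MvPolynomial.constantCoeff_smul, map_sum, Finset.sum_eq_zero] at h2
    · rw [elemSym_natCast, elemSeries, expSeries, PowerSeries.coeff_mk]
      simp only [PowerSeries.coeff_mk]
      exact (mul_eq_zero.mp h2).resolve_left (Nat.cast_ne_zero.mpr n.succ_ne_zero)
    · intro i _
      rw [map_mul, MvPolynomial.constantCoeff_smul, h3, smul_zero, zero_mul]

theorem constantCoeff_whittaker (q : ℂ) (m : ℕ →₀ ℕ) :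
    MvPolynomial.constantCoeff (whittaker q m) = if m = 0 then 1 else 0 := by
  induction m using column_induction with
  | h0 => rw [whittaker_zero, map_one, if_pos rfl]
  | hadd M w hw _ =>
    obtain ⟨N, hN⟩ := exists_translCoeff_eq_zero (vertexShift q) (whittaker q w)
    rw [whittaker_add_single_one q hw, vertexOp_apply q _ _ hN, map_sum, Finset.sum_eq_zero,
      if_neg]
    · intro h
      have := DFunLike.congr_fun h M
      rw [Finsupp.add_apply, Finsupp.single_eq_same, Finsupp.zero_apply] at this
      omega
    · intro i _
      rw [map_mul, constantCoeff_elemSym (by omega), mul_zero]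

/-! ### Branching: adding a variable -/

/-- The operator `f[X] ↦ f[X + x]` that adds a variable with value `x` to the alphabet. -/
def addVarAt (x : ℂ) : SymFun →ₐ[ℂ] SymFun :=
  MvPolynomial.aeval fun k : ℕ+ => MvPolynomial.X k + MvPolynomial.C (x ^ (k : ℕ))

theorem addVarAt_eq_eval (x : ℂ) (f : SymFun) :
    addVarAt x f = (transl (fun _ => 1) f).eval (MvPolynomial.C x) := by
  induction f using MvPolynomial.induction_on with
  | C a =>
    rw [← MvPolynomial.algebraMap_eq, AlgHom.commutes, AlgHom.commutes,
      Polynomial.algebraMap_apply, Polynomial.eval_C]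
  | add f g hf hg => rw [map_add, map_add, hf, hg, Polynomial.eval_add]
  | mul_X f k hf =>
    rw [map_mul, map_mul, hf, Polynomial.eval_mul]
    simp [addVarAt, transl]

theorem addVarAt_eq_sum (x : ℂ) (f : SymFun) {N : ℕ} (hN : ∀ i, N < i → addVar i f = 0) :
    addVarAt x f = ∑ i ∈ Finset.range (N + 1), x ^ i • addVar i f := by
  have h : (transl (fun _ => 1) f).natDegree < N + 1 :=
    Nat.lt_succ_of_le (Polynomial.natDegree_le_iff_coeff_eq_zero.mpr hN)
  rw [addVarAt_eq_eval, Polynomial.eval_eq_sum_range' h]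
  refine Finset.sum_congr rfl fun i _ => ?_
  rw [MvPolynomial.smul_eq_C_mul, map_pow, mul_comm]
  rfl

theorem addVarAt_vertexOp (q x : ℂ) (r : ℤ) (f : SymFun) :
    addVarAt x (vertexOp q r f) =
      (vertexOp q r + x • vertexOp q (r - 1)) (addVarAt x f) := by
  obtain ⟨N, hN⟩ := exists_translCoeff_eq_zero (fun _ => 1) f
  have h1 : ∀ i, N + 1 < i → addVar i f = 0 := fun i hi => hN i (by omega)
  have h2 : ∀ i, N + 1 < i → addVar i (vertexOp q r f) = 0 := by
    intro i hi
    obtain ⟨i, rfl⟩ := Nat.exists_eq_succ_of_ne_zero (n := i) (by omega)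
    have h3 : addVar i f = 0 := hN i (by omega)
    rw [Nat.succ_eq_add_one, addVar_succ_vertexOp, h1 _ hi, h3, map_zero, map_zero, add_zero]
  rw [addVarAt_eq_sum x _ h2, LinearMap.add_apply, LinearMap.smul_apply]
  conv_rhs => rw [addVarAt_eq_sum x f h1]
  conv_rhs => enter [2]; rw [← addVarAt_eq_sum x f h1, addVarAt_eq_sum x f hN]
  rw [Finset.sum_range_succ', Finset.sum_range_succ' _ (N + 1), map_add, map_sum, map_sum,
    Finset.smul_sum, addVar_zero, addVar_zero, pow_zero, one_smul, one_smul, add_right_comm,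
    ← Finset.sum_add_distrib]
  congr 1
  refine Finset.sum_congr rfl fun i _ => ?_
  rw [addVar_succ_vertexOp, map_smul, map_smul, smul_add, smul_smul, pow_succ']

theorem addVarAt_vertexOp_pow (q x : ℂ) (r : ℤ) (a : ℕ) (f : SymFun) :
    addVarAt x ((vertexOp q r ^ a) f) =
      ((vertexOp q r + x • vertexOp q (r - 1)) ^ a) (addVarAt x f) := by
  induction a with
  | zero => rfl
  | succ a ih =>
    rw [pow_succ', pow_succ', Module.End.mul_apply, Module.End.mul_apply, addVarAt_vertexOp, ih]

/-- The branching coefficient `∏_i [m_i choose k_i]_q` for shortening `k i` of the `m i` columns of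
length `i + 1`. -/
def branchCoeff (q : ℂ) (m k : ℕ →₀ ℕ) : ℂ := ∏ i ∈ m.support, qBinom q (m i) (k i)

theorem branchCoeff_eq_prod {q : ℂ} (hq : ‖q‖ < 1) {m k : ℕ →₀ ℕ} {s : Finset ℕ}
    (hs : m.support ⊆ s) (hk : k ≤ m) :
    branchCoeff q m k = ∏ i ∈ s, qBinom q (m i) (k i) := by
  refine Finset.prod_subset hs fun i _ hi => ?_
  have h1 : m i = 0 := Finsupp.notMem_support_iff.mp hi
  have h2 : k i = 0 := Nat.le_zero.mp (h1 ▸ hk i)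
  rw [h1, h2, qBinom_self hq]

theorem branchCoeff_add_single {q : ℂ} (hq : ‖q‖ < 1) {w k : ℕ →₀ ℕ} {M a j : ℕ} (hw : w M = 0)
    (hk : k ≤ w) (hj : j ≤ a) :
    branchCoeff q (w + Finsupp.single M a) (k + Finsupp.single M j) =
      branchCoeff q w k * qBinom q a j := by
  have hM : M ∉ w.support := Finsupp.notMem_support_iff.mpr hw
  have hkM : k M = 0 := Nat.le_zero.mp (hw ▸ hk M)
  rw [branchCoeff_eq_prod hq (s := insert M w.support) _
    (add_le_add hk (Finsupp.single_mono hj)), Finset.prod_insert hM, branchCoeff, mul_comm]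
  · congr 1
    · refine Finset.prod_congr rfl fun i hi => ?_
      have : i ≠ M := fun h => hM (h ▸ hi)
      rw [Finsupp.add_apply, Finsupp.add_apply, Finsupp.single_eq_of_ne this,
        Finsupp.single_eq_of_ne this, add_zero, add_zero]
    · rw [Finsupp.add_apply, Finsupp.add_apply, hw, hkM, zero_add, zero_add,
        Finsupp.single_eq_same, Finsupp.single_eq_same]
  · intro i hi
    rw [Finset.mem_insert]
    by_contra h
    push Not at h
    apply Finsupp.mem_support_iff.mp hi
    rw [Finsupp.add_apply, Finsupp.single_eq_of_ne h.1, Finsupp.notMem_support_iff.mp h.2,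
      add_zero]

theorem vertexOp_zero_one (q : ℂ) : vertexOp q 0 1 = 1 := by
  rw [vertexOp_apply_one, elemSym_zero]

theorem vertexOp_pow_whittaker_shorten (q : ℂ) {n : ℕ →₀ ℕ} {M : ℕ} (hn : ∀ j, M ≤ j → n j = 0)
    (a : ℕ) : (vertexOp q M ^ a) (whittaker q n) =
      whittaker q (n + shorten (Finsupp.single M a)) := by
  cases M with
  | zero =>
    have h0 : n = 0 := by
      ext j
      exact hn j (Nat.zero_le j)
    rw [shorten_single_zero, add_zero, h0, whittaker_zero]
    induction a with
    | zero => rfl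
    | succ a ih => rw [pow_succ', Module.End.mul_apply, ih, Nat.cast_zero, vertexOp_zero_one]
  | succ M =>
    rw [shorten_single_succ, whittaker_add_single q fun j hj => hn j hj, Nat.cast_succ]

/-- The branching rule for `q`-Whittaker functions: adding a variable shortens columns by at
most one. -/
theorem addVarAt_whittaker {q : ℂ} (hq : ‖q‖ < 1) (x : ℂ) (m : ℕ →₀ ℕ) :
    addVarAt x (whittaker q m) = ∑ k ∈ Finset.Iic m,
      (branchCoeff q m k * x ^ k.degree) • whittaker q (m - k + shorten k) := by
  induction m using Finsupp.induction_on_max with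
  | zero =>
    have : Finset.Iic (0 : ℕ →₀ ℕ) = {0} := by
      ext k
      simp
    rw [this, Finset.sum_singleton, whittaker_zero, map_one]
    simp [branchCoeff, whittaker_zero]
  | single_add M a w hw _ ih =>
    have hw' : ∀ j, M ≤ j → w j = 0 := fun j hj => by
      by_contra h
      exact absurd (hw j (Finsupp.mem_support_iff.mpr h)) (by omega)
    have hwM : w M = 0 := hw' M le_rfl
    have hcomm : vertexOp q ((M : ℤ) + 1 - 1) * vertexOp q ((M : ℤ) + 1) =
        q • (vertexOp q ((M : ℤ) + 1) * vertexOp q ((M : ℤ) + 1 - 1)) :=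
      LinearMap.ext fun f => by
        rw [LinearMap.smul_apply, Module.End.mul_apply, Module.End.mul_apply, vertexOp_comm]
    rw [add_comm, whittaker_add_single q fun j hj => hw' j hj.le, addVarAt_vertexOp_pow,
      sum_Iic_add_single hwM, ih, add_smul_pow_of_qcomm hq hcomm,
      LinearMap.sum_apply]
    refine Finset.sum_congr rfl fun j hj => ?_
    have hj' : j ≤ a := Nat.le_of_lt_succ (Finset.mem_range.mp hj)
    rw [map_sum]
    refine Finset.sum_congr rfl fun k hk => ?_
    have hk' : k ≤ w := Finset.mem_Iic.mp hk
    have hkM : k M = 0 := Nat.le_zero.mp (hwM ▸ hk' M)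
    have h1 : ∀ i, M ≤ i → (w - k + shorten k : ℕ →₀ ℕ) i = 0 := by
      intro i hi
      have := hk' (i + 1)
      rw [hw' (i + 1) (by omega)] at this
      rw [Finsupp.add_apply, Finsupp.tsub_apply, hw' i hi, shorten_apply]
      omega
    have h2 : ∀ i, M < i →
        (w - k + shorten k + shorten (Finsupp.single M j) : ℕ →₀ ℕ) i = 0 := by
      intro i hi
      rw [Finsupp.add_apply, h1 i hi.le, shorten_apply, Finsupp.single_eq_of_ne (by omega),
        add_zero]
    have h3 : w + Finsupp.single M a - (k + Finsupp.single M j) +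
        shorten (k + Finsupp.single M j) =
          w - k + shorten k + shorten (Finsupp.single M j) + Finsupp.single M (a - j) := by
      rw [map_add, add_assoc (w - k), add_right_comm _ (_ + _)]
      congr 1
      ext i
      rcases eq_or_ne i M with rfl | hi
      · simp [hwM, hkM]
      · simp [Finsupp.single_eq_of_ne hi]
    rw [LinearMap.smul_apply, Module.End.mul_apply, map_smul, map_smul, add_sub_cancel_right,
      vertexOp_pow_whittaker_shorten q h1, ← whittaker_add_single q h2, ← h3, smul_smul,
      branchCoeff_add_single hq hwM hk' hj', map_add Finsupp.degree, Finsupp.degree_single, pow_add]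
    congr 1
    ring

theorem addVar_whittaker_of_lt (q : ℂ) (m : ℕ →₀ ℕ) :
    ∀ i, m.degree < i → addVar i (whittaker q m) = 0 := by
  induction m using column_induction with
  | h0 =>
    intro i hi
    rw [whittaker_zero, addVar, transl_one_coeff, if_neg (by simp at hi; omega)]
  | hadd M w hw ih =>
    intro i hi
    rw [map_add, Finsupp.degree_single] at hi
    obtain ⟨i, rfl⟩ := Nat.exists_eq_succ_of_ne_zero (n := i) (by omega)
    rw [whittaker_add_single_one q hw, Nat.succ_eq_add_one, addVar_succ_vertexOp, ih _ (by omega),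
      ih _ (by omega), map_zero, map_zero, add_zero]

/-- The leading coefficient of the branching rule removes the first row of the diagram. -/
theorem addVar_degree_whittaker (q : ℂ) (m : ℕ →₀ ℕ) :
    addVar m.degree (whittaker q m) = whittaker q (shorten m) := by
  induction m using column_induction with
  | h0 => rw [map_zero, addVar_zero, map_zero]
  | hadd M w hw ih =>
    have h1 : ∀ j, M ≤ j → shorten w j = 0 := fun j hj => hw (j + 1) (by omega)
    have h2 := vertexOp_pow_whittaker_shorten q h1 1
    rw [pow_one] at h2
    rw [whittaker_add_single_one q hw, map_add, Finsupp.degree_single, addVar_succ_vertexOp,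
      addVar_whittaker_of_lt q w _ (by omega), map_zero, zero_add, ih, add_sub_cancel_right, h2,
      map_add]

/-! ### Multiplication by the functions `g_r` -/

theorem whittaker_single_zero {q : ℂ} (hq : ‖q‖ < 1) (r : ℕ) :
    whittaker q (Finsupp.single 0 r) = qPoch q r • completeSym q r := by
  induction r with
  | zero => rw [Finsupp.single_zero, whittaker_zero, qPoch_zero, one_smul, completeSym_zero]
  | succ r ih =>
    have h : ∀ j, 0 < j → (Finsupp.single 0 r : ℕ →₀ ℕ) j = 0 := fun j hj =>
      Finsupp.single_eq_of_ne (by omega)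
    have h1 := vertexOp_one_completeSym hq r
    rw [Finsupp.single_add, whittaker_add_single_one q h, ih, map_smul, Nat.cast_zero, zero_add,
      h1, smul_smul, qPoch_succ]

/-- The span of the `q`-Whittaker functions of the diagrams that have the size of `w` with
`r` boxes added, first row longer than `r`, and at most one row more than `w`. -/
def longRowSpan (q : ℂ) (w : ℕ →₀ ℕ) (r : ℕ) : Submodule ℂ SymFun :=
  Submodule.span ℂ (whittaker q '' {n | r < n.degree ∧ colSize n = colSize w + r ∧
    ∀ K, (∀ j, K ≤ j → w j = 0) → ∀ j, K + 1 ≤ j → n j = 0})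

/-- The product `g_r P_w` is a multiple of the `q`-Whittaker function of the diagram with first row
`r` above `w`, if `r` is at least the first row of `w`, up to diagrams with first row longer than
`r`. -/
theorem completeSym_mul_whittaker {q : ℂ} (hq : ‖q‖ < 1) (w : ℕ →₀ ℕ) :
    ∀ r, completeSym q r * whittaker q w - (if w.degree ≤ r then (qPoch q (r - w.degree))⁻¹ •
        whittaker q (lengthen w + Finsupp.single 0 (r - w.degree)) else 0) ∈
      longRowSpan q w r := by
  induction w using column_induction with
  | h0 =>
    intro r
    rw [map_zero, if_pos (Nat.zero_le r), map_zero, zero_add, Nat.sub_zero,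
      whittaker_single_zero hq, smul_smul, inv_mul_cancel₀ (qPoch_ne_zero hq r), one_smul,
      whittaker_zero, mul_one, sub_self]
    exact Submodule.zero_mem _
  | hadd M w hw ih =>
    have hsupp : ∀ K, (∀ j, K ≤ j → (w + Finsupp.single M 1 : ℕ →₀ ℕ) j = 0) →
        M < K ∧ ∀ j, K ≤ j → w j = 0 := by
      intro K hK
      constructor
      · by_contra h
        have := hK M (not_lt.mp h)
        rw [Finsupp.add_apply, Finsupp.single_eq_same] at this
        omega
      · intro j hj
        have := hK j hj
        rw [Finsupp.add_apply] at this
        omega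
    intro r
    cases r with
    | zero =>
      have hdeg : (w + Finsupp.single M 1 : ℕ →₀ ℕ).degree = w.degree + 1 := by
        rw [map_add, Finsupp.degree_single]
      rw [completeSym_zero, one_mul, if_neg (by omega), sub_zero]
      refine Submodule.subset_span ⟨_, ⟨by omega, by rw [add_zero], fun K hK j hj => ?_⟩, rfl⟩
      exact hK j (by omega)
    | succ r =>
      have hdeg : (w + Finsupp.single M 1 : ℕ →₀ ℕ).degree = w.degree + 1 := by
        rw [map_add, Finsupp.degree_single]
      have hsize : colSize (w + Finsupp.single M 1) = colSize w + (M + 1) := by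
        rw [map_add, colSize_single, one_mul]
      have hzero : ∀ {n : ℕ →₀ ℕ}, (∀ K, (∀ j, K ≤ j → w j = 0) → ∀ j, K + 1 ≤ j → n j = 0) →
          ∀ j, M + 1 < j → n j = 0 := fun h j hj => h (M + 1) (fun j hj => hw j hj) j hj
      -- The operator `B_{M+1}` lengthens the first row.
      have hB1 : ∀ n : ℕ →₀ ℕ, r + 1 ≤ n.degree → colSize n = colSize w + (r + 1) →
          (∀ K, (∀ j, K ≤ j → w j = 0) → ∀ j, K + 1 ≤ j → n j = 0) →
          vertexOp q (M + 1) (whittaker q n) ∈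
            longRowSpan q (w + Finsupp.single M 1) (r + 1) := by
        intro n h1 h2 h3
        rw [vertexOp_whittaker q (hzero h3)]
        refine Submodule.smul_mem _ _ (Submodule.subset_span ⟨_, ⟨?_, ?_, ?_⟩, rfl⟩)
        · rw [map_add, Finsupp.degree_single]
          omega
        · rw [map_add, colSize_single, hsize, h2]
          ring
        · intro K hK j hj
          rw [Finsupp.add_apply, h3 K (hsupp K hK).2 j hj,
            Finsupp.single_eq_of_ne (by have := (hsupp K hK).1; omega), add_zero]
      have hB2 : ∀ f ∈ longRowSpan q w r, vertexOp q (M + 1 + 1) f ∈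
          longRowSpan q (w + Finsupp.single M 1) (r + 1) := by
        intro f hf
        induction hf using Submodule.span_induction with
        | mem f hf =>
          obtain ⟨n, ⟨h1, h2, h3⟩, rfl⟩ := hf
          have h4 := whittaker_add_single_one q (hzero h3)
          rw [Nat.cast_succ] at h4
          rw [← h4]
          refine Submodule.subset_span ⟨_, ⟨?_, ?_, ?_⟩, rfl⟩
          · rw [map_add, Finsupp.degree_single]
            omega
          · rw [map_add, colSize_single, hsize, h2]
            ring
          · intro K hK j hj
            rw [Finsupp.add_apply, h3 K (hsupp K hK).2 j hj,
              Finsupp.single_eq_of_ne (by have := (hsupp K hK).1; omega), add_zero]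
        | zero => rw [map_zero]; exact Submodule.zero_mem _
        | add f g _ _ hf hg => rw [map_add]; exact Submodule.add_mem _ hf hg
        | smul a f _ hf => rw [map_smul]; exact Submodule.smul_mem _ _ hf
      have hlead : ∀ r K, (∀ j, K ≤ j → w j = 0) → ∀ j, K + 1 ≤ j →
          (lengthen w + Finsupp.single 0 r : ℕ →₀ ℕ) j = 0 := by
        intro r K hK j hj
        obtain ⟨j, rfl⟩ := Nat.exists_eq_succ_of_ne_zero (n := j) (by omega)
        rw [Finsupp.add_apply, Nat.succ_eq_add_one, lengthen_apply_succ, hK j (by omega),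
          Finsupp.single_eq_of_ne (by omega), add_zero]
      have h1 : vertexOp q (M + 1) (completeSym q (r + 1) * whittaker q w) ∈
          longRowSpan q (w + Finsupp.single M 1) (r + 1) := by
        rw [← sub_add_cancel (completeSym q (r + 1) * whittaker q w)
          (if w.degree ≤ r + 1 then (qPoch q (r + 1 - w.degree))⁻¹ •
            whittaker q (lengthen w + Finsupp.single 0 (r + 1 - w.degree)) else 0), map_add]
        refine Submodule.add_mem _ ?_ ?_
        · have := ih (r + 1)
          generalize completeSym q (r + 1) * whittaker q w - _ = f at this
          induction this using Submodule.span_induction with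
          | mem f hf =>
            obtain ⟨n, ⟨h1, h2, h3⟩, rfl⟩ := hf
            exact hB1 n h1.le h2 h3
          | zero => rw [map_zero]; exact Submodule.zero_mem _
          | add f g _ _ hf hg => rw [map_add]; exact Submodule.add_mem _ hf hg
          | smul a f _ hf => rw [map_smul]; exact Submodule.smul_mem _ _ hf
        · split_ifs with h
          · rw [map_smul]
            refine Submodule.smul_mem _ _ (hB1 _ ?_ ?_ (hlead _))
            · rw [map_add, degree_lengthen, Finsupp.degree_single]
              omega
            · rw [map_add, colSize_lengthen, colSize_single]
              omega
          · rw [map_zero]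
            exact Submodule.zero_mem _
      have h2 : vertexOp q (M + 1 + 1) (if w.degree ≤ r then (qPoch q (r - w.degree))⁻¹ •
          whittaker q (lengthen w + Finsupp.single 0 (r - w.degree)) else 0) =
          if (w + Finsupp.single M 1 : ℕ →₀ ℕ).degree ≤ r + 1 then
            (qPoch q (r + 1 - (w + Finsupp.single M 1 : ℕ →₀ ℕ).degree))⁻¹ •
              whittaker q (lengthen (w + Finsupp.single M 1) +
                Finsupp.single 0 (r + 1 - (w + Finsupp.single M 1 : ℕ →₀ ℕ).degree)) else 0 := by
        rw [hdeg, Nat.add_sub_add_right]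
        by_cases h : w.degree ≤ r
        · have h3 := whittaker_add_single_one q (hzero (hlead (r - w.degree)))
          rw [Nat.cast_succ] at h3
          rw [if_pos h, if_pos (by omega), map_smul, map_add lengthen, lengthen_single,
            ← h3, add_right_comm]
        · rw [if_neg h, if_neg (by omega), map_zero]
      rw [whittaker_add_single_one q hw, completeSym_succ_mul_vertexOp hq, ← h2, add_sub_assoc,
        ← map_sub]
      exact Submodule.add_mem _ h1 (hB2 _ (ih r))

theorem longRowSpan_le (q : ℂ) (w : ℕ →₀ ℕ) (r : ℕ) :
    longRowSpan q w r ≤ Submodule.span ℂ (Set.range (whittaker q)) :=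
  Submodule.span_mono (Set.image_subset_range _ _)

theorem completeSym_mul_mem_span {q : ℂ} (hq : ‖q‖ < 1) (r : ℕ) {f : SymFun}
    (hf : f ∈ Submodule.span ℂ (Set.range (whittaker q))) :
    completeSym q r * f ∈ Submodule.span ℂ (Set.range (whittaker q)) := by
  induction hf using Submodule.span_induction with
  | mem f hf =>
    obtain ⟨w, rfl⟩ := hf
    rw [← Submodule.sub_mem_iff_left _ _ (x := completeSym q r * whittaker q w)
      (y := if w.degree ≤ r then (qPoch q (r - w.degree))⁻¹ •
        whittaker q (lengthen w + Finsupp.single 0 (r - w.degree)) else 0)]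
    · exact longRowSpan_le q w r (completeSym_mul_whittaker hq w r)
    · split_ifs
      · exact Submodule.smul_mem _ _ (Submodule.subset_span ⟨_, rfl⟩)
      · exact Submodule.zero_mem _
  | zero => rw [mul_zero]; exact Submodule.zero_mem _
  | add f g _ _ hf hg => rw [mul_add]; exact Submodule.add_mem _ hf hg
  | smul a f _ hf => rw [mul_smul_comm]; exact Submodule.smul_mem _ _ hf

/-- The functions `g_r` generate the ring of symmetric functions. -/
theorem mem_of_completeSym_mul_mem {q : ℂ} (hq : ‖q‖ < 1) {V : Submodule ℂ SymFun} (h1 : 1 ∈ V)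
    (hV : ∀ r, ∀ f ∈ V, completeSym q r * f ∈ V) (f : SymFun) : f ∈ V := by
  have key : ∀ n, ∀ f ∈ V, psumSucc n * f ∈ V := by
    intro n
    induction n using Nat.strong_induction_on with
    | _ n ih =>
      intro f hf
      have h2 := smul_completeSym_succ q n
      rw [Finset.sum_range_succ, Nat.sub_self, completeSym_zero, mul_one] at h2
      have h3 : psumSucc n * f = (1 - q ^ (n + 1)) • (((n + 1 : ℕ) : ℂ) •
          (completeSym q (n + 1) * f) - ∑ i ∈ Finset.range n,
            (1 - q ^ (i + 1))⁻¹ • (psumSucc i * (completeSym q (n - i) * f))) := by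
        have h4 : ∑ i ∈ Finset.range n,
            (1 - q ^ (i + 1))⁻¹ • (psumSucc i * (completeSym q (n - i) * f)) =
            (∑ i ∈ Finset.range n,
              (1 - q ^ (i + 1))⁻¹ • (psumSucc i * completeSym q (n - i))) * f := by
          rw [Finset.sum_mul]
          simp only [smul_mul_assoc, mul_assoc]
        rw [h4, ← smul_mul_assoc, h2, ← sub_mul, add_sub_cancel_left, smul_mul_assoc, smul_smul,
          mul_inv_cancel₀ (one_sub_pow_ne_zero hq n), one_smul]
      rw [h3]
      refine V.smul_mem _ (V.sub_mem (V.smul_mem _ (hV _ _ hf)) (V.sum_mem fun i hi => ?_))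
      exact V.smul_mem _ (ih i (Finset.mem_range.mp hi) _ (hV _ _ hf))
  induction f using symFun_induction with
  | h1 => exact h1
  | hadd f g hf hg => exact V.add_mem hf hg
  | hsmul a f hf => exact V.smul_mem a hf
  | hmul f n hf =>
    rw [mul_comm]
    exact key n f hf

theorem span_whittaker {q : ℂ} (hq : ‖q‖ < 1) :
    Submodule.span ℂ (Set.range (whittaker q)) = ⊤ :=
  Submodule.eq_top_iff'.mpr fun f => mem_of_completeSym_mul_mem hq
    (V := Submodule.span ℂ (Set.range (whittaker q)))
    (Submodule.subset_span ⟨0, whittaker_zero q⟩) (fun r _ hf => completeSym_mul_mem_span hq r hf) f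

/-! ### The inner product -/

theorem macInner_eq_sum (q t : ℂ) (f g : SymFun) {s : Finset (ℕ+ →₀ ℕ)} (hs : f.support ⊆ s) :
    macInner q t f g = ∑ m ∈ s, f.coeff m * g.coeff m * powerSumNorm q t m := by
  refine Finset.sum_subset hs fun m _ hm => ?_
  rw [MvPolynomial.notMem_support_iff.mp hm, zero_mul, zero_mul]

theorem macInner_comm (q t : ℂ) (f g : SymFun) : macInner q t f g = macInner q t g f := by
  rw [macInner_eq_sum q t f g (Finset.subset_union_left (s₂ := g.support)),
    macInner_eq_sum q t g f (Finset.subset_union_right (s₁ := f.support))]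
  exact Finset.sum_congr rfl fun m _ => by ring

theorem macInner_add_right (q t : ℂ) (f g h : SymFun) :
    macInner q t f (g + h) = macInner q t f g + macInner q t f h := by
  simp only [macInner, MvPolynomial.coeff_add, mul_add, add_mul, Finset.sum_add_distrib]

theorem macInner_smul_right (q t a : ℂ) (f g : SymFun) :
    macInner q t f (a • g) = a * macInner q t f g := by
  simp only [macInner, MvPolynomial.coeff_smul, Finset.mul_sum, smul_eq_mul]
  exact Finset.sum_congr rfl fun m _ => by ring

/-- `macInner` as a linear map in its second argument. -/
def macInnerRight (q t : ℂ) (f : SymFun) : SymFun →ₗ[ℂ] ℂ where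
  toFun := macInner q t f
  map_add' := macInner_add_right q t f
  map_smul' a g := macInner_smul_right q t a f g

theorem macInnerRight_apply (q t : ℂ) (f g : SymFun) :
    macInnerRight q t f g = macInner q t f g := rfl

theorem macInner_add_left (q t : ℂ) (f g h : SymFun) :
    macInner q t (f + g) h = macInner q t f h + macInner q t g h := by
  rw [macInner_comm, macInner_add_right, macInner_comm q t h f, macInner_comm q t h g]

theorem macInner_smul_left (q t a : ℂ) (f g : SymFun) :
    macInner q t (a • f) g = a * macInner q t f g := by
  rw [macInner_comm, macInner_smul_right, macInner_comm]

theorem macInner_zero_left (q t : ℂ) (g : SymFun) : macInner q t 0 g = 0 := by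
  simp [macInner]

theorem macInner_zero_right (q t : ℂ) (f : SymFun) : macInner q t f 0 = 0 := by
  simp [macInner]

theorem macInner_monomial (q t : ℂ) (f : SymFun) (m : ℕ+ →₀ ℕ) (a : ℂ) :
    macInner q t f (MvPolynomial.monomial m a) = f.coeff m * a * powerSumNorm q t m := by
  rw [macInner_eq_sum q t f _ (Finset.subset_insert m f.support), Finset.sum_eq_single m]
  · rw [MvPolynomial.coeff_monomial, if_pos rfl]
  · intro n _ hn
    rw [MvPolynomial.coeff_monomial, if_neg (Ne.symm hn), mul_zero, zero_mul]
  · intro h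
    exact absurd (Finset.mem_insert_self m _) h

theorem powerSumNorm_zero (q t : ℂ) : powerSumNorm q t 0 = 1 := Finsupp.prod_zero_index

theorem macInner_one_right (q t : ℂ) (f : SymFun) :
    macInner q t f 1 = MvPolynomial.constantCoeff f := by
  have := macInner_monomial q t f 0 1
  rw [powerSumNorm_zero, mul_one, mul_one] at this
  exact this

theorem powerSumNorm_add_single (q : ℂ) (m : ℕ+ →₀ ℕ) (k : ℕ+) :
    powerSumNorm q 0 (m + Finsupp.single k 1) =
      (m k + 1) * ((k : ℕ) : ℂ) * (1 - q ^ (k : ℕ)) * powerSumNorm q 0 m := by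
  have h1 : ∀ n : ℕ+ →₀ ℕ, powerSumNorm q 0 n = (fun e : ℕ => (e.factorial : ℂ) *
      ((k : ℕ) : ℂ) ^ e * ((1 - q ^ (k : ℕ)) / (1 - 0 ^ (k : ℕ))) ^ e) (n k) *
      powerSumNorm q 0 (n.erase k) := by
    intro n
    exact (Finsupp.mul_prod_erase' n k _ fun k => by simp).symm
  rw [h1, h1 m]
  simp only [Finsupp.add_apply, Finsupp.single_eq_same, zero_pow k.ne_zero, sub_zero, div_one,
    Finsupp.erase_add, Finsupp.erase_single, add_zero, Nat.factorial_succ, pow_succ]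
  push_cast
  ring

/-- Multiplication by `p_k` is adjoint to `k (1 - q^k) ∂/∂p_k`. -/
theorem macInner_mul_psumSucc (q : ℂ) (f g : SymFun) (n : ℕ) :
    macInner q 0 f (g * psumSucc n) =
      (((n + 1 : ℕ) : ℂ) * (1 - q ^ (n + 1))) *
        macInner q 0 (MvPolynomial.pderiv n.succPNat f) g := by
  induction g using MvPolynomial.induction_on' with
  | add g h hg hh =>
    rw [add_mul, macInner_add_right, macInner_add_right, hg, hh, mul_add]
  | monomial m a =>
    have h1 : MvPolynomial.monomial m a * psumSucc n =
        MvPolynomial.monomial (m + Finsupp.single n.succPNat 1) a := by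
      rw [psumSucc, MvPolynomial.X, MvPolynomial.monomial_mul, mul_one]
    rw [h1, macInner_monomial, macInner_monomial, powerSumNorm_add_single,
      MvPolynomial.coeff_pderiv]
    simp only [Nat.succPNat_coe, Nat.succ_eq_add_one]
    ring

theorem pderiv_psumSucc (n k : ℕ) :
    MvPolynomial.pderiv n.succPNat (psumSucc k) = if k = n then 1 else 0 := by
  rw [psumSucc, MvPolynomial.pderiv_X]
  by_cases h : k = n
  · rw [h, if_pos rfl, Pi.single_eq_same]
  · rw [if_neg h, Pi.single_eq_of_ne]
    intro h'
    exact h (Nat.succPNat_injective h')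

theorem pderiv_addVar (n i : ℕ) (f : SymFun) :
    MvPolynomial.pderiv n.succPNat (addVar i f) =
      addVar i (MvPolynomial.pderiv n.succPNat f) := by
  induction f using symFun_induction generalizing i with
  | h1 =>
    rw [addVar, transl_one_coeff, Derivation.map_one_eq_zero, map_zero]
    split_ifs <;> simp
  | hadd f g hf hg => simp only [map_add, hf, hg]
  | hsmul a f hf => rw [map_smul, Derivation.map_smul, Derivation.map_smul, map_smul, hf]
  | hmul f k hf =>
    have h1 : addVar i (f * psumSucc k) = addVar i f * psumSucc k +
        if k + 1 ≤ i then (1 : ℂ) • addVar (i - (k + 1)) f else 0 :=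
      translCoeff_mul_psumSucc _ i k f
    have h2 : addVar i (MvPolynomial.pderiv n.succPNat f * psumSucc k) =
        addVar i (MvPolynomial.pderiv n.succPNat f) * psumSucc k +
        if k + 1 ≤ i then (1 : ℂ) • addVar (i - (k + 1)) (MvPolynomial.pderiv n.succPNat f)
          else 0 :=
      translCoeff_mul_psumSucc _ i k _
    rw [h1, map_add, Derivation.leibniz, Derivation.leibniz, pderiv_psumSucc, smul_eq_mul,
      smul_eq_mul, smul_eq_mul, smul_eq_mul, map_add, mul_comm (psumSucc k) (_ : SymFun), hf,
      mul_comm (psumSucc k) (_ : SymFun), h2]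
    have h3 : addVar i (f * if k = n then 1 else 0) = addVar i f * if k = n then 1 else 0 := by
      split_ifs <;> simp
    rw [h3]
    split_ifs <;> simp [hf, add_assoc]

theorem pderiv_completeSym {q : ℂ} (hq : ‖q‖ < 1) (n r : ℕ) :
    (((n + 1 : ℕ) : ℂ) * (1 - q ^ (n + 1))) •
        MvPolynomial.pderiv n.succPNat (completeSym q r) =
      if n + 1 ≤ r then completeSym q (r - (n + 1)) else 0 := by
  induction r using Nat.strong_induction_on with
  | _ r ih =>
    cases r with
    | zero => rw [completeSym_zero, Derivation.map_one_eq_zero, smul_zero, if_neg (by omega)]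
    | succ r =>
      have hr : ((r + 1 : ℕ) : ℂ) ≠ 0 := Nat.cast_ne_zero.mpr r.succ_ne_zero
      have h1 := congrArg (MvPolynomial.pderiv n.succPNat) (smul_completeSym_succ q r)
      rw [Derivation.map_smul, map_sum] at h1
      refine smul_right_injective SymFun hr ?_
      change ((r + 1 : ℕ) : ℂ) • _ = ((r + 1 : ℕ) : ℂ) • _
      rw [smul_comm, h1, Finset.smul_sum]
      have h2 : ∀ i ∈ Finset.range (r + 1),
          (((n + 1 : ℕ) : ℂ) * (1 - q ^ (n + 1))) • MvPolynomial.pderiv n.succPNat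
              ((1 - q ^ (i + 1))⁻¹ • (psumSucc i * completeSym q (r - i))) =
            (if n + 1 ≤ r - i then (1 - q ^ (i + 1))⁻¹ •
              (psumSucc i * completeSym q (r - i - (n + 1))) else 0) +
            (if i = n then ((n + 1 : ℕ) : ℂ) • completeSym q (r - n) else 0) := by
        intro i hi
        have hi' := Finset.mem_range.mp hi
        rw [Derivation.map_smul, smul_comm, Derivation.leibniz, smul_add, smul_add, smul_eq_mul, smul_eq_mul,
          ← mul_smul_comm, ih (r - i) (by omega), pderiv_psumSucc]
        congr 1
        · split_ifs <;> simp
        · split_ifs with h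
          · subst h
            rw [mul_one, smul_smul, mul_left_comm,
              inv_mul_cancel₀ (one_sub_pow_ne_zero hq i), mul_one]
          · simp
      rw [Finset.sum_congr rfl h2, Finset.sum_add_distrib, Finset.sum_ite_eq']
      simp only [Finset.mem_range]
      by_cases hn : n + 1 ≤ r + 1
      · rw [if_pos (by omega), if_pos hn, Nat.add_sub_add_right]
        rcases Nat.eq_or_lt_of_le (Nat.le_of_succ_le_succ hn) with rfl | hnr
        · rw [Finset.sum_eq_zero, zero_add]
          intro i _
          rw [if_neg (by omega)]
        · obtain ⟨s, rfl⟩ := Nat.exists_eq_add_of_lt hnr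
          have h3 : n + s + 1 - n = s + 1 := by omega
          have h4 : ∑ i ∈ Finset.range (n + s + 1 + 1), (if n + 1 ≤ n + s + 1 - i then
              (1 - q ^ (i + 1))⁻¹ • (psumSucc i * completeSym q (n + s + 1 - i - (n + 1)))
                else 0) =
              ((s + 1 : ℕ) : ℂ) • completeSym q (s + 1) := by
            rw [smul_completeSym_succ, ← Finset.sum_subset
              (Finset.range_subset_range.mpr (by omega : s + 1 ≤ n + s + 1 + 1))]
            · refine Finset.sum_congr rfl fun i hi => ?_
              have := Finset.mem_range.mp hi
              rw [if_pos (by omega), show n + s + 1 - i - (n + 1) = s - i by omega]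
            · intro i _ hi
              have := Finset.mem_range.not.mp hi
              rw [if_neg (by omega)]
          rw [h4, h3, ← add_smul]
          congr 1
          push_cast
          ring
      · rw [if_neg (by omega), if_neg hn, add_zero, smul_zero, Finset.sum_eq_zero]
        intro i _
        rw [if_neg (by omega)]

theorem constantCoeff_addVar_mul_psumSucc (i n : ℕ) (f : SymFun) :
    MvPolynomial.constantCoeff (addVar i (f * psumSucc n)) =
      if n + 1 ≤ i then MvPolynomial.constantCoeff (addVar (i - (n + 1)) f) else 0 := by
  have h1 : addVar i (f * psumSucc n) = addVar i f * psumSucc n +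
      if n + 1 ≤ i then (1 : ℂ) • addVar (i - (n + 1)) f else 0 :=
    translCoeff_mul_psumSucc _ i n f
  have h2 : MvPolynomial.constantCoeff (psumSucc n) = 0 := MvPolynomial.constantCoeff_X _ _
  rw [h1, map_add, map_mul, h2, mul_zero, zero_add, one_smul]
  split_ifs
  · rfl
  · rw [map_zero]

theorem macInner_completeSym {q : ℂ} (hq : ‖q‖ < 1) (f : SymFun) (r : ℕ) :
    macInner q 0 f (completeSym q r) = MvPolynomial.constantCoeff (addVar r f) := by
  induction f using symFun_induction generalizing r with
  | h1 =>
    rw [macInner_comm, macInner_one_right, addVar, transl_one_coeff]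
    have := constantCoeff_whittaker q (Finsupp.single 0 r)
    rw [whittaker_single_zero hq, MvPolynomial.constantCoeff_smul] at this
    split_ifs with h
    · rw [h, completeSym_zero]
    · rw [if_neg (by simpa using h)] at this
      rw [map_zero]
      exact (mul_eq_zero.mp this).resolve_left (qPoch_ne_zero hq r)
  | hadd f g hf hg => rw [macInner_add_left, map_add, map_add, hf, hg]
  | hsmul a f hf =>
    rw [macInner_smul_left, map_smul, MvPolynomial.constantCoeff_smul, hf, smul_eq_mul]
  | hmul f n hf =>
    rw [macInner_comm, macInner_mul_psumSucc, ← macInner_smul_left, pderiv_completeSym hq,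
      constantCoeff_addVar_mul_psumSucc]
    split_ifs
    · rw [macInner_comm, hf]
    · rw [macInner_zero_left]

/-- Multiplication by `g_r` is adjoint to the coefficient of `x ^ r` in the operator
`f[X] ↦ f[X + x]`. -/
theorem macInner_completeSym_mul {q : ℂ} (hq : ‖q‖ < 1) (f h : SymFun) (r : ℕ) :
    macInner q 0 f (completeSym q r * h) = macInner q 0 (addVar r f) h := by
  induction h using symFun_induction generalizing f with
  | h1 => rw [mul_one, macInner_completeSym hq, macInner_one_right]
  | hadd g h hg hh => rw [mul_add, macInner_add_right, macInner_add_right, hg, hh]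
  | hsmul a h hh => rw [mul_smul_comm, macInner_smul_right, macInner_smul_right, hh]
  | hmul h n hh => rw [← mul_assoc, macInner_mul_psumSucc, macInner_mul_psumSucc, hh,
      pderiv_addVar]

/-! ### Orthogonality of the `q`-Whittaker functions -/

theorem macInner_longRowSpan_eq_zero {q : ℂ} {f : SymFun} {w : ℕ →₀ ℕ} {r : ℕ}
    (h : ∀ n, r < n.degree → colSize n = colSize w + r → macInner q 0 f (whittaker q n) = 0)
    {g : SymFun} (hg : g ∈ longRowSpan q w r) : macInner q 0 f g = 0 := by
  have h1 : longRowSpan q w r ≤ LinearMap.ker (macInnerRight q 0 f) := by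
    refine Submodule.span_le.mpr ?_
    rintro _ ⟨n, ⟨h1, h2, -⟩, rfl⟩
    exact h n h1 h2
  exact h1 hg

/-- If `P_m` is orthogonal to all diagrams of the size of `n` with longer first row than `n`, then
its product with `P_n` is computed by removing the first rows. -/
theorem macInner_whittaker_shorten {q : ℂ} (hq : ‖q‖ < 1) (m n : ℕ →₀ ℕ)
    (h : ∀ n', n.degree < n'.degree → colSize n' = colSize n →
      macInner q 0 (whittaker q m) (whittaker q n') = 0) :
    (qPoch q (n 0))⁻¹ * macInner q 0 (whittaker q m) (whittaker q n) =
      macInner q 0 (addVar n.degree (whittaker q m)) (whittaker q (shorten n)) := by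
  have h1 : n.degree = (shorten n).degree + n 0 := degree_eq_shorten_add n
  have h2 : colSize n = colSize (shorten n) + n.degree := colSize_eq_shorten_add n
  have h3 := completeSym_mul_whittaker hq (shorten n) n.degree
  have h4 : n.degree - (shorten n).degree = n 0 := by omega
  rw [if_pos (by omega), h4, lengthen_shorten_add] at h3
  have h5 := macInner_longRowSpan_eq_zero (f := whittaker q m)
    (fun n' h6 h7 => h n' h6 (h7.trans h2.symm)) h3
  rw [← macInner_completeSym_mul hq, ← sub_add_cancel
    (completeSym q n.degree * whittaker q (shorten n)) ((qPoch q (n 0))⁻¹ • whittaker q n),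
    macInner_add_right, h5, zero_add, macInner_smul_right]

theorem macInner_whittaker_of_degree_lt {q : ℂ} (hq : ‖q‖ < 1) {m n : ℕ →₀ ℕ}
    (h : m.degree < n.degree) : macInner q 0 (whittaker q m) (whittaker q n) = 0 := by
  -- Downward induction on the length of the first row of `n`, for given size of `n`.
  induction hd : colSize n - n.degree using Nat.strong_induction_on generalizing n with
  | _ d ih =>
    have h1 := macInner_whittaker_shorten hq m n fun n' h2 h3 => by
      have := degree_le_colSize n'
      exact ih (colSize n' - n'.degree) (by omega) (h.trans h2) rfl
    rw [addVar_whittaker_of_lt q m _ h, macInner_zero_left] at h1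
    exact (mul_eq_zero.mp h1).resolve_left (inv_ne_zero (qPoch_ne_zero hq _))

theorem macInner_whittaker_rec {q : ℂ} (hq : ‖q‖ < 1) {m n : ℕ →₀ ℕ}
    (h : m.degree = n.degree) :
    macInner q 0 (whittaker q m) (whittaker q n) =
      qPoch q (n 0) * macInner q 0 (whittaker q (shorten m)) (whittaker q (shorten n)) := by
  have h1 := macInner_whittaker_shorten hq m n fun n' h2 _ =>
    macInner_whittaker_of_degree_lt hq (h.trans_lt h2)
  rw [← h, addVar_degree_whittaker] at h1
  rw [← h1, mul_inv_cancel_left₀ (qPoch_ne_zero hq _)]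

theorem colSize_shorten_lt {m : ℕ →₀ ℕ} (hm : m ≠ 0) : colSize (shorten m) < colSize m := by
  have h1 : 0 < m.degree := Nat.pos_of_ne_zero fun h => hm ((Finsupp.degree_eq_zero_iff m).mp h)
  rw [colSize_eq_shorten_add m]
  omega

theorem macInner_whittaker_of_ne {q : ℂ} (hq : ‖q‖ < 1) {m n : ℕ →₀ ℕ} (h : m ≠ n) :
    macInner q 0 (whittaker q m) (whittaker q n) = 0 := by
  induction hd : colSize m using Nat.strong_induction_on generalizing m n with
  | _ d ih =>
    rcases lt_trichotomy m.degree n.degree with h1 | h1 | h1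
    · exact macInner_whittaker_of_degree_lt hq h1
    · have h2 : m ≠ 0 := by
        rintro rfl
        rw [map_zero] at h1
        exact h ((Finsupp.degree_eq_zero_iff n).mp h1.symm).symm
      have h3 : shorten m ≠ shorten n := by
        intro h4
        have h5 : m 0 = n 0 := by
          have h6 := h1
          rw [← lengthen_shorten_add m, ← lengthen_shorten_add n, map_add, map_add,
            degree_lengthen, degree_lengthen, Finsupp.degree_single, Finsupp.degree_single,
            h4] at h6
          omega
        exact h (by rw [← lengthen_shorten_add m, ← lengthen_shorten_add n, h4, h5])
      rw [macInner_whittaker_rec hq h1, ih _ (hd ▸ colSize_shorten_lt h2) h3 rfl, mul_zero]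
    · rw [macInner_comm]
      exact macInner_whittaker_of_degree_lt hq h1

theorem macInner_whittaker_self_ne_zero {q : ℂ} (hq : ‖q‖ < 1) (m : ℕ →₀ ℕ) :
    macInner q 0 (whittaker q m) (whittaker q m) ≠ 0 := by
  induction hd : colSize m using Nat.strong_induction_on generalizing m with
  | _ d ih =>
    by_cases hm : m = 0
    · rw [hm, whittaker_zero, macInner_one_right, map_one]
      exact one_ne_zero
    · rw [macInner_whittaker_rec hq rfl]
      exact mul_ne_zero (qPoch_ne_zero hq _) (ih _ (hd ▸ colSize_shorten_lt hm) _ rfl)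

theorem linearIndependent_whittaker {q : ℂ} (hq : ‖q‖ < 1) :
    LinearIndependent ℂ (whittaker q) := by
  rw [linearIndependent_iff]
  intro c hc
  ext m
  have h1 : macInnerRight q 0 (whittaker q m) (Finsupp.linearCombination ℂ (whittaker q) c) =
      c m * macInner q 0 (whittaker q m) (whittaker q m) := by
    rw [Finsupp.linearCombination_apply, Finsupp.sum, map_sum, Finset.sum_eq_single m]
    · rw [map_smul, macInnerRight_apply, smul_eq_mul]
    · intro n _ hn
      rw [map_smul, macInnerRight_apply, macInner_whittaker_of_ne hq hn.symm, smul_zero]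
    · intro h
      rw [Finsupp.notMem_support_iff.mp h, zero_smul, map_zero]
  rw [hc, map_zero] at h1
  exact (mul_eq_zero.mp h1.symm).resolve_right (macInner_whittaker_self_ne_zero hq m)

/-- The basis of `q`-Whittaker functions. -/
def whittakerBasis {q : ℂ} (hq : ‖q‖ < 1) : Module.Basis (ℕ →₀ ℕ) ℂ SymFun :=
  Module.Basis.mk (linearIndependent_whittaker hq) (span_whittaker hq).ge

theorem whittakerBasis_apply {q : ℂ} (hq : ‖q‖ < 1) (m : ℕ →₀ ℕ) :
    whittakerBasis hq m = whittaker q m := Module.Basis.mk_apply _ _ _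

theorem eq_sum_whittaker {q : ℂ} (hq : ‖q‖ < 1) (f : SymFun) :
    f = ((whittakerBasis hq).repr f).sum fun m a => a • whittaker q m := by
  conv_lhs => rw [← (whittakerBasis hq).linearCombination_repr f]
  rw [Finsupp.linearCombination_apply]
  simp only [whittakerBasis_apply]

theorem macInner_whittaker_eq_repr {q : ℂ} (hq : ‖q‖ < 1) (f : SymFun) (m : ℕ →₀ ℕ) :
    macInner q 0 f (whittaker q m) =
      (whittakerBasis hq).repr f m * macInner q 0 (whittaker q m) (whittaker q m) := by
  rw [macInner_comm, ← macInnerRight_apply]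
  conv_lhs => rw [eq_sum_whittaker hq f]
  rw [Finsupp.sum, map_sum, Finset.sum_eq_single m]
  · rw [map_smul, macInnerRight_apply, smul_eq_mul]
  · intro n _ hn
    rw [map_smul, macInnerRight_apply, macInner_whittaker_of_ne hq hn.symm, smul_zero]
  · intro h
    rw [Finsupp.notMem_support_iff.mp h, zero_smul, map_zero]

/-! ### Young diagrams and column multiplicities -/

/-- The length of row `i` of the diagram with column multiplicities `m`. -/
def rowOf (m : ℕ →₀ ℕ) (i : ℕ) : ℕ := (shorten^[i] m).degree

theorem rowOf_zero (m : ℕ →₀ ℕ) : rowOf m 0 = m.degree := rfl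

theorem rowOf_shorten (m : ℕ →₀ ℕ) (i : ℕ) : rowOf (shorten m) i = rowOf m (i + 1) := rfl

theorem rowOf_add (m n : ℕ →₀ ℕ) (i : ℕ) : rowOf (m + n) i = rowOf m i + rowOf n i := by
  induction i generalizing m n with
  | zero => exact map_add _ _ _
  | succ i ih => rw [← rowOf_shorten, map_add, ih, rowOf_shorten, rowOf_shorten]

theorem rowOf_eq (m : ℕ →₀ ℕ) (i : ℕ) : rowOf m i = rowOf m (i + 1) + m i := by
  induction i generalizing m with
  | zero => exact degree_eq_shorten_add m
  | succ i ih => rw [← rowOf_shorten, ih (shorten m), rowOf_shorten, shorten_apply]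

theorem rowOf_antitone (m : ℕ →₀ ℕ) : Antitone (rowOf m) :=
  antitone_nat_of_succ_le fun i => by rw [rowOf_eq m i]; omega

theorem rowOf_eq_zero {m : ℕ →₀ ℕ} {i : ℕ} (h : ∀ j, i ≤ j → m j = 0) : rowOf m i = 0 := by
  induction i generalizing m with
  | zero =>
    have : m = 0 := by
      ext j
      exact h j (Nat.zero_le j)
    rw [this, rowOf_zero, map_zero]
  | succ i ih =>
    rw [← rowOf_shorten]
    exact ih fun j hj => h (j + 1) (by omega)

theorem sum_rowOf {m : ℕ →₀ ℕ} {L : ℕ} (h : ∀ j, L ≤ j → m j = 0) :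
    ∑ i ∈ Finset.range L, rowOf m i = colSize m := by
  induction L generalizing m with
  | zero =>
    have : m = 0 := by
      ext j
      exact h j (Nat.zero_le j)
    rw [this, map_zero, Finset.sum_range_zero]
  | succ L ih =>
    rw [Finset.sum_range_succ', colSize_eq_shorten_add, ← ih fun j hj => h (j + 1) (by omega)]
    rfl

theorem colSize_shorten_add_degree (k : ℕ →₀ ℕ) : colSize (shorten k) + k.degree = colSize k :=
  (colSize_eq_shorten_add k).symm

theorem rowOf_branch {m k : ℕ →₀ ℕ} (hk : k ≤ m) (i : ℕ) :
    rowOf (m - k + shorten k) i + k i = rowOf m i := by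
  rw [rowOf_add, rowOf_shorten, add_assoc, ← rowOf_eq, ← rowOf_add, tsub_add_cancel_of_le hk]

theorem colSize_branch {m k : ℕ →₀ ℕ} (hk : k ≤ m) :
    colSize (m - k + shorten k) + k.degree = colSize m := by
  rw [map_add, add_assoc, colSize_shorten_add_degree, ← map_add, tsub_add_cancel_of_le hk]

theorem exists_bound (m : ℕ →₀ ℕ) : ∃ L, ∀ j, L ≤ j → m j = 0 := by
  refine ⟨m.support.sup Nat.succ, fun j hj => ?_⟩
  by_contra h
  have := Finset.le_sup (f := Nat.succ) (Finsupp.mem_support_iff.mpr h)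
  omega

/-- The column multiplicities of a Young diagram: the value at `i` is the number of columns of
length `i + 1`. -/
def colMult (μ : YoungDiagram) : ℕ →₀ ℕ :=
  Finsupp.onFinset (Finset.range (μ.colLen 0)) (fun i => μ.rowLen i - μ.rowLen (i + 1))
    fun i hi => by
      rw [Finset.mem_range, ← YoungDiagram.mem_iff_lt_colLen, YoungDiagram.mem_iff_lt_rowLen]
      omega

theorem colMult_apply (μ : YoungDiagram) (i : ℕ) :
    colMult μ i = μ.rowLen i - μ.rowLen (i + 1) := rfl

theorem partMult_transpose (μ : YoungDiagram) (i : ℕ) :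
    partMult μ.transpose i = colMult μ i := by
  rw [partMult, YoungDiagram.colLen_transpose, YoungDiagram.colLen_transpose, colMult_apply]

theorem rowLen_eq_zero {μ : YoungDiagram} {i : ℕ} (h : μ.colLen 0 ≤ i) : μ.rowLen i = 0 := by
  by_contra h'
  have := YoungDiagram.mem_iff_lt_colLen.mp
    (YoungDiagram.mem_iff_lt_rowLen.mpr (Nat.pos_of_ne_zero h'))
  omega

theorem colMult_eq_zero {μ : YoungDiagram} {i : ℕ} (h : μ.colLen 0 ≤ i) : colMult μ i = 0 := by
  rw [colMult_apply, rowLen_eq_zero h, Nat.zero_sub]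

theorem rowOf_colMult (μ : YoungDiagram) (i : ℕ) : rowOf (colMult μ) i = μ.rowLen i := by
  have h : ∀ d i, μ.colLen 0 ≤ i + d → rowOf (colMult μ) i = μ.rowLen i := by
    intro d
    induction d with
    | zero =>
      intro i hi
      rw [add_zero] at hi
      rw [rowLen_eq_zero hi, rowOf_eq_zero fun j hj => colMult_eq_zero (le_trans hi hj)]
    | succ d ih =>
      intro i hi
      rw [rowOf_eq, ih (i + 1) (by omega), colMult_apply]
      have := μ.rowLen_anti i (i + 1) (Nat.le_succ i)
      omega
  exact h (μ.colLen 0) i (by omega)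

theorem degree_colMult (μ : YoungDiagram) : (colMult μ).degree = μ.rowLen 0 :=
  rowOf_colMult μ 0

theorem le_of_rowLen_le {μ ν : YoungDiagram} (h : ∀ i, μ.rowLen i ≤ ν.rowLen i) : μ ≤ ν := by
  rintro ⟨i, j⟩ hij
  exact YoungDiagram.mem_iff_lt_rowLen.mpr
    ((YoungDiagram.mem_iff_lt_rowLen.mp hij).trans_le (h i))

theorem eq_of_rowLen_eq {μ ν : YoungDiagram} (h : ∀ i, μ.rowLen i = ν.rowLen i) : μ = ν :=
  le_antisymm (le_of_rowLen_le fun i => (h i).le) (le_of_rowLen_le fun i => (h i).ge)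

theorem colMult_injective : Function.Injective colMult := fun μ ν h =>
  eq_of_rowLen_eq fun i => by rw [← rowOf_colMult, ← rowOf_colMult, h]

theorem colMult_surjective : Function.Surjective colMult := by
  intro m
  obtain ⟨L, hL⟩ := exists_bound m
  let μ : YoungDiagram :=
    { cells := (Finset.range L ×ˢ Finset.range m.degree).filter fun c => c.2 < rowOf m c.1
      isLowerSet := by
        rintro ⟨i, j⟩ ⟨i', j'⟩ hle hc
        have h1 : i' ≤ i := hle.1
        have h2 : j' ≤ j := hle.2
        simp only [Finset.coe_filter, Finset.mem_product, Finset.mem_range,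
          Set.mem_ofPred_eq] at hc ⊢
        have := rowOf_antitone m h1
        omega }
  have h : ∀ i, μ.rowLen i = rowOf m i := by
    intro i
    have h1 : ∀ j, j < μ.rowLen i ↔ j < rowOf m i := by
      intro j
      rw [← YoungDiagram.mem_iff_lt_rowLen, ← YoungDiagram.mem_cells]
      simp only [μ, Finset.mem_filter, Finset.mem_product, Finset.mem_range]
      constructor
      · exact fun h => h.2
      · intro h
        refine ⟨⟨?_, h.trans_le (rowOf_antitone m (Nat.zero_le i))⟩, h⟩
        by_contra hi
        rw [rowOf_eq_zero fun j hj => hL j (by omega)] at h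
        omega
    exact le_antisymm (not_lt.mp fun h2 => lt_irrefl _ ((h1 _).mp h2))
      (not_lt.mp fun h2 => lt_irrefl _ ((h1 _).mpr h2))
  refine ⟨μ, ?_⟩
  ext i
  rw [colMult_apply, h, h, rowOf_eq m i]
  omega

/-- Young diagrams correspond to finitely supported column multiplicities. -/
def colMultEquiv : YoungDiagram ≃ (ℕ →₀ ℕ) :=
  Equiv.ofBijective colMult ⟨colMult_injective, colMult_surjective⟩

theorem colMultEquiv_apply (μ : YoungDiagram) : colMultEquiv μ = colMult μ := rfl

theorem card_transpose (μ : YoungDiagram) : μ.transpose.card = μ.card := by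
  simp [YoungDiagram.card, YoungDiagram.transpose]

theorem card_eq_colSize (μ : YoungDiagram) : μ.card = colSize (colMult μ) := by
  rw [← card_transpose, card_eq_sum_partMult, YoungDiagram.rowLen_transpose, colSize,
    Finsupp.weight_apply, Finsupp.sum_of_support_subset (s := Finset.range (μ.colLen 0))]
  · exact Finset.sum_congr rfl fun i _ => by rw [partMult_transpose, smul_eq_mul, mul_comm]
  · exact Finsupp.support_onFinset_subset
  · simp

/-! ### Triangularity -/

theorem transl_whittaker {q : ℂ} (hq : ‖q‖ < 1) (m : ℕ →₀ ℕ) :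
    transl (fun _ => 1) (whittaker q m) = ∑ k ∈ Finset.Iic m,
      Polynomial.C (branchCoeff q m k • whittaker q (m - k + shorten k)) *
        Polynomial.X ^ k.degree := by
  refine Polynomial.eq_of_infinite_eval_eq _ _ (Set.Infinite.mono (s := Set.range
    (MvPolynomial.C : ℂ → SymFun)) ?_ (Set.infinite_range_of_injective
      (MvPolynomial.C_injective _ _)))
  rintro _ ⟨x, rfl⟩
  change Polynomial.eval _ _ = Polynomial.eval _ _
  rw [← addVarAt_eq_eval, addVarAt_whittaker hq, Polynomial.eval_finsetSum]
  refine Finset.sum_congr rfl fun k _ => ?_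
  rw [Polynomial.eval_mul, Polynomial.eval_C, Polynomial.eval_pow, Polynomial.eval_X, ← map_pow,
    mul_comm _ (MvPolynomial.C _), ← MvPolynomial.smul_eq_C_mul, smul_smul, mul_comm]

theorem addVar_whittaker {q : ℂ} (hq : ‖q‖ < 1) (r : ℕ) (m : ℕ →₀ ℕ) :
    addVar r (whittaker q m) = ∑ k ∈ Finset.Iic m,
      if r = k.degree then branchCoeff q m k • whittaker q (m - k + shorten k) else 0 := by
  rw [addVar, translCoeff_apply, transl_whittaker hq, Polynomial.finsetSum_coeff]
  simp only [Polynomial.coeff_C_mul_X_pow]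

/-- The coefficient of `x_0 ^ (r 0) ⋯ x_{L-1} ^ (r (L-1))` in the operator that adds `L` variables
to the alphabet. -/
def addVars (r : ℕ → ℕ) : ℕ → SymFun →ₗ[ℂ] SymFun
  | 0 => LinearMap.id
  | L + 1 => addVars r L ∘ₗ addVar (r L)

theorem addVars_congr {r r' : ℕ → ℕ} {L : ℕ} (h : ∀ i < L, r i = r' i) :
    addVars r L = addVars r' L := by
  induction L with
  | zero => rfl
  | succ L ih => rw [addVars, addVars, ih fun i hi => h i (by omega), h L (by omega)]

theorem addVars_succ' (r : ℕ → ℕ) (L : ℕ) (f : SymFun) :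
    addVars r (L + 1) f = addVars (fun i => r (i + 1)) L (addVar (r 0) f) := by
  induction L generalizing f with
  | zero => rfl
  | succ L ih =>
    rw [addVars, LinearMap.comp_apply, ih, addVars, LinearMap.comp_apply, addVar, addVar,
      translCoeff_comm]

theorem constantCoeff_addVars_mul_psumSucc (r : ℕ → ℕ) (L n : ℕ) (f : SymFun) :
    MvPolynomial.constantCoeff (addVars r L (f * psumSucc n)) =
      ∑ i ∈ Finset.range L, if n + 1 ≤ r i then MvPolynomial.constantCoeff
        (addVars (Function.update r i (r i - (n + 1))) L f) else 0 := by
  induction L generalizing f with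
  | zero =>
    rw [Finset.sum_range_zero]
    change MvPolynomial.constantCoeff (f * psumSucc n) = 0
    rw [map_mul, psumSucc, MvPolynomial.constantCoeff_X, mul_zero]
  | succ L ih =>
    have h1 : addVar (r L) (f * psumSucc n) = addVar (r L) f * psumSucc n +
        if n + 1 ≤ r L then (1 : ℂ) • addVar (r L - (n + 1)) f else 0 :=
      translCoeff_mul_psumSucc _ (r L) n f
    rw [addVars, LinearMap.comp_apply, h1, map_add, map_add, ih, Finset.sum_range_succ]
    congr 1
    · refine Finset.sum_congr rfl fun i hi => ?_
      have : L ≠ i := (Finset.mem_range.mp hi).ne'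
      rw [addVars, LinearMap.comp_apply, Function.update_of_ne this]
    · split_ifs
      · rw [addVars, LinearMap.comp_apply, Function.update_self, one_smul,
          addVars_congr (r := Function.update r L (r L - (n + 1))) (r' := r)
            fun i hi => Function.update_of_ne hi.ne _ _]
      · rw [map_zero, map_zero]

theorem coeff_evalAlphabet_X (f : SymFun) (L : ℕ) (r : ℕ → ℕ) :
    MvPolynomial.coeff (Finsupp.equivFunOnFinite.symm fun i : Fin L => r i)
      (evalAlphabet (fun i : Fin L => (MvPolynomial.X i : MvPolynomial _ ℂ)) f) =
    MvPolynomial.constantCoeff (addVars r L f) := by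
  induction f using symFun_induction generalizing r with
  | h1 =>
    have h1 : MvPolynomial.constantCoeff (addVars r L 1) =
        if ∀ i < L, r i = 0 then 1 else 0 := by
      induction L with
      | zero => simp [addVars]
      | succ L ih =>
        rw [addVars, LinearMap.comp_apply, addVar, transl_one_coeff]
        by_cases h : r L = 0
        · rw [if_pos h, ih]
          refine if_congr ⟨fun h2 i hi => ?_, fun h2 i hi => h2 i (by omega)⟩ rfl rfl
          rcases Nat.lt_succ_iff_lt_or_eq.mp hi with h3 | rfl
          · exact h2 i h3
          · exact h
        · rw [if_neg h, map_zero, map_zero, if_neg]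
          exact fun h2 => h (h2 L (Nat.lt_succ_self L))
    rw [h1, map_one, MvPolynomial.coeff_one]
    refine if_congr ⟨fun h i hi => ?_, fun h => ?_⟩ rfl rfl
    · have := DFunLike.congr_fun h ⟨i, hi⟩
      simpa using this.symm
    · ext i
      simpa using (h i i.2).symm
  | hadd f g hf hg => rw [map_add, MvPolynomial.coeff_add, hf, hg, map_add, map_add]
  | hsmul a f hf =>
    rw [map_smul, MvPolynomial.coeff_smul, hf, map_smul, MvPolynomial.constantCoeff_smul]
  | hmul f n hf =>
    have h1 : evalAlphabet (fun i : Fin L => (MvPolynomial.X i : MvPolynomial (Fin L) ℂ))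
        (psumSucc n) = ∑ i, MvPolynomial.monomial (Finsupp.single i (n + 1)) 1 := by
      rw [evalAlphabet, psumSucc, MvPolynomial.aeval_X]
      exact Finset.sum_congr rfl fun i _ => by
        rw [MvPolynomial.X_pow_eq_monomial, Nat.succPNat_coe]
    rw [map_mul, h1, Finset.mul_sum, MvPolynomial.coeff_sum, constantCoeff_addVars_mul_psumSucc,
      Finset.sum_range]
    refine Finset.sum_congr rfl fun i _ => ?_
    rw [MvPolynomial.coeff_mul_monomial', mul_one, ← hf]
    refine if_congr ?_ ?_ rfl
    · rw [Finsupp.single_le_iff]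
      rfl
    · congr 1
      ext j
      rcases eq_or_ne j i with rfl | hj
      · simp
      · have : (j : ℕ) ≠ i := fun h => hj (Fin.ext h)
        simp [Function.update_of_ne this, Finsupp.single_eq_of_ne hj]

theorem monomialCoeff_eq (f : SymFun) (μ : YoungDiagram) :
    monomialCoeff f μ =
      MvPolynomial.constantCoeff (addVars (fun i => μ.rowLen i) (μ.colLen 0) f) :=
  coeff_evalAlphabet_X f (μ.colLen 0) fun i => μ.rowLen i

theorem of_constantCoeff_addVars_whittaker_ne_zero {q : ℂ} (hq : ‖q‖ < 1) (r : ℕ → ℕ) (L : ℕ)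
    (m : ℕ →₀ ℕ) (h : MvPolynomial.constantCoeff (addVars r L (whittaker q m)) ≠ 0) :
    (∀ j, L ≤ j → m j = 0) ∧ ∑ i ∈ Finset.range L, r i = colSize m ∧
      ∀ k ≤ L, ∑ i ∈ Finset.range k, r i ≤ ∑ i ∈ Finset.range k, rowOf m i := by
  induction L generalizing m with
  | zero =>
    rw [addVars, LinearMap.id_apply, constantCoeff_whittaker] at h
    have hm : m = 0 := by
      by_contra hm
      exact h (if_neg hm)
    subst hm
    refine ⟨fun j _ => rfl, by simp, fun k hk => ?_⟩
    rw [Nat.le_zero.mp hk]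
    simp
  | succ L ih =>
    rw [addVars, LinearMap.comp_apply, addVar_whittaker hq, map_sum, map_sum] at h
    obtain ⟨k, hk, hk'⟩ := Finset.exists_ne_zero_of_sum_ne_zero h
    have hkm : k ≤ m := Finset.mem_Iic.mp hk
    have hr : r L = k.degree := by
      by_contra h1
      rw [if_neg h1, map_zero, map_zero] at hk'
      exact hk' rfl
    rw [if_pos hr, map_smul, MvPolynomial.constantCoeff_smul] at hk'
    obtain ⟨h1, h2, h3⟩ := ih _ (right_ne_zero_of_mul hk')
    have h4 : ∀ j, L ≤ j → m j - k j + k (j + 1) = 0 := h1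
    have h5 : ∀ j, L + 1 ≤ j → m j = 0 := by
      intro j hj
      obtain ⟨j, rfl⟩ := Nat.exists_eq_succ_of_ne_zero (n := j) (by omega)
      have h6 := h4 j (by omega)
      have h7 := h4 (j + 1) (by omega)
      change m (j + 1) = 0
      have h8 : k (j + 1) ≤ m (j + 1) := hkm (j + 1)
      omega
    have h6 : ∑ i ∈ Finset.range (L + 1), r i = colSize m := by
      rw [Finset.sum_range_succ, h2, hr, colSize_branch hkm]
    refine ⟨h5, h6, fun K hK => ?_⟩
    rcases Nat.le_succ_iff.mp hK with hK | rfl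
    · refine (h3 K hK).trans (Finset.sum_le_sum fun i _ => ?_)
      rw [← rowOf_branch hkm i]
      exact Nat.le_add_right _ _
    · rw [h6, sum_rowOf h5]

theorem constantCoeff_addVars_rowOf (q : ℂ) (L : ℕ) (m : ℕ →₀ ℕ) (h : ∀ j, L ≤ j → m j = 0) :
    MvPolynomial.constantCoeff (addVars (rowOf m) L (whittaker q m)) = 1 := by
  induction L generalizing m with
  | zero =>
    have hm : m = 0 := by
      ext j
      exact h j (Nat.zero_le j)
    rw [addVars, LinearMap.id_apply, constantCoeff_whittaker, if_pos hm]
  | succ L ih =>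
    rw [addVars_succ', rowOf_zero, addVar_degree_whittaker]
    exact ih (shorten m) fun j hj => h (j + 1) (by omega)

theorem monomialCoeff_whittaker_self (q : ℂ) (μ : YoungDiagram) :
    monomialCoeff (whittaker q (colMult μ)) μ = 1 := by
  have h : (fun i => μ.rowLen i) = rowOf (colMult μ) :=
    funext fun i => (rowOf_colMult μ i).symm
  rw [monomialCoeff_eq, h]
  exact constantCoeff_addVars_rowOf q (μ.colLen 0) (colMult μ) fun j hj => colMult_eq_zero hj

theorem sum_rowLen_eq_card {μ : YoungDiagram} {k : ℕ} (hk : μ.colLen 0 ≤ k) :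
    ∑ i ∈ Finset.range k, μ.rowLen i = μ.card := by
  rw [card_eq_colSize, ← sum_rowOf fun j hj => colMult_eq_zero (μ := μ) (hk.trans hj)]
  exact Finset.sum_congr rfl fun i _ => (rowOf_colMult μ i).symm

theorem dominatedBy_of_monomialCoeff_whittaker_ne_zero {q : ℂ} (hq : ‖q‖ < 1)
    {lam μ : YoungDiagram} (h : monomialCoeff (whittaker q (colMult lam)) μ ≠ 0) :
    DominatedBy μ lam := by
  rw [monomialCoeff_eq] at h
  obtain ⟨h1, h2, h3⟩ := of_constantCoeff_addVars_whittaker_ne_zero hq _ _ _ h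
  have h4 : μ.card = lam.card := by
    rw [← sum_rowLen_eq_card le_rfl, h2, card_eq_colSize]
  refine ⟨h4, fun k => ?_⟩
  simp only [rowOf_colMult] at h3
  rcases le_or_gt k (μ.colLen 0) with hk | hk
  · exact h3 k hk
  · rw [sum_rowLen_eq_card hk.le, ← sum_rowLen_eq_card le_rfl]
    exact (h3 _ le_rfl).trans (Finset.sum_le_sum_of_subset
      (Finset.range_subset_range.mpr hk.le))

/-! ### Identification of the Macdonald functions -/

theorem isMacdonaldFamily_whittaker {q : ℂ} (hq : ‖q‖ < 1) :
    IsMacdonaldFamily q 0 fun lam => whittaker q (colMult lam) where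
  coeff_self := monomialCoeff_whittaker_self q
  triangular _ _ := dominatedBy_of_monomialCoeff_whittaker_ne_zero hq
  orthogonal _ _ h := macInner_whittaker_of_ne hq (colMult_injective.ne h)

theorem DominatedBy.trans {μ ν lam : YoungDiagram} (h1 : DominatedBy μ ν)
    (h2 : DominatedBy ν lam) : DominatedBy μ lam :=
  ⟨h1.1.trans h2.1, fun k => (h1.2 k).trans (h2.2 k)⟩

/-- A rank function for the dominance order. -/
def dominanceRank (μ : YoungDiagram) : ℕ :=
  ∑ k ∈ Finset.range (μ.card + 1), ∑ i ∈ Finset.range k, μ.rowLen i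

theorem colLen_zero_le_card (μ : YoungDiagram) : μ.colLen 0 ≤ μ.card := by
  rw [YoungDiagram.colLen_eq_card]
  exact Finset.card_le_card (Finset.filter_subset _ _)

theorem DominatedBy.rank_lt {μ ν : YoungDiagram} (h : DominatedBy μ ν) (hne : μ ≠ ν) :
    dominanceRank μ < dominanceRank ν := by
  have h1 : ∃ k, ∑ i ∈ Finset.range k, μ.rowLen i ≠ ∑ i ∈ Finset.range k, ν.rowLen i := by
    by_contra! h1
    refine hne (eq_of_rowLen_eq fun i => ?_)
    have h2 := h1 (i + 1)
    rw [Finset.sum_range_succ, Finset.sum_range_succ, h1 i] at h2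
    exact Nat.add_left_cancel h2
  obtain ⟨k, hk⟩ := h1
  have h2 : k < μ.card + 1 := by
    by_contra h2
    have h3 := colLen_zero_le_card μ
    have h4 := colLen_zero_le_card ν
    have h5 := h.1
    exact hk (by rw [sum_rowLen_eq_card (by omega), sum_rowLen_eq_card (by omega), h.1])
  rw [dominanceRank, dominanceRank, ← h.1]
  exact Finset.sum_lt_sum (fun k _ => h.2 k)
    ⟨k, Finset.mem_range.mpr h2, lt_of_le_of_ne (h.2 k) hk⟩

/-- `monomialCoeff` as a linear functional. -/
def monomialCoeffL (μ : YoungDiagram) : SymFun →ₗ[ℂ] ℂ :=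
  MvPolynomial.lcoeff ℂ (Finsupp.equivFunOnFinite.symm fun i : Fin (μ.colLen 0) => μ.rowLen i) ∘ₗ
    (evalAlphabet (fun i : Fin (μ.colLen 0) =>
      (MvPolynomial.X i : MvPolynomial _ ℂ))).toLinearMap

theorem monomialCoeffL_apply (μ : YoungDiagram) (f : SymFun) :
    monomialCoeffL μ f = monomialCoeff f μ := rfl

/-- If no diagram above `μ` other than `μ` occurs in the expansion of `f` in `q`-Whittaker
functions, the coefficients of `f` at `μ` in the two bases agree. -/
theorem monomialCoeff_eq_repr {q : ℂ} (hq : ‖q‖ < 1) {f : SymFun} {μ : YoungDiagram}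
    (h : ∀ ν, (whittakerBasis hq).repr f (colMult ν) ≠ 0 → DominatedBy μ ν → ν = μ) :
    monomialCoeff f μ = (whittakerBasis hq).repr f (colMult μ) := by
  rw [← monomialCoeffL_apply]
  conv_lhs => rw [eq_sum_whittaker hq f]
  rw [Finsupp.sum, map_sum, Finset.sum_eq_single (colMult μ)]
  · rw [map_smul, monomialCoeffL_apply, monomialCoeff_whittaker_self, smul_eq_mul, mul_one]
  · intro m hm hmμ
    obtain ⟨ν, rfl⟩ := colMult_surjective m
    rw [map_smul, monomialCoeffL_apply, smul_eq_mul, mul_eq_zero]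
    right
    by_contra h1
    exact hmμ (congrArg colMult (h ν (Finsupp.mem_support_iff.mp hm)
      (dominatedBy_of_monomialCoeff_whittaker_ne_zero hq h1)))
  · intro hm
    rw [Finsupp.notMem_support_iff.mp hm, zero_smul, map_zero]

theorem DominatedBy.antisymm {μ ν : YoungDiagram} (h1 : DominatedBy μ ν)
    (h2 : DominatedBy ν μ) : μ = ν := by
  by_contra h
  exact lt_asymm (h1.rank_lt h) (h2.rank_lt (Ne.symm h))

theorem dominatedBy_of_repr_ne_zero {q : ℂ} (hq : ‖q‖ < 1) {f : SymFun} {lam : YoungDiagram}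
    (hf : ∀ μ, monomialCoeff f μ ≠ 0 → DominatedBy μ lam) {μ : YoungDiagram}
    (hμ : (whittakerBasis hq).repr f (colMult μ) ≠ 0) : DominatedBy μ lam := by
  -- Induction on the number of diagrams that occur in `f` and have larger rank than `μ`.
  induction hd : (((whittakerBasis hq).repr f).support.filter fun m =>
    dominanceRank μ < dominanceRank (colMultEquiv.symm m)).card using Nat.strong_induction_on
    generalizing μ with
  | _ d ih =>
    by_cases h : ∃ ν, (whittakerBasis hq).repr f (colMult ν) ≠ 0 ∧ DominatedBy μ ν ∧ ν ≠ μ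
    · obtain ⟨ν, h1, h2, h3⟩ := h
      have h4 := h2.rank_lt h3.symm
      refine h2.trans (ih _ ?_ h1 rfl)
      rw [← hd]
      refine Finset.card_lt_card (Finset.ssubset_iff_of_subset ?_ |>.mpr ⟨colMult ν, ?_, ?_⟩)
      · exact Finset.monotone_filter_right _ fun m _ hm => h4.trans hm
      · rw [Finset.mem_filter, ← colMultEquiv_apply, Equiv.symm_apply_apply]
        exact ⟨Finsupp.mem_support_iff.mpr h1, h4⟩
      · rw [Finset.mem_filter, ← colMultEquiv_apply, Equiv.symm_apply_apply]
        exact fun h5 => lt_irrefl _ h5.2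
    · push Not at h
      exact hf μ (by rwa [monomialCoeff_eq_repr hq h])

theorem IsMacdonaldFamily.eq_whittaker {q : ℂ} (hq : ‖q‖ < 1) {P : YoungDiagram → SymFun}
    (hP : IsMacdonaldFamily q 0 P) (lam : YoungDiagram) : P lam = whittaker q (colMult lam) := by
  induction hd : dominanceRank lam using Nat.strong_induction_on generalizing lam with
  | _ d ih =>
    have h1 : ∀ μ, (whittakerBasis hq).repr (P lam) (colMult μ) ≠ 0 → DominatedBy μ lam :=
      fun μ => dominatedBy_of_repr_ne_zero hq (hP.triangular lam)
    have h2 : (whittakerBasis hq).repr (P lam) (colMult lam) = 1 := by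
      rw [← hP.coeff_self lam]
      exact (monomialCoeff_eq_repr hq fun ν h3 h4 => (h1 ν h3).antisymm h4).symm
    have h3 : ∀ μ, μ ≠ lam → (whittakerBasis hq).repr (P lam) (colMult μ) = 0 := by
      intro μ hμ
      by_contra h4
      have h5 := ih _ (hd ▸ (h1 μ h4).rank_lt hμ) μ rfl
      have h6 := macInner_whittaker_eq_repr hq (P lam) (colMult μ)
      rw [← h5, hP.orthogonal lam μ (Ne.symm hμ), h5] at h6
      exact mul_ne_zero h4 (macInner_whittaker_self_ne_zero hq _) h6.symm
    have h4 : (whittakerBasis hq).repr (P lam) = Finsupp.single (colMult lam) 1 := by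
      ext m
      obtain ⟨μ, rfl⟩ := colMult_surjective m
      rcases eq_or_ne μ lam with rfl | h
      · rw [h2, Finsupp.single_eq_same]
      · rw [h3 μ h, Finsupp.single_eq_of_ne (colMult_injective.ne h)]
    rw [eq_sum_whittaker hq (P lam), h4, Finsupp.sum_single_index (by rw [zero_smul]), one_smul]

theorem macdonaldP_eq_whittaker {q : ℂ} (hq : ‖q‖ < 1) (lam : YoungDiagram) :
    macdonaldP q 0 lam = whittaker q (colMult lam) :=
  (Classical.epsilon_spec (p := IsMacdonaldFamily q 0)
    ⟨_, isMacdonaldFamily_whittaker hq⟩).eq_whittaker hq lam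

/-! ### Skew functions -/

/-- The operator `f[X] ↦ f[X + x]` that adds the alphabet `x`. -/
def addAlphabet {N : ℕ} (x : Fin N → ℂ) : SymFun →ₐ[ℂ] SymFun :=
  MvPolynomial.aeval fun k : ℕ+ => MvPolynomial.X k + MvPolynomial.C (∑ i, x i ^ (k : ℕ))

theorem addAlphabet_succ {N : ℕ} (x : Fin (N + 1) → ℂ) (f : SymFun) :
    addAlphabet x f = addVarAt (x 0) (addAlphabet (fun i => x i.succ) f) := by
  have h : addAlphabet x = (addVarAt (x 0)).comp (addAlphabet fun i => x i.succ) :=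
    MvPolynomial.algHom_ext fun k => by
      simp [addVarAt, addAlphabet, MvPolynomial.algHom_C, Fin.sum_univ_succ, add_assoc]
  rw [h, AlgHom.comp_apply]

theorem addAlphabet_zero (x : Fin 0 → ℂ) (f : SymFun) : addAlphabet x f = f := by
  have h : addAlphabet x = AlgHom.id ℂ SymFun :=
    MvPolynomial.algHom_ext fun k => by simp [addAlphabet]
  rw [h, AlgHom.id_apply]

theorem constantCoeff_addAlphabet {N : ℕ} (x : Fin N → ℂ) (f : SymFun) :
    MvPolynomial.constantCoeff (addAlphabet x f) = evalAlphabet x f := by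
  induction f using MvPolynomial.induction_on with
  | C a =>
    rw [← MvPolynomial.algebraMap_eq, AlgHom.commutes, AlgHom.commutes,
      MvPolynomial.algebraMap_eq, MvPolynomial.constantCoeff_C]
    rfl
  | add f g hf hg => simp only [map_add, hf, hg]
  | mul_X f k hf =>
    rw [map_mul, map_mul, map_mul, hf]
    simp [addAlphabet, evalAlphabet]

/-- The functional `c ↦ ⟨a, b c⟩` is represented by a symmetric function. -/
theorem exists_macInner_eq {q : ℂ} (hq : ‖q‖ < 1) (a b : SymFun) :
    ∃ f, ∀ c, macInner q 0 f c = macInner q 0 a (b * c) := by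
  let V : Submodule ℂ SymFun :=
    { carrier := {b | ∀ a, ∃ f, ∀ c, macInner q 0 f c = macInner q 0 a (b * c)}
      zero_mem' := fun a => ⟨0, fun c => by
        rw [zero_mul, macInner_zero_left, macInner_zero_right]⟩
      add_mem' := fun {b b'} hb hb' a => by
        obtain ⟨f, hf⟩ := hb a
        obtain ⟨f', hf'⟩ := hb' a
        exact ⟨f + f', fun c => by rw [macInner_add_left, hf, hf', add_mul, macInner_add_right]⟩
      smul_mem' := fun s b hb a => by
        obtain ⟨f, hf⟩ := hb a
        exact ⟨s • f, fun c => by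
          rw [macInner_smul_left, hf, smul_mul_assoc, macInner_smul_right]⟩ }
  refine mem_of_completeSym_mul_mem hq (V := V) ?_ ?_ b a
  · exact fun a => ⟨a, fun c => by rw [one_mul]⟩
  · intro r b hb a
    obtain ⟨f, hf⟩ := hb (addVar r a)
    exact ⟨f, fun c => by rw [hf, mul_assoc, macInner_completeSym_mul hq]⟩

theorem macInner_addVarAt {q : ℂ} (hq : ‖q‖ < 1) {f a b : SymFun}
    (h : ∀ c, macInner q 0 f c = macInner q 0 a (b * c)) (x : ℂ) (c : SymFun) :
    macInner q 0 (addVarAt x f) c = macInner q 0 (addVarAt x a) (b * c) := by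
  obtain ⟨N₁, h1⟩ := exists_translCoeff_eq_zero (fun _ => 1) f
  obtain ⟨N₂, h2⟩ := exists_translCoeff_eq_zero (fun _ => 1) a
  rw [addVarAt_eq_sum x f (N := N₁ + N₂) fun i hi => h1 i (by omega),
    addVarAt_eq_sum x a (N := N₁ + N₂) fun i hi => h2 i (by omega), macInner_comm,
    macInner_comm q 0 _ (b * c), ← macInnerRight_apply, ← macInnerRight_apply, map_sum, map_sum]
  refine Finset.sum_congr rfl fun i _ => ?_
  rw [map_smul, map_smul, macInnerRight_apply, macInnerRight_apply, macInner_comm,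
    macInner_comm q 0 (b * c), ← macInner_completeSym_mul hq, ← macInner_completeSym_mul hq, h,
    mul_left_comm]

theorem macInner_addAlphabet {q : ℂ} (hq : ‖q‖ < 1) {N : ℕ} (x : Fin N → ℂ) {f a b : SymFun}
    (h : ∀ c, macInner q 0 f c = macInner q 0 a (b * c)) (c : SymFun) :
    macInner q 0 (addAlphabet x f) c = macInner q 0 (addAlphabet x a) (b * c) := by
  induction N generalizing c with
  | zero => rw [addAlphabet_zero, addAlphabet_zero, h]
  | succ N ih =>
    rw [addAlphabet_succ, addAlphabet_succ]
    exact macInner_addVarAt hq (fun c => ih (fun i => x i.succ) c) (x 0) c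

theorem macInner_skewMacdonaldP {q : ℂ} (hq : ‖q‖ < 1) (lam μ : YoungDiagram) (c : SymFun) :
    macInner q 0 (skewMacdonaldP q 0 lam μ) c =
      macInner q 0 (whittaker q (colMult lam)) (macdonaldQ q 0 μ * c) := by
  obtain ⟨f, hf⟩ := exists_macInner_eq hq (macdonaldP q 0 lam) (macdonaldQ q 0 μ)
  have h1 : ∀ ν, macInner q 0 (skewMacdonaldP q 0 lam μ) (macdonaldQ q 0 ν) =
      macInner q 0 (macdonaldP q 0 lam) (macdonaldQ q 0 μ * macdonaldQ q 0 ν) :=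
    Classical.epsilon_spec (p := fun f : SymFun => ∀ ν : YoungDiagram,
      macInner q 0 f (macdonaldQ q 0 ν) =
        macInner q 0 (macdonaldP q 0 lam) (macdonaldQ q 0 μ * macdonaldQ q 0 ν))
      ⟨f, fun ν => hf _⟩
  rw [← macdonaldP_eq_whittaker hq]
  -- The functions `Q_ν` span, so the defining property extends to all arguments.
  let V : Submodule ℂ SymFun := LinearMap.ker (macInnerRight q 0 (skewMacdonaldP q 0 lam μ) -
    macInnerRight q 0 (macdonaldP q 0 lam) ∘ₗ LinearMap.mulLeft ℂ (macdonaldQ q 0 μ))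
  have hV : ∀ c, c ∈ V ↔ macInner q 0 (skewMacdonaldP q 0 lam μ) c =
      macInner q 0 (macdonaldP q 0 lam) (macdonaldQ q 0 μ * c) := by
    intro c
    rw [LinearMap.mem_ker, LinearMap.sub_apply, sub_eq_zero]
    rfl
  refine (hV c).mp ?_
  have h2 : Submodule.span ℂ (Set.range (whittaker q)) ≤ V := by
    refine Submodule.span_le.mpr ?_
    rintro _ ⟨m, rfl⟩
    obtain ⟨ν, rfl⟩ := colMult_surjective m
    have h3 := (hV _).mpr (h1 ν)
    rw [macdonaldQ, macdonaldP_eq_whittaker hq] at h3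
    exact (Submodule.smul_mem_iff V
      (inv_ne_zero (macInner_whittaker_self_ne_zero hq (colMult ν)))).mp h3
  rw [span_whittaker hq] at h2
  exact h2 Submodule.mem_top

/-- The skew `q`-Whittaker polynomials are the coefficients of `P_lam[X + x]` in the basis of
`q`-Whittaker functions. -/
theorem skewWhittaker_eq_repr {q : ℂ} (hq : ‖q‖ < 1) {N : ℕ} (x : Fin N → ℂ)
    (lam μ : YoungDiagram) :
    skewWhittaker q lam μ x =
      (whittakerBasis hq).repr (addAlphabet x (whittaker q (colMult lam))) (colMult μ) := by
  have h1 := macInner_addAlphabet hq x (macInner_skewMacdonaldP hq lam μ) 1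
  rw [macInner_one_right, constantCoeff_addAlphabet, mul_one, macdonaldQ,
    macdonaldP_eq_whittaker hq, macInner_smul_right,
    macInner_whittaker_eq_repr hq (addAlphabet x (whittaker q (colMult lam)))] at h1
  rw [skewWhittaker, h1, mul_left_comm,
    inv_mul_cancel₀ (macInner_whittaker_self_ne_zero hq (colMult μ)), mul_one]

/-! ### Sums that factor over the columns -/

theorem sum_Iic_prod {A : Type*} [CommSemiring A] (F : ℕ → ℕ → ℕ → A) (m : ℕ →₀ ℕ) :
    ∑ k ∈ Finset.Iic m, (m.prod fun i e => F i e (k i)) =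
      m.prod fun i e => ∑ j ∈ Finset.range (e + 1), F i e j := by
  induction m using Finsupp.induction_on_max with
  | zero =>
    have : Finset.Iic (0 : ℕ →₀ ℕ) = {0} := by
      ext k
      simp
    rw [this, Finset.sum_singleton, Finsupp.prod_zero_index, Finsupp.prod_zero_index]
  | single_add M a w hw ha ih =>
    have hwM : w M = 0 := by
      by_contra h
      exact lt_irrefl _ (hw M (Finsupp.mem_support_iff.mpr h))
    have hdisj : Disjoint w.support (Finsupp.single M a).support := by
      rw [Finsupp.support_single M ha, Finset.disjoint_singleton_right]
      exact Finsupp.notMem_support_iff.mpr hwM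
    have hsingle : ∀ G : ℕ → ℕ → A, (Finsupp.single M a).prod G = G M a := by
      intro G
      rw [Finsupp.prod, Finsupp.support_single M ha, Finset.prod_singleton,
        Finsupp.single_eq_same]
    rw [add_comm, sum_Iic_add_single hwM, Finsupp.prod_add_index_of_disjoint hdisj, ← ih, hsingle,
      Finset.mul_sum]
    refine Finset.sum_congr rfl fun j _ => ?_
    rw [Finset.sum_mul]
    refine Finset.sum_congr rfl fun k hk => ?_
    have hkM : k M = 0 := Nat.le_zero.mp (hwM ▸ Finset.mem_Iic.mp hk M)
    rw [Finsupp.prod_add_index_of_disjoint hdisj, hsingle, Finsupp.add_apply, hkM, zero_add,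
      Finsupp.single_eq_same]
    congr 1
    refine Finsupp.prod_congr fun i hi => ?_
    have : i ≠ M := (hw i hi).ne
    rw [Finsupp.add_apply, Finsupp.single_eq_of_ne this, add_zero]

/-- The product `∏_i (ζ i) ^ (m i)`. -/
def colPow (ζ : ℕ → ℂ) (m : ℕ →₀ ℕ) : ℂ := m.prod fun i e => ζ i ^ e

theorem colPow_eq_prod (ζ : ℕ → ℂ) {m : ℕ →₀ ℕ} {s : Finset ℕ} (hs : m.support ⊆ s) :
    colPow ζ m = ∏ i ∈ s, ζ i ^ m i :=
  Finsupp.prod_of_support_subset _ hs _ fun _ _ => pow_zero _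

theorem colPow_zero (ζ : ℕ → ℂ) : colPow ζ 0 = 1 := Finsupp.prod_zero_index

theorem colPow_single (ζ : ℕ → ℂ) (i a : ℕ) : colPow ζ (Finsupp.single i a) = ζ i ^ a :=
  Finsupp.prod_single_index (pow_zero _)

theorem colPow_add (ζ : ℕ → ℂ) (m k : ℕ →₀ ℕ) : colPow ζ (m + k) = colPow ζ m * colPow ζ k :=
  Finsupp.prod_add_index' (fun _ => pow_zero _) fun _ => pow_add _

theorem colPow_const (x : ℂ) (m : ℕ →₀ ℕ) : colPow (fun _ => x) m = x ^ m.degree := by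
  rw [colPow, Finsupp.prod, Finset.prod_pow_eq_pow_sum, Finsupp.degree_apply]

/-- The column weights `ζ`, shifted by one index: if a column of length `i + 1` has weight `ζ i`, the
value at `i` is the weight of a column of length `i`, which is `1` for the empty column. -/
def weightPred (ζ : ℕ → ℂ) : ℕ → ℂ
  | 0 => 1
  | i + 1 => ζ i

theorem colPow_shorten (ζ : ℕ → ℂ) (m : ℕ →₀ ℕ) :
    colPow ζ (shorten m) = colPow (weightPred ζ) m := by
  induction m using Finsupp.induction_linear with
  | zero => rw [map_zero, colPow_zero, colPow_zero]
  | add f g hf hg => rw [map_add, colPow_add, colPow_add, hf, hg]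
  | single i a =>
    cases i with
    | zero => rw [shorten_single_zero, colPow_zero, colPow_single, weightPred, one_pow]
    | succ i => rw [shorten_single_succ, colPow_single, colPow_single, weightPred]

/-! ### Rogers--Szegő polynomials -/

theorem rogersSzegoHom_zero_right {q : ℂ} (hq : ‖q‖ < 1) (m : ℕ) (a : ℂ) :
    rogersSzegoHom q m a 0 = a ^ m := by
  rw [rogersSzegoHom, Finset.sum_eq_single 0]
  · rw [qBinom_zero_right hq, pow_zero, mul_one, one_mul, Nat.sub_zero]
  · intro k _ hk
    rw [zero_pow hk, mul_zero, mul_zero]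
  · simp

theorem rogersSzegoHom_zero_left {q : ℂ} (hq : ‖q‖ < 1) (m : ℕ) (b : ℂ) :
    rogersSzegoHom q m 0 b = b ^ m := by
  rw [rogersSzegoHom, Finset.sum_eq_single m]
  · rw [qBinom_self hq, Nat.sub_self, pow_zero, one_mul, one_mul]
  · intro k hk hkm
    have : m - k ≠ 0 := by
      have := Finset.mem_range.mp hk
      omega
    rw [zero_pow this, zero_mul, mul_zero]
  · simp

theorem rogersSzego_eq_hom (q : ℂ) (m : ℕ) (z : ℂ) :
    rogersSzego q m z = rogersSzegoHom q m 1 z := by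
  simp only [rogersSzego, rogersSzegoHom, one_pow, one_mul]

theorem rogersSzegoHom_mul (q : ℂ) (m : ℕ) (s a b : ℂ) :
    rogersSzegoHom q m (s * a) (s * b) = s ^ m * rogersSzegoHom q m a b := by
  rw [rogersSzegoHom, rogersSzegoHom, Finset.mul_sum]
  refine Finset.sum_congr rfl fun k hk => ?_
  have h : s ^ m = s ^ (m - k) * s ^ k := by
    rw [← pow_add, Nat.sub_add_cancel (Nat.lt_succ_iff.mp (Finset.mem_range.mp hk))]
  rw [h, mul_pow, mul_pow]
  ring

theorem rogersSzegoHom_div_qPoch {q : ℂ} (hq : ‖q‖ < 1) (m : ℕ) (a b : ℂ) :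
    rogersSzegoHom q m a b / qPoch q m =
      ∑ k ∈ Finset.range (m + 1), a ^ (m - k) / qPoch q (m - k) * (b ^ k / qPoch q k) := by
  rw [rogersSzegoHom, Finset.sum_div]
  refine Finset.sum_congr rfl fun k _ => ?_
  have h1 := qPoch_ne_zero hq m
  have h2 := qPoch_ne_zero hq k
  have h3 := qPoch_ne_zero hq (m - k)
  rw [qBinom]
  field_simp

/-! ### The right boundary -/

/-- The weight `t^{|μ|/2} h_{μ'}(c/√t, d/√t; q)` in terms of the column multiplicities of `μ`. -/
def rightWeight (q t c d : ℂ) (m : ℕ →₀ ℕ) : ℂ :=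
  m.prod fun i e => t ^ (i / 2 * e) *
    if Even i then rogersSzegoHom q e c d else rogersSzegoHom q e t (c * d)

theorem qBinom_zero (q : ℂ) : qBinom q 0 0 = 1 := by simp [qBinom, qPoch_zero]

theorem rogersSzegoHom_zero (q a b : ℂ) : rogersSzegoHom q 0 a b = 1 := by
  simp [rogersSzegoHom, qBinom_zero]

theorem hPartScaled_transpose (q t : ℂ) (μ : YoungDiagram) (c d : ℂ) :
    hPartScaled q t μ.transpose c d = rightWeight q t c d (colMult μ) := by
  rw [rightWeight, Finsupp.prod_of_support_subset (s := Finset.range (μ.colLen 0))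
    (colMult μ) Finsupp.support_onFinset_subset _
    (fun i _ => by rw [rogersSzegoHom_zero, rogersSzegoHom_zero, ite_self, mul_zero, pow_zero,
      mul_one]), hPartScaled, YoungDiagram.rowLen_transpose]
  simp only [partMult_transpose]

/-- The weight of a column of length `i + 1` at a right boundary with parameters `c, 0`. -/
def rightColWeight (t c : ℂ) (i : ℕ) : ℂ := t ^ (i / 2) * if Even i then c else t

theorem rightWeight_zero_right {q : ℂ} (hq : ‖q‖ < 1) (t c : ℂ) (m : ℕ →₀ ℕ) :
    rightWeight q t c 0 m = colPow (rightColWeight t c) m := by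
  refine Finsupp.prod_congr fun i _ => ?_
  rw [rightColWeight, mul_zero, rogersSzegoHom_zero_right hq, rogersSzegoHom_zero_right hq,
    mul_pow, ← pow_mul]
  split_ifs <;> rfl

theorem rightWeight_zero_left {q : ℂ} (hq : ‖q‖ < 1) (t c : ℂ) (m : ℕ →₀ ℕ) :
    rightWeight q t 0 c m = rightWeight q t c 0 m := by
  refine Finsupp.prod_congr fun i _ => ?_
  rw [zero_mul, mul_zero, rogersSzegoHom_zero_right hq, rogersSzegoHom_zero_right hq,
    rogersSzegoHom_zero_left hq]

/-- The linear functional on symmetric functions with values `rightWeight` on the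
`q`-Whittaker functions. -/
def rightFunctional {q : ℂ} (hq : ‖q‖ < 1) (t c d : ℂ) : SymFun →ₗ[ℂ] ℂ :=
  (whittakerBasis hq).constr ℂ (rightWeight q t c d)

theorem rightFunctional_whittaker {q : ℂ} (hq : ‖q‖ < 1) (t c d : ℂ) (m : ℕ →₀ ℕ) :
    rightFunctional hq t c d (whittaker q m) = rightWeight q t c d m := by
  rw [← whittakerBasis_apply hq, rightFunctional, Module.Basis.constr_basis]

theorem rightFunctional_apply {q : ℂ} (hq : ‖q‖ < 1) (t c d : ℂ) (f : SymFun) :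
    rightFunctional hq t c d f =
      ((whittakerBasis hq).repr f).sum fun m a => a * rightWeight q t c d m :=
  Module.Basis.constr_apply _ _ _ _

/-- A right boundary whose weight is multiplicative over the columns absorbs a variable. -/
theorem sum_branchCoeff_mul_colPow {q : ℂ} (ζ : ℕ → ℂ) (x : ℂ) (m : ℕ →₀ ℕ) :
    ∑ k ∈ Finset.Iic m, branchCoeff q m k * x ^ k.degree * colPow ζ (m - k + shorten k) =
      m.prod fun i e => rogersSzegoHom q e (ζ i) (x * weightPred ζ i) := by
  simp only [rogersSzegoHom]
  rw [← sum_Iic_prod fun i e j => qBinom q e j * (ζ i ^ (e - j) * (x * weightPred ζ i) ^ j)]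
  refine Finset.sum_congr rfl fun k hk => ?_
  have hkm : k ≤ m := Finset.mem_Iic.mp hk
  have h1 : k.support ⊆ m.support := Finsupp.support_mono hkm
  have h2 : (m - k).support ⊆ m.support := Finsupp.support_mono tsub_le_self
  rw [colPow_add, colPow_shorten, ← colPow_const, colPow_eq_prod _ h1, colPow_eq_prod _ h1,
    colPow_eq_prod _ h2, branchCoeff, Finsupp.prod]
  simp only [mul_pow, Finset.prod_mul_distrib, Finsupp.tsub_apply]
  ring

theorem rightFunctional_addVarAt {q : ℂ} (hq : ‖q‖ < 1) (t c d : ℂ) (f : SymFun) :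
    rightFunctional hq t c 0 (addVarAt d f) = rightFunctional hq t c d f := by
  have h : rightFunctional hq t c 0 ∘ₗ (addVarAt d).toLinearMap = rightFunctional hq t c d := by
    refine (whittakerBasis hq).ext fun m => ?_
    rw [whittakerBasis_apply, rightFunctional_whittaker, LinearMap.comp_apply,
      AlgHom.toLinearMap_apply, addVarAt_whittaker hq, map_sum]
    simp only [map_smul, rightFunctional_whittaker, rightWeight_zero_right hq, smul_eq_mul]
    rw [sum_branchCoeff_mul_colPow]
    refine Finsupp.prod_congr fun i _ => ?_
    rw [pow_mul]
    rcases Nat.even_or_odd' i with ⟨j, rfl | rfl⟩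
    · have h1 : Even (2 * j) := even_two_mul j
      have h2 : weightPred (rightColWeight t c) (2 * j) = t ^ (2 * j / 2) := by
        cases j with
        | zero => simp [weightPred]
        | succ j =>
          have h3 : (2 * j + 1) / 2 = j := by omega
          have h4 : 2 * (j + 1) / 2 = j + 1 := by omega
          change rightColWeight t c (2 * j + 1) = _
          rw [rightColWeight, if_neg (Nat.not_even_two_mul_add_one j), h3, h4, pow_succ]
      rw [h2, rightColWeight, if_pos h1, if_pos h1, mul_comm d, rogersSzegoHom_mul]
    · have h1 : ¬ Even (2 * j + 1) := Nat.not_even_two_mul_add_one j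
      have h2 : weightPred (rightColWeight t c) (2 * j + 1) = t ^ ((2 * j + 1) / 2) * c := by
        have h3 : (2 * j + 1) / 2 = 2 * j / 2 := by omega
        change rightColWeight t c (2 * j) = _
        rw [rightColWeight, if_pos (even_two_mul j), h3]
      rw [h2, rightColWeight, if_neg h1, if_neg h1, mul_left_comm d, mul_comm d,
        rogersSzegoHom_mul]
  exact LinearMap.congr_fun h f

theorem rightFunctional_zero_left {q : ℂ} (hq : ‖q‖ < 1) (t c : ℂ) :
    rightFunctional hq t 0 c = rightFunctional hq t c 0 := by
  have h : rightWeight q t 0 c = rightWeight q t c 0 := funext (rightWeight_zero_left hq t c)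
  rw [rightFunctional, rightFunctional, h]

/-! ### The left boundary -/

/-- The factor of a summand of `Z_n` that depends only on the outer partition, in terms of its
column multiplicities. It vanishes for partitions with more than `n` columns. -/
def leftWeight (q : ℂ) (n : ℕ) (a b : ℂ) (m : ℕ →₀ ℕ) : ℂ :=
  if m.degree ≤ n then
    rogersSzego q (n - m.degree) (a * b) / qPoch q (n - m.degree) *
      m.prod fun i e =>
        (if Even i then rogersSzegoHom q e a b else rogersSzego q e (a * b)) / qPoch q e
  else 0

theorem leftWeight_of_lt {q : ℂ} {n : ℕ} {a b : ℂ} {m : ℕ →₀ ℕ} (h : n < m.degree) :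
    leftWeight q n a b m = 0 := if_neg (not_le.mpr h)

theorem leftWeight_colMult {q : ℂ} {n : ℕ} (a b : ℂ) {lam : YoungDiagram}
    (h : lam.rowLen 0 ≤ n) :
    leftWeight q n a b (colMult lam) =
      rogersSzego q (n - lam.rowLen 0) (a * b) * hPart q lam.transpose a b /
        (qPoch q (n - lam.rowLen 0) *
          ∏ i ∈ Finset.range (lam.colLen 0), qPoch q (lam.rowLen i - lam.rowLen (i + 1))) := by
  rw [leftWeight, degree_colMult, if_pos h,
    Finsupp.prod_of_support_subset (s := Finset.range (lam.colLen 0))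
      (colMult lam) Finsupp.support_onFinset_subset _
      (fun i _ => by rw [rogersSzego_eq_hom, rogersSzegoHom_zero, rogersSzegoHom_zero, ite_self,
        qPoch_zero, div_one]), Finset.prod_div_distrib, div_mul_div_comm, hPart,
    YoungDiagram.rowLen_transpose]
  simp only [partMult_transpose, colMult_apply]

theorem leftWeight_zero_left {q : ℂ} (hq : ‖q‖ < 1) (n : ℕ) (a : ℂ) :
    leftWeight q n 0 a = leftWeight q n a 0 := by
  funext m
  simp only [leftWeight, zero_mul, mul_zero, rogersSzegoHom_zero_left hq,
    rogersSzegoHom_zero_right hq]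

/-- The product `∏_i (ζ i) ^ (m i) / (q;q)_{m i}`. -/
def dividedColPow (q : ℂ) (ζ : ℕ → ℂ) (m : ℕ →₀ ℕ) : ℂ := m.prod fun i e => ζ i ^ e / qPoch q e

theorem dividedColPow_eq_prod (q : ℂ) (ζ : ℕ → ℂ) {m : ℕ →₀ ℕ} {s : Finset ℕ}
    (hs : m.support ⊆ s) : dividedColPow q ζ m = ∏ i ∈ s, ζ i ^ m i / qPoch q (m i) :=
  Finsupp.prod_of_support_subset _ hs _ fun _ _ => by rw [pow_zero, qPoch_zero, div_one]

/-- The weight of a column of length `i + 1` at a left boundary with parameters `a, 0`. -/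
def leftColWeight (a : ℂ) (i : ℕ) : ℂ := if Even i then a else 1

theorem leftWeight_zero_right {q : ℂ} (hq : ‖q‖ < 1) {n : ℕ} (a : ℂ) {m : ℕ →₀ ℕ}
    (h : m.degree ≤ n) :
    leftWeight q n a 0 m = (qPoch q (n - m.degree))⁻¹ * dividedColPow q (leftColWeight a) m := by
  rw [leftWeight, if_pos h, mul_zero, rogersSzego_eq_hom, rogersSzegoHom_zero_right hq, one_pow,
    one_div]
  congr 1
  refine Finsupp.prod_congr fun i _ => ?_
  rw [rogersSzegoHom_zero_right hq, rogersSzego_eq_hom, rogersSzegoHom_zero_right hq, leftColWeight]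
  split_ifs <;> rfl

/-- The branching coefficients turn the multiplicative left weights of `l + k` into a product. -/
theorem dividedColPow_add_mul_branchCoeff {q : ℂ} (hq : ‖q‖ < 1) (ζ : ℕ → ℂ) (x : ℂ)
    (l k : ℕ →₀ ℕ) :
    dividedColPow q ζ (l + k) * (branchCoeff q (l + k) k * x ^ k.degree) =
      dividedColPow q ζ l * dividedColPow q (fun i => x * ζ i) k := by
  have h1 : (l + k).support ⊆ l.support ∪ k.support := Finsupp.support_add
  rw [branchCoeff_eq_prod hq h1 le_add_self, dividedColPow_eq_prod _ _ h1,
    dividedColPow_eq_prod _ _ (Finset.subset_union_left (s₂ := k.support)),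
    dividedColPow_eq_prod _ _ (Finset.subset_union_right (s₁ := l.support)), ← colPow_const,
    colPow_eq_prod _ (Finset.subset_union_right (s₁ := l.support)), ← Finset.prod_mul_distrib,
    ← Finset.prod_mul_distrib, ← Finset.prod_mul_distrib]
  refine Finset.prod_congr rfl fun i _ => ?_
  have h2 := qPoch_ne_zero hq (l i + k i)
  have h3 := qPoch_ne_zero hq (l i)
  have h4 := qPoch_ne_zero hq (k i)
  rw [Finsupp.add_apply, qBinom, Nat.add_sub_cancel_right, mul_pow, pow_add]
  field_simp

theorem dividedColPow_lengthen_add (q : ℂ) (ζ : ℕ → ℂ) (k : ℕ →₀ ℕ) (j : ℕ) :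
    dividedColPow q ζ (lengthen k + Finsupp.single 0 j) =
      dividedColPow q (fun i => ζ (i + 1)) k * (ζ 0 ^ j / qPoch q j) := by
  have hdisj : Disjoint (lengthen k).support (Finsupp.single 0 j).support := by
    refine Finset.disjoint_left.mpr fun i hi hi' => ?_
    have h0 : i = 0 := Finset.mem_singleton.mp (Finsupp.support_single_subset hi')
    rw [h0, Finsupp.mem_support_iff, lengthen_apply_zero] at hi
    exact hi rfl
  rw [dividedColPow, Finsupp.prod_add_index_of_disjoint hdisj, Finsupp.prod_single_index
    (by rw [pow_zero, qPoch_zero, div_one])]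
  congr 1
  exact Finsupp.prod_mapDomain_index_inj Nat.succ_injective

/-- A left boundary with parameters `a, 0` turns a variable into the second parameter. -/
theorem sum_dividedColPow {q : ℂ} (hq : ‖q‖ < 1) (a x : ℂ) {n : ℕ} {κ : ℕ →₀ ℕ}
    (hκ : κ.degree ≤ n) :
    ∑ j ∈ Finset.range (n - κ.degree + 1), ∑ k ∈ Finset.Iic κ,
      (qPoch q (n - κ.degree - j))⁻¹ * (dividedColPow q (leftColWeight a) (κ - k) *
        dividedColPow q (fun i => x * leftColWeight a i) (lengthen k + Finsupp.single 0 j)) =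
      leftWeight q n a x κ := by
  have h1 : ∀ j, ∑ k ∈ Finset.Iic κ,
      (qPoch q (n - κ.degree - j))⁻¹ * (dividedColPow q (leftColWeight a) (κ - k) *
        dividedColPow q (fun i => x * leftColWeight a i) (lengthen k + Finsupp.single 0 j)) =
      (1 ^ (n - κ.degree - j) / qPoch q (n - κ.degree - j) * ((a * x) ^ j / qPoch q j)) *
        κ.prod fun i e => rogersSzegoHom q e (leftColWeight a i) (x * leftColWeight a (i + 1)) /
          qPoch q e := by
    intro j
    simp only [rogersSzegoHom_div_qPoch hq]
    rw [← sum_Iic_prod fun i e j => leftColWeight a i ^ (e - j) / qPoch q (e - j) *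
      ((x * leftColWeight a (i + 1)) ^ j / qPoch q j), Finset.mul_sum]
    refine Finset.sum_congr rfl fun k hk => ?_
    have hkκ : k ≤ κ := Finset.mem_Iic.mp hk
    rw [dividedColPow_lengthen_add, dividedColPow_eq_prod (s := κ.support) _ _
      (Finsupp.support_mono tsub_le_self), dividedColPow_eq_prod (s := κ.support) _ _
      (Finsupp.support_mono hkκ), Finsupp.prod, Finset.prod_mul_distrib,
      show leftColWeight a 0 = a from if_pos Even.zero, one_pow, one_div, mul_comm x a]
    simp only [Finsupp.tsub_apply]
    ring
  rw [Finset.sum_congr rfl fun j _ => h1 j, ← Finset.sum_mul, ← rogersSzegoHom_div_qPoch hq,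
    leftWeight, if_pos hκ, rogersSzego_eq_hom]
  congr 1
  refine Finsupp.prod_congr fun i _ => ?_
  rw [leftColWeight, leftColWeight]
  by_cases hi : Even i
  · rw [if_pos hi, if_pos hi, if_neg (by rwa [Nat.even_add_one, not_not]), mul_one]
  · rw [if_neg hi, if_neg hi, if_pos (Nat.even_add_one.mpr hi), rogersSzego_eq_hom, mul_comm x a]

/-! ### Bounds for the weights -/

theorem exists_norm_bound {ι : Type*} (s : Finset ι) (f : ι → ℂ) :
    ∃ B : ℝ, 1 ≤ B ∧ ∀ i ∈ s, ‖f i‖ ≤ B := by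
  refine ⟨1 + ∑ i ∈ s, ‖f i‖, ?_, fun i hi => ?_⟩
  · have := Finset.sum_nonneg fun i (_ : i ∈ s) => norm_nonneg (f i)
    linarith
  · have := Finset.single_le_sum (fun i _ => norm_nonneg (f i)) hi
    linarith

theorem card_support_le_degree (m : ℕ →₀ ℕ) : m.support.card ≤ m.degree := by
  rw [Finset.card_eq_sum_ones, Finsupp.degree_apply]
  exact Finset.sum_le_sum fun i hi => Nat.pos_of_ne_zero (Finsupp.mem_support_iff.mp hi)

theorem norm_prod_support_le {F : ℕ → ℂ} {B : ℝ} {n : ℕ} {m : ℕ →₀ ℕ} (hB : 1 ≤ B)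
    (hm : m.degree ≤ n) (hF : ∀ i ∈ m.support, ‖F i‖ ≤ B) : ‖∏ i ∈ m.support, F i‖ ≤ B ^ n := by
  rw [norm_prod]
  refine (Finset.prod_le_prod (fun i _ => norm_nonneg _) hF).trans ?_
  rw [Finset.prod_const]
  exact pow_le_pow_right₀ hB ((card_support_le_degree m).trans hm)

theorem norm_finsuppProd_le {F : ℕ → ℕ → ℂ} {B : ℝ} {n : ℕ} {m : ℕ →₀ ℕ} (hB : 1 ≤ B)
    (hm : m.degree ≤ n) (hF : ∀ i e, e ≤ n → ‖F i e‖ ≤ B) : ‖m.prod F‖ ≤ B ^ n :=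
  norm_prod_support_le hB hm fun i _ => hF i (m i) ((Finsupp.le_degree i m).trans hm)

theorem exists_leftWeight_le (q : ℂ) (n : ℕ) (a b : ℂ) :
    ∃ B : ℝ, 0 ≤ B ∧ ∀ m, ‖leftWeight q n a b m‖ ≤ B := by
  obtain ⟨B₁, h1, hB₁⟩ := exists_norm_bound (Finset.range (n + 1)) fun e =>
    rogersSzego q e (a * b) / qPoch q e
  obtain ⟨B₂, h2, hB₂⟩ := exists_norm_bound (Finset.range (n + 1)) fun e =>
    rogersSzegoHom q e a b / qPoch q e
  have h3 : 1 ≤ max B₁ B₂ := h1.trans (le_max_left _ _)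
  refine ⟨B₁ * max B₁ B₂ ^ n, by positivity, fun m => ?_⟩
  rcases le_or_gt m.degree n with hm | hm
  · rw [leftWeight, if_pos hm, norm_mul]
    refine mul_le_mul (hB₁ _ (Finset.mem_range.mpr (by omega))) (norm_finsuppProd_le h3 hm
      fun i e he => ?_) (norm_nonneg _) (by positivity)
    have he' : e ∈ Finset.range (n + 1) := Finset.mem_range.mpr (by omega)
    split_ifs
    · exact (hB₂ e he').trans (le_max_right _ _)
    · exact (hB₁ e he').trans (le_max_left _ _)
  · rw [leftWeight_of_lt hm, norm_zero]
    positivity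

theorem exists_dividedColPow_le (q : ℂ) (n : ℕ) (u v : ℂ) :
    ∃ B : ℝ, 0 ≤ B ∧ ∀ m : ℕ →₀ ℕ, m.degree ≤ n →
      ‖dividedColPow q (fun i => if Even i then u else v) m‖ ≤ B := by
  obtain ⟨B₁, h1, hB₁⟩ := exists_norm_bound (Finset.range (n + 1)) fun e => u ^ e / qPoch q e
  obtain ⟨B₂, h2, hB₂⟩ := exists_norm_bound (Finset.range (n + 1)) fun e => v ^ e / qPoch q e
  have h3 : 1 ≤ max B₁ B₂ := h1.trans (le_max_left _ _)
  refine ⟨max B₁ B₂ ^ n, by positivity, fun m hm => norm_finsuppProd_le h3 hm fun i e he => ?_⟩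
  have he' : e ∈ Finset.range (n + 1) := Finset.mem_range.mpr (by omega)
  dsimp only
  split_ifs
  · exact (hB₁ e he').trans (le_max_left _ _)
  · exact (hB₂ e he').trans (le_max_right _ _)

theorem exists_branchCoeff_le (q : ℂ) (n : ℕ) :
    ∃ B : ℝ, 0 ≤ B ∧ ∀ m k : ℕ →₀ ℕ, m.degree ≤ n → k ≤ m → ‖branchCoeff q m k‖ ≤ B := by
  obtain ⟨B, h1, hB⟩ := exists_norm_bound (Finset.range (n + 1) ×ˢ Finset.range (n + 1)) fun e =>
    qBinom q e.1 e.2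
  refine ⟨B ^ n, by positivity, fun m k hm hk => norm_prod_support_le h1 hm fun i _ => ?_⟩
  have h2 := (Finsupp.le_degree i m).trans hm
  have h3 : k i ≤ m i := hk i
  exact hB (m i, k i) (Finset.mk_mem_product (Finset.mem_range.mpr (by omega))
    (Finset.mem_range.mpr (by omega)))

/-- The right weights decay geometrically in the size of the partition. The base of the decay is
a bound for `√|t|`, because only every second row contributes a factor `t`. -/
theorem exists_rightWeight_le (q c d : ℂ) {t : ℂ} (ht : ‖t‖ < 1) (n : ℕ) :
    ∃ ρ C : ℝ, 0 < ρ ∧ ρ < 1 ∧ 0 ≤ C ∧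
      ∀ m : ℕ →₀ ℕ, m.degree ≤ n → ‖rightWeight q t c d m‖ ≤ C * ρ ^ colSize m := by
  obtain ⟨B₁, h1, hB₁⟩ := exists_norm_bound (Finset.range (n + 1)) fun e => rogersSzegoHom q e c d
  obtain ⟨B₂, h2, hB₂⟩ := exists_norm_bound (Finset.range (n + 1)) fun e =>
    rogersSzegoHom q e t (c * d)
  have ht0 := norm_nonneg t
  have hρsq : √((1 + ‖t‖) / 2) ^ 2 = (1 + ‖t‖) / 2 := Real.sq_sqrt (by positivity)
  have hρ0 : 0 < √((1 + ‖t‖) / 2) := Real.sqrt_pos.mpr (by positivity)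
  generalize √((1 + ‖t‖) / 2) = ρ at hρsq hρ0
  have hρ1 : ρ < 1 := by nlinarith
  have hinv : 1 ≤ ρ⁻¹ := (one_le_inv₀ hρ0).mpr hρ1.le
  have h3 : 1 ≤ max B₁ B₂ * ρ⁻¹ ^ (2 * n) := by
    have h4 : 1 ≤ max B₁ B₂ := h1.trans (le_max_left _ _)
    have h5 : 1 ≤ ρ⁻¹ ^ (2 * n) := one_le_pow₀ hinv
    nlinarith
  refine ⟨ρ, (max B₁ B₂ * ρ⁻¹ ^ (2 * n)) ^ n, hρ0, hρ1, by positivity, fun m hm => ?_⟩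
  have hcol : ρ ^ colSize m = ∏ i ∈ m.support, ρ ^ (m i * (i + 1)) := by
    rw [Finset.prod_pow_eq_pow_sum, colSize, Finsupp.weight_apply]
    rfl
  have hfac : ∀ i ∈ m.support, ‖t ^ (i / 2 * m i) *
      (if Even i then rogersSzegoHom q (m i) c d else rogersSzegoHom q (m i) t (c * d))‖ ≤
        max B₁ B₂ * ρ⁻¹ ^ (2 * n) * ρ ^ (m i * (i + 1)) := by
    intro i _
    have he : m i ≤ n := (Finsupp.le_degree i m).trans hm
    have he' : m i ∈ Finset.range (n + 1) := Finset.mem_range.mpr (by omega)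
    have h4 : ‖t ^ (i / 2 * m i)‖ ≤ ρ⁻¹ ^ (2 * n) * ρ ^ (m i * (i + 1)) := by
      have h5 : ‖t‖ ≤ ρ ^ 2 := by linarith
      calc ‖t ^ (i / 2 * m i)‖ ≤ (ρ ^ 2) ^ (i / 2 * m i) := by
            rw [norm_pow]
            exact pow_le_pow_left₀ ht0 h5 _
        _ = ρ⁻¹ ^ (2 * m i) * ρ ^ (2 * (i / 2 * m i) + 2 * m i) := by
            rw [← pow_mul, pow_add, inv_pow]
            field_simp
        _ ≤ ρ⁻¹ ^ (2 * n) * ρ ^ (m i * (i + 1)) := by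
            refine mul_le_mul (pow_le_pow_right₀ hinv (by omega))
              (pow_le_pow_of_le_one hρ0.le hρ1.le ?_) (by positivity) (by positivity)
            have h6 : i + 1 ≤ 2 * (i / 2) + 2 := by omega
            calc m i * (i + 1) ≤ m i * (2 * (i / 2) + 2) := Nat.mul_le_mul_left _ h6
              _ = 2 * (i / 2 * m i) + 2 * m i := by ring
    rw [norm_mul, mul_comm, mul_assoc]
    refine mul_le_mul ?_ h4 (norm_nonneg _) (by positivity)
    split_ifs
    · exact (hB₁ _ he').trans (le_max_left _ _)
    · exact (hB₂ _ he').trans (le_max_right _ _)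
  rw [rightWeight, Finsupp.prod, norm_prod, hcol]
  refine (Finset.prod_le_prod (fun i _ => norm_nonneg _) hfac).trans ?_
  rw [Finset.prod_mul_distrib, Finset.prod_const]
  exact mul_le_mul_of_nonneg_right
    (pow_le_pow_right₀ h3 ((card_support_le_degree m).trans hm)) (by positivity)

/-! ### Absolute convergence -/

theorem summable_pow_colSize {ρ : ℝ} (h0 : 0 ≤ ρ) (h1 : ρ < 1) (n : ℕ) :
    Summable fun m : {m : ℕ →₀ ℕ // m.degree ≤ n} => ρ ^ colSize m.1 := by
  induction n with
  | zero =>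
    have : Subsingleton {m : ℕ →₀ ℕ // m.degree ≤ 0} := ⟨fun m m' => Subtype.ext (by
      rw [(Finsupp.degree_eq_zero_iff _).mp (Nat.le_zero.mp m.2),
        (Finsupp.degree_eq_zero_iff _).mp (Nat.le_zero.mp m'.2)])⟩
    exact Summable.of_finite
  | succ n ih =>
    -- A partition with at most `n + 1` columns arises by adding at most one column.
    let g : ℕ × {m : ℕ →₀ ℕ // m.degree ≤ n} → {m : ℕ →₀ ℕ // m.degree ≤ n + 1}
      | (0, m) => ⟨m.1, m.2.trans (Nat.le_succ n)⟩
      | (i + 1, m) => ⟨m.1 + Finsupp.single i 1, by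
          rw [map_add, Finsupp.degree_single]
          exact Nat.add_le_add_right m.2 1⟩
    have hg : Function.Surjective g := by
      rintro ⟨m, hm⟩
      rcases Nat.le_succ_iff.mp hm with hm' | hm'
      · exact ⟨(0, ⟨m, hm'⟩), rfl⟩
      · have hm0 : m ≠ 0 := by
          rintro rfl
          rw [map_zero] at hm'
          omega
        obtain ⟨i, hi⟩ := Finsupp.ne_iff.mp hm0
        have hi' : Finsupp.single i 1 ≤ m := Finsupp.single_le_iff.mpr (Nat.pos_of_ne_zero hi)
        have h2 : m - Finsupp.single i 1 + Finsupp.single i 1 = m := tsub_add_cancel_of_le hi'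
        refine ⟨(i + 1, ⟨m - Finsupp.single i 1, ?_⟩), Subtype.ext h2⟩
        rw [← h2, map_add, Finsupp.degree_single] at hm'
        omega
    have h2 : Summable fun p : ℕ × {m : ℕ →₀ ℕ // m.degree ≤ n} => ρ ^ colSize (g p).1 := by
      have h3 := (summable_geometric_of_lt_one h0 h1).mul_of_nonneg ih
        (fun i => pow_nonneg h0 i) fun m => pow_nonneg h0 _
      refine h3.congr fun p => ?_
      obtain ⟨i, m⟩ := p
      cases i with
      | zero => exact one_mul _
      | succ i =>
        change ρ ^ (i + 1) * ρ ^ colSize m.1 = ρ ^ colSize (m.1 + Finsupp.single i 1)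
        rw [map_add, colSize_single, one_mul, pow_add (n := i + 1), mul_comm]
    have h3 := h2.comp_injective (Function.injective_surjInv hg)
    refine h3.congr fun m => ?_
    rw [Function.comp_apply, Function.surjInv_eq hg]

/-- The function `ρ ^ |m|` on the partitions with at most `n` columns, extended by `0`. -/
def decay (n : ℕ) (ρ : ℝ) : (ℕ →₀ ℕ) → ℝ :=
  Set.indicator {m | m.degree ≤ n} fun m => ρ ^ colSize m

theorem decay_of_le {n : ℕ} {m : ℕ →₀ ℕ} (hm : m.degree ≤ n) (ρ : ℝ) :
    decay n ρ m = ρ ^ colSize m :=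
  Set.indicator_of_mem (s := {m : ℕ →₀ ℕ | m.degree ≤ n}) hm _

theorem decay_nonneg {ρ : ℝ} (h0 : 0 ≤ ρ) (n : ℕ) (m : ℕ →₀ ℕ) : 0 ≤ decay n ρ m :=
  Set.indicator_nonneg (fun _ _ => pow_nonneg h0 _) m

theorem summable_decay {ρ : ℝ} (h0 : 0 ≤ ρ) (h1 : ρ < 1) (n : ℕ) : Summable (decay n ρ) :=
  summable_subtype_iff_indicator.mp (summable_pow_colSize h0 h1 n)

theorem coe_whittakerBasis {q : ℂ} (hq : ‖q‖ < 1) : ⇑(whittakerBasis hq) = whittaker q :=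
  funext (whittakerBasis_apply hq)

theorem addAlphabet_whittaker_mem_span {q : ℂ} (hq : ‖q‖ < 1) {N : ℕ} (x : Fin N → ℂ)
    (m : ℕ →₀ ℕ) : addAlphabet x (whittaker q m) ∈
      Submodule.span ℂ (whittaker q '' {κ | ∀ i, rowOf κ i ≤ rowOf m i}) := by
  induction N with
  | zero =>
    rw [addAlphabet_zero]
    exact Submodule.subset_span ⟨m, fun i => le_rfl, rfl⟩
  | succ N ih =>
    rw [addAlphabet_succ]
    refine (Submodule.map_span_le (addVarAt (x 0)).toLinearMap _ _).mpr ?_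
      (Submodule.mem_map_of_mem (ih fun i => x i.succ))
    rintro _ ⟨κ, hκ, rfl⟩
    rw [AlgHom.toLinearMap_apply, addVarAt_whittaker hq]
    refine Submodule.sum_mem _ fun k hk => Submodule.smul_mem _ _
      (Submodule.subset_span ⟨_, fun i => ?_, rfl⟩)
    refine le_trans ?_ (hκ i)
    rw [← rowOf_branch (Finset.mem_Iic.mp hk) i]
    exact Nat.le_add_right _ _

/-- Adding variables removes boxes from a partition. -/
theorem rowOf_le_of_repr_addAlphabet_ne_zero {q : ℂ} (hq : ‖q‖ < 1) {N : ℕ} (x : Fin N → ℂ)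
    {m κ : ℕ →₀ ℕ} (h : (whittakerBasis hq).repr (addAlphabet x (whittaker q m)) κ ≠ 0) (i : ℕ) :
    rowOf κ i ≤ rowOf m i := by
  have h1 := addAlphabet_whittaker_mem_span hq x m
  generalize addAlphabet x (whittaker q m) = f at h h1
  rw [← coe_whittakerBasis hq, Module.Basis.mem_span_image] at h1
  exact h1 (Finsupp.mem_support_iff.mpr h) i

theorem degree_le_of_repr_addAlphabet_ne_zero {q : ℂ} (hq : ‖q‖ < 1) {N : ℕ} (x : Fin N → ℂ)
    {m κ : ℕ →₀ ℕ} (h : (whittakerBasis hq).repr (addAlphabet x (whittaker q m)) κ ≠ 0) :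
    κ.degree ≤ m.degree :=
  rowOf_le_of_repr_addAlphabet_ne_zero hq x h 0

/-- The weighted `ℓ¹` norm `∑_κ |a_κ| ρ^{|κ|}` of `∑_κ a_κ P_κ`. -/
def weightedNorm {q : ℂ} (hq : ‖q‖ < 1) (ρ : ℝ) (f : SymFun) : ℝ :=
  ((whittakerBasis hq).repr f).sum fun m a => ‖a‖ * ρ ^ colSize m

theorem weightedNorm_eq_sum {q : ℂ} (hq : ‖q‖ < 1) (ρ : ℝ) {f : SymFun} {s : Finset (ℕ →₀ ℕ)}
    (hs : ((whittakerBasis hq).repr f).support ⊆ s) :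
    weightedNorm hq ρ f = ∑ m ∈ s, ‖(whittakerBasis hq).repr f m‖ * ρ ^ colSize m :=
  Finsupp.sum_of_support_subset _ hs _ fun _ _ => by rw [norm_zero, zero_mul]

theorem weightedNorm_add_le {q : ℂ} (hq : ‖q‖ < 1) {ρ : ℝ} (h0 : 0 ≤ ρ) (f g : SymFun) :
    weightedNorm hq ρ (f + g) ≤ weightedNorm hq ρ f + weightedNorm hq ρ g := by
  classical
  have h1 : ((whittakerBasis hq).repr (f + g)).support ⊆
      ((whittakerBasis hq).repr f).support ∪ ((whittakerBasis hq).repr g).support := by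
    rw [map_add]
    exact Finsupp.support_add
  rw [weightedNorm_eq_sum hq ρ h1, weightedNorm_eq_sum hq ρ (Finset.subset_union_left
    (s₂ := ((whittakerBasis hq).repr g).support)), weightedNorm_eq_sum hq ρ
    (Finset.subset_union_right (s₁ := ((whittakerBasis hq).repr f).support)),
    ← Finset.sum_add_distrib]
  refine Finset.sum_le_sum fun m _ => ?_
  rw [map_add, Finsupp.add_apply, ← add_mul]
  exact mul_le_mul_of_nonneg_right (norm_add_le _ _) (pow_nonneg h0 _)

theorem weightedNorm_zero {q : ℂ} (hq : ‖q‖ < 1) (ρ : ℝ) : weightedNorm hq ρ 0 = 0 := by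
  rw [weightedNorm, map_zero, Finsupp.sum_zero_index]

theorem weightedNorm_sum_le {q : ℂ} (hq : ‖q‖ < 1) {ρ : ℝ} (h0 : 0 ≤ ρ) {ι : Type*}
    (s : Finset ι) (f : ι → SymFun) :
    weightedNorm hq ρ (∑ i ∈ s, f i) ≤ ∑ i ∈ s, weightedNorm hq ρ (f i) :=
  Finset.le_sum_of_subadditive _ (weightedNorm_zero hq ρ).le (weightedNorm_add_le hq h0) _ _

theorem weightedNorm_smul {q : ℂ} (hq : ‖q‖ < 1) (ρ : ℝ) (a : ℂ) (f : SymFun) :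
    weightedNorm hq ρ (a • f) = ‖a‖ * weightedNorm hq ρ f := by
  have h1 : ((whittakerBasis hq).repr (a • f)).support ⊆ ((whittakerBasis hq).repr f).support := by
    rw [map_smul]
    exact Finsupp.support_smul
  rw [weightedNorm_eq_sum hq ρ h1, weightedNorm, Finsupp.sum, Finset.mul_sum]
  refine Finset.sum_congr rfl fun m _ => ?_
  rw [map_smul, Finsupp.smul_apply, norm_smul, mul_assoc]

theorem weightedNorm_whittaker {q : ℂ} (hq : ‖q‖ < 1) (ρ : ℝ) (m : ℕ →₀ ℕ) :
    weightedNorm hq ρ (whittaker q m) = ρ ^ colSize m := by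
  rw [weightedNorm, ← whittakerBasis_apply hq, Module.Basis.repr_self,
    Finsupp.sum_single_index (by rw [norm_zero, zero_mul]), norm_one, one_mul]

/-- Adding a variable is bounded in the weighted norm, on the span of the `P_κ` for which `κ` has
at most `n` columns. -/
theorem exists_weightedNorm_addVarAt_le {q : ℂ} (hq : ‖q‖ < 1) {ρ : ℝ} (h0 : 0 < ρ) (n : ℕ)
    (x : ℂ) : ∃ A : ℝ, 0 ≤ A ∧ ∀ f : SymFun,
      (∀ κ, (whittakerBasis hq).repr f κ ≠ 0 → κ.degree ≤ n) →
        weightedNorm hq ρ (addVarAt x f) ≤ A * weightedNorm hq ρ f := by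
  obtain ⟨B, hB0, hB⟩ := exists_branchCoeff_le q n
  have key : ∀ m : ℕ →₀ ℕ, m.degree ≤ n → weightedNorm hq ρ (addVarAt x (whittaker q m)) ≤
      (n + 1 : ℕ) ^ n * (B * (1 + ‖x‖ / ρ) ^ n) * ρ ^ colSize m := by
    intro m hm
    rw [addVarAt_whittaker hq]
    refine (weightedNorm_sum_le hq h0.le _ _).trans ?_
    have h1 : ∀ k ∈ Finset.Iic m, weightedNorm hq ρ
        ((branchCoeff q m k * x ^ k.degree) • whittaker q (m - k + shorten k)) ≤
          B * (1 + ‖x‖ / ρ) ^ n * ρ ^ colSize m := by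
      intro k hk
      have hkm := Finset.mem_Iic.mp hk
      have h2 : k.degree ≤ n := (Finsupp.degree_mono hkm).trans hm
      have h3 : 0 ≤ ‖x‖ / ρ := by positivity
      have h4 : ‖x‖ ^ k.degree = (‖x‖ / ρ) ^ k.degree * ρ ^ k.degree := by
        rw [← mul_pow, div_mul_cancel₀ _ h0.ne']
      rw [weightedNorm_smul, weightedNorm_whittaker, norm_mul, norm_pow, h4,
        ← colSize_branch hkm, pow_add]
      have h5 : (‖x‖ / ρ) ^ k.degree ≤ (1 + ‖x‖ / ρ) ^ n :=
        (pow_le_pow_left₀ h3 (by linarith) _).trans (pow_le_pow_right₀ (by linarith) h2)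
      calc ‖branchCoeff q m k‖ * ((‖x‖ / ρ) ^ k.degree * ρ ^ k.degree) *
            ρ ^ colSize (m - k + shorten k)
          = ‖branchCoeff q m k‖ * (‖x‖ / ρ) ^ k.degree *
            (ρ ^ colSize (m - k + shorten k) * ρ ^ k.degree) := by ring
        _ ≤ _ := mul_le_mul_of_nonneg_right
            (mul_le_mul (hB m k hm hkm) h5 (by positivity) hB0) (by positivity)
    have hcard : (Finset.Iic m).card ≤ (n + 1) ^ n := by
      rw [Finsupp.card_Iic]
      have h2 : ∀ i ∈ m.support, (Finset.Iic (m i)).card ≤ n + 1 := fun i _ => by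
        rw [Nat.card_Iic]
        exact Nat.add_le_add_right ((Finsupp.le_degree i m).trans hm) 1
      exact (Finset.prod_le_pow_card m.support _ _ h2).trans
        (Nat.pow_le_pow_right n.succ_pos ((card_support_le_degree m).trans hm))
    refine (Finset.sum_le_card_nsmul _ _ _ h1).trans ?_
    rw [nsmul_eq_mul, ← mul_assoc]
    refine mul_le_mul_of_nonneg_right (mul_le_mul_of_nonneg_right ?_ (by positivity))
      (by positivity)
    exact_mod_cast hcard
  refine ⟨(n + 1 : ℕ) ^ n * (B * (1 + ‖x‖ / ρ) ^ n), by positivity, fun f hf => ?_⟩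
  conv_lhs => rw [eq_sum_whittaker hq f]
  rw [Finsupp.sum, map_sum]
  refine (weightedNorm_sum_le hq h0.le _ _).trans ?_
  rw [weightedNorm, Finsupp.sum, Finset.mul_sum]
  refine Finset.sum_le_sum fun m hm => ?_
  rw [map_smul, weightedNorm_smul, mul_left_comm]
  exact mul_le_mul_of_nonneg_left (key m (hf m (Finsupp.mem_support_iff.mp hm))) (norm_nonneg _)

theorem exists_weightedNorm_addAlphabet_le {q : ℂ} (hq : ‖q‖ < 1) {ρ : ℝ} (h0 : 0 < ρ) (n : ℕ)
    {N : ℕ} (x : Fin N → ℂ) : ∃ A : ℝ, 0 ≤ A ∧ ∀ m : ℕ →₀ ℕ, m.degree ≤ n →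
      weightedNorm hq ρ (addAlphabet x (whittaker q m)) ≤ A * ρ ^ colSize m := by
  induction N with
  | zero =>
    refine ⟨1, zero_le_one, fun m _ => ?_⟩
    rw [addAlphabet_zero, weightedNorm_whittaker, one_mul]
  | succ N ih =>
    obtain ⟨A, hA0, hA⟩ := ih fun i => x i.succ
    obtain ⟨A', hA'0, hA'⟩ := exists_weightedNorm_addVarAt_le hq h0 n (x 0)
    refine ⟨A' * A, mul_nonneg hA'0 hA0, fun m hm => ?_⟩
    rw [addAlphabet_succ, mul_assoc]
    exact (hA' _ fun κ hκ => (degree_le_of_repr_addAlphabet_ne_zero hq _ hκ).trans hm).trans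
      (mul_le_mul_of_nonneg_left (hA m hm) hA'0)

/-! ### Summation over all partitions -/

/-- The summand of `Z_n` in terms of the column multiplicities of the two partitions. -/
def zSummand {q : ℂ} (hq : ‖q‖ < 1) (n : ℕ) {N : ℕ} (x : Fin N → ℂ) (t a b c d : ℂ)
    (p : (ℕ →₀ ℕ) × (ℕ →₀ ℕ)) : ℂ :=
  leftWeight q n a b p.1 * ((whittakerBasis hq).repr (addAlphabet x (whittaker q p.1)) p.2 *
    rightWeight q t c d p.2)

theorem sum_norm_repr_mul_rightWeight_le {q : ℂ} (hq : ‖q‖ < 1) {n : ℕ} {t c d : ℂ} {ρ C : ℝ}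
    (hC : ∀ m : ℕ →₀ ℕ, m.degree ≤ n → ‖rightWeight q t c d m‖ ≤ C * ρ ^ colSize m)
    {f : SymFun} (hf : ∀ κ, (whittakerBasis hq).repr f κ ≠ 0 → κ.degree ≤ n) :
    ∑ κ ∈ ((whittakerBasis hq).repr f).support,
      ‖(whittakerBasis hq).repr f κ * rightWeight q t c d κ‖ ≤ C * weightedNorm hq ρ f := by
  rw [weightedNorm, Finsupp.sum, Finset.mul_sum]
  refine Finset.sum_le_sum fun κ hκ => ?_
  rw [norm_mul, mul_left_comm]
  exact mul_le_mul_of_nonneg_left (hC κ (hf κ (Finsupp.mem_support_iff.mp hκ))) (norm_nonneg _)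

/-- The values of `f ↦ rightFunctional (f[X + x])` on the `q`-Whittaker functions decay
geometrically. -/
theorem exists_rightFunctional_addAlphabet_le {q : ℂ} (hq : ‖q‖ < 1) {t : ℂ} (ht : ‖t‖ < 1)
    (c d : ℂ) (n : ℕ) {N : ℕ} (x : Fin N → ℂ) :
    ∃ ρ C : ℝ, 0 < ρ ∧ ρ < 1 ∧ 0 ≤ C ∧ ∀ m : ℕ →₀ ℕ, m.degree ≤ n →
      ∑ κ ∈ ((whittakerBasis hq).repr (addAlphabet x (whittaker q m))).support,
        ‖(whittakerBasis hq).repr (addAlphabet x (whittaker q m)) κ * rightWeight q t c d κ‖ ≤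
          C * ρ ^ colSize m := by
  obtain ⟨ρ, C, h0, h1, hC0, hC⟩ := exists_rightWeight_le q c d ht n
  obtain ⟨A, hA0, hA⟩ := exists_weightedNorm_addAlphabet_le hq h0 n x
  refine ⟨ρ, C * A, h0, h1, mul_nonneg hC0 hA0, fun m hm => ?_⟩
  refine (sum_norm_repr_mul_rightWeight_le hq hC fun κ hκ =>
    (degree_le_of_repr_addAlphabet_ne_zero hq x hκ).trans hm).trans ?_
  rw [mul_assoc]
  exact mul_le_mul_of_nonneg_left (hA m hm) hC0

theorem norm_rightFunctional_le {q : ℂ} (hq : ‖q‖ < 1) (t c d : ℂ) (f : SymFun) :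
    ‖rightFunctional hq t c d f‖ ≤ ∑ κ ∈ ((whittakerBasis hq).repr f).support,
      ‖(whittakerBasis hq).repr f κ * rightWeight q t c d κ‖ := by
  rw [rightFunctional_apply]
  exact norm_sum_le _ _

theorem summable_zSummand {q : ℂ} (hq : ‖q‖ < 1) {t : ℂ} (ht : ‖t‖ < 1) (n : ℕ) {N : ℕ}
    (x : Fin N → ℂ) (a b c d : ℂ) : Summable (zSummand hq n x t a b c d) := by
  obtain ⟨ρ, C, h0, h1, hC0, hC⟩ := exists_rightFunctional_addAlphabet_le hq ht c d n x
  obtain ⟨B, hB0, hB⟩ := exists_leftWeight_le q n a b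
  refine Summable.of_norm ((summable_prod_of_nonneg fun p => norm_nonneg _).mpr ?_)
  have h2 : ∀ m, ∀ κ ∉ ((whittakerBasis hq).repr (addAlphabet x (whittaker q m))).support,
      ‖zSummand hq n x t a b c d (m, κ)‖ = 0 := by
    intro m κ hκ
    rw [zSummand, Finsupp.notMem_support_iff.mp hκ, zero_mul, mul_zero, norm_zero]
  refine ⟨fun m => summable_of_ne_finset_zero (h2 m), ?_⟩
  refine Summable.of_nonneg_of_le (fun m => tsum_nonneg fun κ => norm_nonneg _) (fun m => ?_)
    ((summable_decay h0.le h1 n).mul_left (B * C))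
  rw [tsum_eq_sum (h2 m)]
  rcases le_or_gt m.degree n with hm | hm
  · simp only [zSummand, norm_mul (leftWeight q n a b m)]
    rw [← Finset.mul_sum, decay_of_le hm, mul_assoc]
    exact mul_le_mul (hB m) (hC m hm) (Finset.sum_nonneg fun κ _ => norm_nonneg _) hB0
  · rw [Finset.sum_eq_zero fun κ _ => ?_]
    · exact mul_nonneg (mul_nonneg hB0 hC0) (decay_nonneg h0.le n m)
    · rw [zSummand, leftWeight_of_lt hm, zero_mul, norm_zero]

theorem tsum_zSummand {q : ℂ} (hq : ‖q‖ < 1) {t : ℂ} (ht : ‖t‖ < 1) (n : ℕ) {N : ℕ}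
    (x : Fin N → ℂ) (a b c d : ℂ) :
    ∑' p, zSummand hq n x t a b c d p = ∑' m, leftWeight q n a b m *
      rightFunctional hq t c d (addAlphabet x (whittaker q m)) := by
  rw [(summable_zSummand hq ht n x a b c d).tsum_prod]
  refine tsum_congr fun m => ?_
  rw [rightFunctional_apply, Finsupp.sum, Finset.mul_sum]
  refine tsum_eq_sum fun κ hκ => ?_
  rw [zSummand, Finsupp.notMem_support_iff.mp hκ, zero_mul, mul_zero]

theorem zTerm_eq_zSummand {q : ℂ} (hq : ‖q‖ < 1) (n : ℕ) {N : ℕ} (x : Fin N → ℂ)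
    (t a b c d : ℂ) (p : PartitionPair n) :
    zTerm n x q t a b c d p = zSummand hq n x t a b c d (colMult p.1.1, colMult p.1.2) := by
  rw [zTerm, zSummand, leftWeight_colMult a b p.2.2, skewWhittaker_eq_repr hq,
    hPartScaled_transpose, mul_assoc]

theorem colMult_pair_injective (n : ℕ) : Function.Injective
    fun p : PartitionPair n => (colMult p.1.1, colMult p.1.2) := fun _ _ h =>
  Subtype.ext (Prod.ext (colMult_injective (Prod.ext_iff.mp h).1)
    (colMult_injective (Prod.ext_iff.mp h).2))

/-- The summands outside the range of summation of `Z_n` vanish. -/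
theorem zSummand_eq_zero {q : ℂ} (hq : ‖q‖ < 1) (n : ℕ) {N : ℕ} (x : Fin N → ℂ)
    (t a b c d : ℂ) (p : (ℕ →₀ ℕ) × (ℕ →₀ ℕ))
    (hp : p ∉ Set.range fun p : PartitionPair n => (colMult p.1.1, colMult p.1.2)) :
    zSummand hq n x t a b c d p = 0 := by
  obtain ⟨m, κ⟩ := p
  by_contra h
  refine hp ?_
  obtain ⟨lam, rfl⟩ := colMult_surjective m
  obtain ⟨μ, rfl⟩ := colMult_surjective κ
  have h1 : lam.rowLen 0 ≤ n := by
    by_contra h2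
    rw [zSummand, leftWeight_of_lt (by rw [degree_colMult]; exact not_le.mp h2), zero_mul] at h
    exact h rfl
  have h2 := left_ne_zero_of_mul (right_ne_zero_of_mul h)
  refine ⟨⟨(lam, μ), le_of_rowLen_le fun i => ?_, h1⟩, rfl⟩
  rw [← rowOf_colMult, ← rowOf_colMult]
  exact rowOf_le_of_repr_addAlphabet_ne_zero hq x h2 i

theorem summable_zTerm {q : ℂ} (hq : ‖q‖ < 1) {t : ℂ} (ht : ‖t‖ < 1) (n : ℕ) {N : ℕ}
    (x : Fin N → ℂ) (a b c d : ℂ) : Summable (zTerm n x q t a b c d) := by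
  have h := ((colMult_pair_injective n).summable_iff (zSummand_eq_zero hq n x t a b c d)).mpr
    (summable_zSummand hq ht n x a b c d)
  exact h.congr fun p => (zTerm_eq_zSummand hq n x t a b c d p).symm

theorem Z_eq_tsum {q : ℂ} (hq : ‖q‖ < 1) {t : ℂ} (ht : ‖t‖ < 1) (n : ℕ) {N : ℕ}
    (x : Fin N → ℂ) (a b c d : ℂ) :
    Z n x q t a b c d = ∑' m, leftWeight q n a b m *
      rightFunctional hq t c d (addAlphabet x (whittaker q m)) := by
  rw [← tsum_zSummand hq ht, Z, tsum_congr (zTerm_eq_zSummand hq n x t a b c d)]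
  refine (colMult_pair_injective n).tsum_eq fun p hp => ?_
  by_contra h
  exact hp (zSummand_eq_zero hq n x t a b c d p h)

/-! ### The left boundary absorbs a variable -/

theorem tsum_preimage_eq_sum {β γ δ : Type*} {f : β → ℂ} {g : β → γ} {c : γ} (s : Finset δ)
    (e : δ → β) (he : Set.InjOn e s) (hmem : ∀ i ∈ s, g (e i) = c)
    (hsurj : ∀ b, g b = c → f b ≠ 0 → ∃ i ∈ s, e i = b) :
    ∑' b : ↑(g ⁻¹' {c}), f b = ∑ i ∈ s, f (e i) := by
  classical
  rw [tsum_subtype, tsum_eq_sum (s := s.image e), Finset.sum_image he]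
  · exact Finset.sum_congr rfl fun i hi => Set.indicator_of_mem (s := g ⁻¹' {c}) (hmem i hi) f
  · intro b hb
    by_contra h
    obtain ⟨h1, h2⟩ := Set.indicator_apply_ne_zero.mp h
    obtain ⟨i, hi, rfl⟩ := hsurj b h1 h2
    exact hb (Finset.mem_image_of_mem e hi)

theorem shorten_lengthen_add_single (k : ℕ →₀ ℕ) (j : ℕ) :
    shorten (lengthen k + Finsupp.single 0 j) = k := by
  rw [map_add, shorten_single_zero, add_zero]
  ext i
  rw [shorten_apply, lengthen_apply_succ]

/-- The common refinement of the two sides of `tsum_leftWeight_addVarAt`: the pair `(l, k)` stands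
for shortening `k` of the columns of the partition `l + k`. -/
def branchSummand (q : ℂ) (n : ℕ) (a x : ℂ) (Ψ : SymFun →ₗ[ℂ] ℂ) (p : (ℕ →₀ ℕ) × (ℕ →₀ ℕ)) : ℂ :=
  if p.1.degree + p.2.degree ≤ n then
    (qPoch q (n - (p.1.degree + p.2.degree)))⁻¹ * (dividedColPow q (leftColWeight a) p.1 *
      dividedColPow q (fun i => x * leftColWeight a i) p.2) * Ψ (whittaker q (p.1 + shorten p.2))
  else 0

theorem summable_branchSummand (q : ℂ) (n : ℕ) (a x : ℂ) {Ψ : SymFun →ₗ[ℂ] ℂ} {ρ C : ℝ}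
    (h0 : 0 < ρ) (h1 : ρ < 1) (hC0 : 0 ≤ C)
    (hΨ : ∀ m : ℕ →₀ ℕ, m.degree ≤ n → ‖Ψ (whittaker q m)‖ ≤ C * ρ ^ colSize m) :
    Summable (branchSummand q n a x Ψ) := by
  obtain ⟨B₁, hB1, hB₁⟩ := exists_norm_bound (Finset.range (n + 1)) fun e => (qPoch q e)⁻¹
  obtain ⟨B₂, hB2, hB₂⟩ := exists_dividedColPow_le q n a 1
  obtain ⟨B₃, hB3, hB₃⟩ := exists_dividedColPow_le q n (x * a) x
  have hx : (fun i => x * leftColWeight a i) = fun i => if Even i then x * a else x := by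
    funext i
    rw [leftColWeight, mul_ite, mul_one]
  refine Summable.of_norm_bounded (((summable_decay h0.le h1 n).mul_of_nonneg
    (summable_decay h0.le h1 n) (decay_nonneg h0.le n) (decay_nonneg h0.le n)).mul_left
      (B₁ * (B₂ * B₃) * (C * ρ⁻¹ ^ n))) ?_
  rintro ⟨l, k⟩
  rw [branchSummand]
  split_ifs with h
  · dsimp only at h ⊢
    have hl : l.degree ≤ n := by omega
    have hk : k.degree ≤ n := by omega
    have h2 : (l + shorten k).degree ≤ n := by
      rw [map_add]
      have := degree_eq_shorten_add k
      omega
    have hinv : 1 ≤ ρ⁻¹ := (one_le_inv₀ h0).mpr h1.le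
    have h3 : ρ ^ colSize (l + shorten k) ≤ ρ⁻¹ ^ n * (ρ ^ colSize l * ρ ^ colSize k) := by
      have h4 : ρ ^ colSize (shorten k) = ρ⁻¹ ^ k.degree * ρ ^ colSize k := by
        rw [← colSize_shorten_add_degree k, pow_add, inv_pow]
        field_simp
      rw [map_add, pow_add, h4, mul_left_comm]
      exact mul_le_mul_of_nonneg_right (pow_le_pow_right₀ hinv hk) (by positivity)
    rw [decay_of_le hl, decay_of_le hk, norm_mul, norm_mul, norm_mul, hx, mul_assoc _ (C * _),
      mul_assoc C]
    refine mul_le_mul (mul_le_mul (hB₁ _ (Finset.mem_range.mpr (by omega)))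
      (mul_le_mul (hB₂ l hl) (hB₃ k hk) (norm_nonneg _) hB2) (by positivity) (by positivity))
      ((hΨ _ h2).trans (mul_le_mul_of_nonneg_left h3 hC0)) (norm_nonneg _) (by positivity)
  · rw [norm_zero]
    exact mul_nonneg (by positivity) (mul_nonneg (decay_nonneg h0.le n l) (decay_nonneg h0.le n k))

theorem tsum_branchSummand_add {q : ℂ} (hq : ‖q‖ < 1) (n : ℕ) (a x : ℂ) (Ψ : SymFun →ₗ[ℂ] ℂ)
    (m : ℕ →₀ ℕ) :
    ∑' p : ↑((fun p : (ℕ →₀ ℕ) × (ℕ →₀ ℕ) => p.1 + p.2) ⁻¹' {m}), branchSummand q n a x Ψ p =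
      leftWeight q n a 0 m * Ψ (addVarAt x (whittaker q m)) := by
  rw [tsum_preimage_eq_sum (Finset.Iic m) fun k => (m - k, k)]
  · rw [addVarAt_whittaker hq, map_sum, Finset.mul_sum]
    refine Finset.sum_congr rfl fun k hk => ?_
    have h1 : m - k + k = m := tsub_add_cancel_of_le (Finset.mem_Iic.mp hk)
    have h2 : (m - k).degree + k.degree = m.degree := by rw [← map_add, h1]
    rw [branchSummand, h2]
    split_ifs with h
    · have h3 := dividedColPow_add_mul_branchCoeff hq (leftColWeight a) x (m - k) k
      rw [h1] at h3
      rw [leftWeight_zero_right hq a h, map_smul, smul_eq_mul, ← h3]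
      ring
    · rw [leftWeight_of_lt (not_le.mp h), zero_mul]
  · exact fun k _ k' _ h => (Prod.ext_iff.mp h).2
  · exact fun k hk => tsub_add_cancel_of_le (Finset.mem_Iic.mp hk)
  · rintro ⟨l, k⟩ h _
    have h1 : l + k = m := h
    exact ⟨k, Finset.mem_Iic.mpr (h1 ▸ le_add_self), by rw [← h1, add_tsub_cancel_right]⟩

theorem tsum_branchSummand_add_shorten {q : ℂ} (hq : ‖q‖ < 1) (n : ℕ) (a x : ℂ)
    (Ψ : SymFun →ₗ[ℂ] ℂ) (κ : ℕ →₀ ℕ) :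
    ∑' p : ↑((fun p : (ℕ →₀ ℕ) × (ℕ →₀ ℕ) => p.1 + shorten p.2) ⁻¹' {κ}),
      branchSummand q n a x Ψ p = leftWeight q n a x κ * Ψ (whittaker q κ) := by
  rw [tsum_preimage_eq_sum (Finset.range (n - κ.degree + 1) ×ˢ Finset.Iic κ)
    fun i => (κ - i.2, lengthen i.2 + Finsupp.single 0 i.1)]
  · have h1 : ∀ i ∈ Finset.range (n - κ.degree + 1) ×ˢ Finset.Iic κ,
        (κ - i.2).degree + (lengthen i.2 + Finsupp.single 0 i.1).degree = κ.degree + i.1 := by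
      intro i hi
      rw [map_add Finsupp.degree (lengthen i.2), degree_lengthen, Finsupp.degree_single,
        ← add_assoc, ← map_add, tsub_add_cancel_of_le
          (Finset.mem_Iic.mp (Finset.mem_product.mp hi).2)]
    rcases le_or_gt κ.degree n with hκ | hκ
    · rw [← sum_dividedColPow hq a x hκ, ← Finset.sum_product', Finset.sum_mul]
      refine Finset.sum_congr rfl fun i hi => ?_
      have h2 : κ.degree + i.1 ≤ n := by
        have := Finset.mem_range.mp (Finset.mem_product.mp hi).1
        omega
      rw [branchSummand, h1 i hi, if_pos h2, shorten_lengthen_add_single, tsub_add_cancel_of_le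
        (Finset.mem_Iic.mp (Finset.mem_product.mp hi).2), Nat.sub_sub]
    · rw [leftWeight_of_lt hκ, zero_mul]
      refine Finset.sum_eq_zero fun i hi => ?_
      rw [branchSummand, h1 i hi, if_neg (by omega)]
  · rintro ⟨j, k⟩ _ ⟨j', k'⟩ _ h
    have h1 : lengthen k + Finsupp.single 0 j = lengthen k' + Finsupp.single 0 j' :=
      (Prod.ext_iff.mp h).2
    refine Prod.ext ?_ ?_
    · have h2 := DFunLike.congr_fun h1 0
      rwa [Finsupp.add_apply, Finsupp.add_apply, lengthen_apply_zero, lengthen_apply_zero,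
        zero_add, zero_add, Finsupp.single_eq_same, Finsupp.single_eq_same] at h2
    · have h2 := congrArg shorten h1
      rwa [shorten_lengthen_add_single, shorten_lengthen_add_single] at h2
  · intro i hi
    rw [shorten_lengthen_add_single, tsub_add_cancel_of_le
      (Finset.mem_Iic.mp (Finset.mem_product.mp hi).2)]
  · rintro ⟨l, k⟩ h h'
    have h1 : l + shorten k = κ := h
    have h2 : l.degree + k.degree ≤ n := by
      by_contra h2
      exact h' (if_neg h2)
    have h3 := degree_eq_shorten_add k
    have h4 : κ.degree = l.degree + (shorten k).degree := by rw [← h1, map_add]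
    refine ⟨(k 0, shorten k), Finset.mem_product.mpr ⟨Finset.mem_range.mpr ?_,
      Finset.mem_Iic.mpr (h1 ▸ le_add_self)⟩, ?_⟩
    · dsimp only
      omega
    · rw [lengthen_shorten_add, ← h1, add_tsub_cancel_right]

/-- Transposing the operator that adds a variable: a left boundary with one parameter absorbs the
variable as its second parameter. -/
theorem tsum_leftWeight_addVarAt {q : ℂ} (hq : ‖q‖ < 1) (n : ℕ) (a x : ℂ) {Ψ : SymFun →ₗ[ℂ] ℂ}
    {ρ C : ℝ} (h0 : 0 < ρ) (h1 : ρ < 1) (hC0 : 0 ≤ C)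
    (hΨ : ∀ m : ℕ →₀ ℕ, m.degree ≤ n → ‖Ψ (whittaker q m)‖ ≤ C * ρ ^ colSize m) :
    ∑' m, leftWeight q n a 0 m * Ψ (addVarAt x (whittaker q m)) =
      ∑' κ, leftWeight q n a x κ * Ψ (whittaker q κ) := by
  have h2 := (summable_branchSummand q n a x h0 h1 hC0 hΨ).hasSum
  have h3 := h2.tsum_fiberwise fun p => p.1 + p.2
  have h4 := h2.tsum_fiberwise fun p => p.1 + shorten p.2
  simp only [tsum_branchSummand_add hq] at h3
  simp only [tsum_branchSummand_add_shorten hq] at h4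
  rw [h3.tsum_eq, h4.tsum_eq]

theorem addAlphabet_cons_comm {N : ℕ} (x : ℂ) (y : Fin N → ℂ) (f : SymFun) :
    addAlphabet (Fin.cons x y : Fin (N + 1) → ℂ) f = addAlphabet y (addVarAt x f) := by
  have h : addAlphabet (Fin.cons x y : Fin (N + 1) → ℂ) = (addAlphabet y).comp (addVarAt x) :=
    MvPolynomial.algHom_ext fun k => by
      simp only [addVarAt, addAlphabet, AlgHom.comp_apply, MvPolynomial.aeval_X, map_add,
        MvPolynomial.algHom_C, Fin.sum_univ_succ, Fin.cons_zero, Fin.cons_succ,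
        MvPolynomial.algebraMap_eq]
      ring
  rw [h, AlgHom.comp_apply]

theorem tsum_leftWeight_addAlphabet_cons {q : ℂ} (hq : ‖q‖ < 1) {t : ℂ} (ht : ‖t‖ < 1) (n : ℕ)
    {N : ℕ} (x : Fin N → ℂ) (a b c d : ℂ) :
    ∑' m, leftWeight q n a 0 m * rightFunctional hq t c d
        (addAlphabet (Fin.cons b x : Fin (N + 1) → ℂ) (whittaker q m)) =
      ∑' m, leftWeight q n a b m *
        rightFunctional hq t c d (addAlphabet x (whittaker q m)) := by
  obtain ⟨ρ, C, h0, h1, hC0, hC⟩ := exists_rightFunctional_addAlphabet_le hq ht c d n x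
  have h2 := tsum_leftWeight_addVarAt hq n a b
    (Ψ := rightFunctional hq t c d ∘ₗ (addAlphabet x).toLinearMap) h0 h1 hC0
    fun m hm => (norm_rightFunctional_le hq t c d _).trans (hC m hm)
  simp only [addAlphabet_cons_comm]
  exact h2

/-! ### Moving the parameters into the alphabet -/

theorem evalAlphabet_congr {N M : ℕ} {x : Fin N → ℂ} {y : Fin M → ℂ}
    (h : ∀ k : ℕ, ∑ i, x i ^ k = ∑ i, y i ^ k) : evalAlphabet x = evalAlphabet y := by
  rw [evalAlphabet, evalAlphabet]
  simp only [h]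

theorem Z_congr {N M : ℕ} {x : Fin N → ℂ} {y : Fin M → ℂ}
    (h : ∀ k : ℕ, ∑ i, x i ^ k = ∑ i, y i ^ k) (n : ℕ) (q t a b c d : ℂ) :
    Z n x q t a b c d = Z n y q t a b c d := by
  simp only [Z, zTerm, skewWhittaker, evalAlphabet_congr h]

theorem sum_append_pow {N : ℕ} (v : Fin 4 → ℂ) (x : Fin N → ℂ) (k : ℕ) :
    ∑ i, Fin.append v x i ^ k = ∑ i, v i ^ k + ∑ i, x i ^ k := by
  rw [Fin.sum_univ_add]
  simp only [Fin.append_left, Fin.append_right]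

theorem Z_zero_cons_cons {q : ℂ} (hq : ‖q‖ < 1) {t : ℂ} (ht : ‖t‖ < 1) (n : ℕ) {N : ℕ}
    (x : Fin N → ℂ) (c d a b : ℂ) :
    Z n (Fin.cons a (Fin.cons b x : Fin (N + 1) → ℂ) : Fin (N + 2) → ℂ) q t 0 0 c d =
      Z n x q t a b c d := by
  rw [Z_eq_tsum hq ht, Z_eq_tsum hq ht, tsum_leftWeight_addAlphabet_cons hq ht,
    leftWeight_zero_left hq, tsum_leftWeight_addAlphabet_cons hq ht]

theorem Z_zero_zero_cons_cons {q : ℂ} (hq : ‖q‖ < 1) {t : ℂ} (ht : ‖t‖ < 1) (n : ℕ) {N : ℕ}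
    (x : Fin N → ℂ) (a b c d : ℂ) :
    Z n (Fin.cons c (Fin.cons d x : Fin (N + 1) → ℂ) : Fin (N + 2) → ℂ) q t a b 0 0 =
      Z n x q t a b c d := by
  rw [Z_eq_tsum hq ht, Z_eq_tsum hq ht]
  refine tsum_congr fun m => ?_
  have h1 := addAlphabet_succ (Fin.cons c (Fin.cons d x : Fin (N + 1) → ℂ) : Fin (N + 2) → ℂ)
    (whittaker q m)
  have h2 := addAlphabet_succ (Fin.cons d x : Fin (N + 1) → ℂ) (whittaker q m)
  simp only [Fin.cons_zero, Fin.cons_succ] at h1 h2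
  rw [h1, h2, rightFunctional_addVarAt, rightFunctional_zero_left, rightFunctional_addVarAt]

theorem Z_eq_Z_append {q : ℂ} (hq : ‖q‖ < 1) {t : ℂ} (ht : ‖t‖ < 1) (n : ℕ) {N : ℕ}
    (x : Fin N → ℂ) (v : Fin 4 → ℂ) :
    Z n x q t (v 0) (v 1) (v 2) (v 3) = Z n (Fin.append v x) q t 0 0 0 0 := by
  rw [← Z_zero_cons_cons hq ht, ← Z_zero_zero_cons_cons hq ht]
  refine Z_congr (fun k => ?_) n q t 0 0 0 0
  rw [sum_append_pow]
  simp only [Fin.sum_univ_succ, Fin.cons_zero, Fin.cons_succ, Fin.sum_univ_zero]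
  change v 2 ^ k + (v 3 ^ k + (v 0 ^ k + (v 1 ^ k + _))) =
    v 0 ^ k + (v 1 ^ k + (v 2 ^ k + (v 3 ^ k + 0))) + _
  ring

end FreeBoundary

end

theorem proposition3p1 (n N : ℕ) (x : Fin N → ℂ) (q t a b c d : ℂ)
    (hq : ‖q‖ < 1) (ht : ‖t‖ < 1) :
    Summable (FreeBoundary.zTerm n x q t a b c d) ∧
    Summable (FreeBoundary.zTerm n (Fin.append ![a, b, c, d] x) q t 0 0 0 0) ∧
    FreeBoundary.Z n x q t a b c d =
      FreeBoundary.Z n (Fin.append ![a, b, c, d] x) q t 0 0 0 0 ∧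
    ∀ σ : Equiv.Perm (Fin 4),
      FreeBoundary.Z n x q t (![a, b, c, d] (σ 0)) (![a, b, c, d] (σ 1))
          (![a, b, c, d] (σ 2)) (![a, b, c, d] (σ 3)) =
        FreeBoundary.Z n x q t a b c d := by
  refine ⟨FreeBoundary.summable_zTerm hq ht n x a b c d,
    FreeBoundary.summable_zTerm hq ht n _ 0 0 0 0,
    FreeBoundary.Z_eq_Z_append hq ht n x ![a, b, c, d], fun σ => ?_⟩
  refine (FreeBoundary.Z_eq_Z_append hq ht n x fun i => ![a, b, c, d] (σ i)).trans
    (Eq.trans ?_ (FreeBoundary.Z_eq_Z_append hq ht n x ![a, b, c, d]).symm)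
  refine FreeBoundary.Z_congr (fun k => ?_) n q t 0 0 0 0
  rw [FreeBoundary.sum_append_pow, FreeBoundary.sum_append_pow,
    Equiv.sum_comp σ fun i => ![a, b, c, d] i ^ k]
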